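/- Let $V$ be a real even polynomial of degree at least $2$ with positive leading coefficient, and let $a>0$. Consider the energy $$E(\mu_1,\mu_2)=\iint\log\tfrac1{|x-y|}\,d\mu_1(x)d\mu_1(y)+\iint\log\tfrac1{|x-y|}\,d\mu_2(x)d\mu_2(y)-\iint\log\tfrac1{|x-y|}\,d\mu_1(x)d\mu_2(y)+\int\bigl(V(x)-a|x|\bigr)d\mu_1(x)$$ on the pairs $(\mu_1,\mu_2)$ of positive measures of finite logarithmic energy such that $\mu_1$ lives on $\mathbb R$ and has total mass $1$, and $\mu_2$ lives on $i\mathbb R$, has total mass $1/2$ and satisfies $\mu_2\le\sigma$, where $\sigma$ is the measure on $i\mathbb R$ with constant density $d\sigma/|dz|=a/\pi$. Let $(\mu_1,\mu_2)$ be a minimizer of $E$ among these pairs, and write $U^{\mu}(x)=\int\log\frac1{|x-y|}\,d\mu(y)$. Suppose that $x\mapsto V(\sqrt x)$ is convex for $x>0$. Then the following hold. 1. The support of $\mu_1$ is a union of $N$ disjoint nondegenerate compact intervals, $$\operatorname{supp}(\mu_1)=\bigcup_{j=1}^N[a_j,b_j],\qquad a_1<b_1<\dots<a_N<b_N,$$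 with $N=1$ if $0\in\operatorname{supp}(\mu_1)$ and $N=2$ if $0\notin\operatorname{supp}(\mu_1)$. 2. The measure $\mu_1$ can have singular behavior only at $0$. That is, $\mu_1$ is absolutely continuous with density $$\frac{d\mu_1(x)}{dx}=h(x)\sqrt{\Bigl|\prod_{j=1}^N(b_j-x)(x-a_j)\Bigr|},\qquad x\in\operatorname{supp}(\mu_1),$$ where $h\ge 0$ on $\operatorname{supp}(\mu_1)$ and $h$ is real analytic on $\operatorname{supp}(\mu_1)\setminus\{0\}$ (including at the endpoints), and for some constant $\ell\in\mathbb R$ $$2U^{\mu_1}(x)=U^{\mu_2}(x)-V(x)+a|x|-\ell\quad\text{for } x\in\operatorname{supp}(\mu_1),$$ $$2U^{\mu_1}(x)\ge U^{\mu_2}(x)-V(x)+a|x|-\ell\quad\text{for } x\in\mathbb R\setminus\operatorname{supp}(\mu_1).$$ Moreover $h(x)>0$ for every $x\in\operatorname{supp}(\mu_1)\setminus\{0\}$, and the last inequality is strict for every $x\in\mathbb R\setminus\operatorname{supp}(\mu_1)$ with $x\ne0$. -/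

import Mathlib

open MeasureTheory Set

noncomputable section

namespace ExternalSource

/-- The image on the real axis of the complex plane of a measure on `ℝ`. -/
def onRealAxis (μ : Measure ℝ) : Measure ℂ := μ.map (fun x : ℝ => (x : ℂ))

/-- The constraint: the measure on the imaginary axis with constant density `a / π` with respect
to arc length. -/
def sigma (a : ℝ) : Measure ℂ :=
  ENNReal.ofReal (a / Real.pi) • (volume : Measure ℝ).map (fun y : ℝ => (y : ℂ) * Complex.I)

/-- The mutual logarithmic energy `∬ log (1 / |x - y|) dμ(x) dν(y)`. -/
def mutualEnergy (μ ν : Measure ℂ) : ℝ :=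
  ∫ p : ℂ × ℂ, Real.log (1 / ‖p.1 - p.2‖) ∂(μ.prod ν)

/-- Finite logarithmic energy: `log (1 / |x - y|)` is absolutely integrable against `μ × μ`.
The kernel is `+∞` on the diagonal (while `Real.log (1 / 0) = 0`), so the diagonal has to be a
null set. -/
def FiniteLogEnergy (μ : Measure ℂ) : Prop :=
  (μ.prod μ) {p : ℂ × ℂ | p.1 = p.2} = 0 ∧
    Integrable (fun p : ℂ × ℂ => Real.log (1 / ‖p.1 - p.2‖)) (μ.prod μ)

/-- The logarithmic potential `U^μ(x) = ∫ log (1 / |x - y|) dμ(y)`. -/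
def logPotential (μ : Measure ℂ) (x : ℂ) : ℝ :=
  ∫ y : ℂ, Real.log (1 / ‖x - y‖) ∂μ

/-- The pairs of measures over which the energy is minimized. The inequality `μ₂ ≤ sigma a`
forces `μ₂` to live on the imaginary axis. -/
structure Admissible (a : ℝ) (μ₁ : Measure ℝ) (μ₂ : Measure ℂ) : Prop where
  mass₁ : μ₁ univ = 1
  mass₂ : μ₂ univ = 1 / 2
  finite₁ : FiniteLogEnergy (onRealAxis μ₁)
  finite₂ : FiniteLogEnergy μ₂
  constraint : μ₂ ≤ sigma a

open Classical in
/-- The energy functional `I(μ₁) + I(μ₂) - I(μ₁, μ₂) + ∫ (V(x) - a|x|) dμ₁(x)` on admissible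
pairs. The field `V(x) - a|x|` is bounded below, so its integral is `+∞` when it is not
integrable; the other three terms are finite for admissible pairs. -/
def energy (V : Polynomial ℝ) (a : ℝ) (μ₁ : Measure ℝ) (μ₂ : Measure ℂ) : EReal :=
  if Integrable (fun x : ℝ => V.eval x - a * |x|) μ₁ then
    ((mutualEnergy (onRealAxis μ₁) (onRealAxis μ₁) + mutualEnergy μ₂ μ₂
      - mutualEnergy (onRealAxis μ₁) μ₂ + ∫ x : ℝ, (V.eval x - a * |x|) ∂μ₁ : ℝ) : EReal)
  else ⊤

/-- `(μ₁, μ₂)` solves the constrained vector equilibrium problem. -/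
def IsEquilibriumPair (V : Polynomial ℝ) (a : ℝ) (μ₁ : Measure ℝ) (μ₂ : Measure ℂ) : Prop :=
  Admissible a μ₁ μ₂ ∧
    ∀ (ν₁ : Measure ℝ) (ν₂ : Measure ℂ), Admissible a ν₁ ν₂ →
      energy V a μ₁ μ₂ ≤ energy V a ν₁ ν₂

/-- The support of `μ` is the union of the disjoint, increasingly ordered intervals
`[α j, β j]`, `j < N`, and `μ` has there the density
`h(x) √|∏ j, (β j - x) (x - α j)|` with `h` nonnegative and real analytic (also at the endpoints,
across which `h` extends), except possibly at zero. -/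
structure HasSqrtDensity (μ : Measure ℝ) (N : ℕ) (α β : Fin N → ℝ) (h : ℝ → ℝ) : Prop where
  nondegenerate : ∀ j, α j < β j
  ordered : ∀ i j, i < j → β i < α j
  support_eq : μ.support = ⋃ j, Icc (α j) (β j)
  nonneg : ∀ x ∈ μ.support, 0 ≤ h x
  analytic : AnalyticOnNhd ℝ h (μ.support \ {0})
  density : μ = (volume.restrict μ.support).withDensity
    (fun x => ENNReal.ofReal (h x * √|∏ j, (β j - x) * (x - α j)|))

/-- The right-hand side `U^{μ₂}(x) - V(x) + a|x| - ℓ` of the variational conditions for `μ₁`. -/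
def variationalRHS (V : Polynomial ℝ) (a : ℝ) (μ₂ : Measure ℂ) (ℓ : ℝ) (x : ℝ) : ℝ :=
  logPotential μ₂ x - V.eval x + a * |x| - ℓ

/-- The variational conditions on `μ₁`, with constant `ℓ`. -/
structure VariationalConditions (V : Polynomial ℝ) (a : ℝ) (μ₁ : Measure ℝ) (μ₂ : Measure ℂ)
    (ℓ : ℝ) : Prop where
  eq_on_support : ∀ x ∈ μ₁.support,
    2 * logPotential (onRealAxis μ₁) x = variationalRHS V a μ₂ ℓ x
  ge_off_support : ∀ x ∉ μ₁.support,
    2 * logPotential (onRealAxis μ₁) x ≥ variationalRHS V a μ₂ ℓ x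

/-- The points of singular behavior of `μ₁`, given the factor `h` of its density and its
variational constant `ℓ`: the points of the support where `h` is not positive, and the points
off the support where the variational inequality is not strict. -/
def singularPoints (V : Polynomial ℝ) (a : ℝ) (μ₁ : Measure ℝ) (μ₂ : Measure ℂ)
    (h : ℝ → ℝ) (ℓ : ℝ) : Set ℝ :=
  {x | x ∈ μ₁.support ∧ ¬ 0 < h x} ∪
    {x | x ∉ μ₁.support ∧
      ¬ 2 * logPotential (onRealAxis μ₁) x > variationalRHS V a μ₂ ℓ x}

end ExternalSource

end

namespace ExternalSource

open Filter Topology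

/-! ### The logarithmic kernel -/

/-! Freeze μ₂. Then μ₁ minimizes a scalar logarithmic energy in the field Q(x) = V(x) - a|x| + ∫ ½
log(x² + y²) dm(y), where m is μ₂ transported to the line (`IsEquilibriumPair.isLogMinimizer`). In
the variable s = x² this field is strictly convex. Indeed a/√s = ∫ dσ(y)/(s + y²), so besides the
convex contribution of V the s-derivative of Q is -½ ∫ d(σ - m)(y)/(s + y²). It is strictly
increasing because m ≤ σ, m is finite and σ is not (`strictMonoOn_aux`).

Support. Testing minimality against uniform measures on small intervals gives 2U + Q ≥ const, with
equality on the support. The logarithmic energy is positive definite, being a superposition of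
Gaussian energies, so the minimizer is even (`map_neg_eq`). Hence 2U = -∫ log|s - y²| dμ₁(y) is
convex in s across every gap of the support, 2U + Q is strictly convex there, and it cannot attain
its minimum at both ends (`two_mul_robin_lt`). So the support has no gap in [0, ∞), and the
inequality is strict off the support.

Density. Stationarity under x ↦ x + εφ(x) with φ(0) = 0, applied to φ(x) = x/(z² - x²), gives G(z)²
= ∫ xQ'(x)/(z² - x²) dμ₁(x) for the Stieltjes transform G. Subtracting this from Q'G cancels the
poles on the real axis. What remains is holomorphic for Re z > 0, where neither |x| nor the measure
on the imaginary axis causes a singularity (`exists_differentiableOn_eq`). So (G - A)² = D with A =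
Q'/2, and both A and D are holomorphic there and real on the positive axis. Stieltjes inversion
gives the density √max(-D, 0)/π.

Zeros of D. Suppose D has a double zero at x > 0 and write D = (z - x)²E. Then S = ∫ (x - y)⁻²
dμ₁(y) is finite, G(x) = A(x) and E(x) = (S + A'(x))². Convexity gives A'(x) ≥ A(x)/x = G(x)/x, and
evenness gives S + G(x)/x > 0. Hence D > 0 around x, and x is not in the support
(`eventually_pos_of_double_zero`). So on the positive part of the support D is negative inside and
has simple zeros at the ends, which is the square root behavior with an analytic factor h > 0. Only
the origin, on the boundary of the half-plane, escapes the argument. -/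

theorem ae_ne_of_noAtoms {X : Type*} [MeasurableSpace X] (μ : Measure X) [NullSingletonClass μ] (x : X) :
    ∀ᵐ y ∂μ, y ≠ x :=
  compl_mem_ae_iff.2 (measure_singleton x)

theorem ae_fst_ne_snd (μ ν : Measure ℝ) [SFinite μ] [SFinite ν] [NullSingletonClass ν] :
    ∀ᵐ p ∂(μ.prod ν), p.1 ≠ p.2 :=
  (Measure.ae_prod_iff_ae_ae (measurableSet_eq_fun measurable_fst measurable_snd).compl).2
    (ae_of_all _ fun x => (ae_ne_of_noAtoms ν x).mono fun _ hy => hy.symm)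

/-- Comes from ‖x - y‖ ≤ (1 + ‖x‖)(1 + ‖y‖). The bound separates the variables, so a logarithmic
moment controls the positive part of the kernel. It survives on the diagonal, where `Real.log 0 =
0`. -/
theorem log_norm_sub_le {E : Type*} [SeminormedAddCommGroup E] (x y : E) :
    Real.log ‖x - y‖ ≤ Real.log (1 + ‖x‖) + Real.log (1 + ‖y‖) := by
  have hx := norm_nonneg x
  have hy := norm_nonneg y
  rw [← Real.log_mul (by positivity) (by positivity)]
  rcases (norm_nonneg (x - y)).eq_or_lt with h | h
  · rw [← h, Real.log_zero]
    exact Real.log_nonneg (by nlinarith)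
  · exact Real.log_le_log h (by nlinarith [norm_sub_le x y])

theorem log_sub_le (x y : ℝ) :
    Real.log (x - y) ≤ Real.log (1 + |x|) + Real.log (1 + |y|) := by
  simpa [Real.norm_eq_abs] using log_norm_sub_le x y

theorem log_one_add_abs_nonneg (x : ℝ) : 0 ≤ Real.log (1 + |x|) :=
  Real.log_nonneg (by linarith [abs_nonneg x])

theorem log_one_add_le_log_two_add {t : ℝ} (ht : 0 ≤ t) :
    Real.log (1 + t) ≤ Real.log 2 + |Real.log t| := by
  rcases le_or_gt t 1 with h | h
  · have := Real.log_le_log (by linarith) (by linarith : 1 + t ≤ 2)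
    linarith [abs_nonneg (Real.log t)]
  · have := Real.log_le_log (by linarith) (by linarith : 1 + t ≤ 2 * t)
    rw [Real.log_mul (by norm_num) (by linarith)] at this
    linarith [le_abs_self (Real.log t)]

theorem continuous_log_one_add_norm {E : Type*} [SeminormedAddCommGroup E] :
    Continuous (fun x : E => Real.log (1 + ‖x‖)) :=
  Continuous.log (by fun_prop) fun x => by linarith [norm_nonneg x]

theorem continuous_log_one_add_abs : Continuous (fun x : ℝ => Real.log (1 + |x|)) :=
  continuous_log_one_add_norm (E := ℝ)

/-- Finite logarithmic energy implies a finite logarithmic moment. -/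
theorem integrable_log_one_add_norm {E : Type*} [NormedAddCommGroup E] [MeasurableSpace E]
    [BorelSpace E] [SecondCountableTopology E] {μ : Measure E} [IsFiniteMeasure μ]
    (h : Integrable (fun p : E × E => Real.log ‖p.1 - p.2‖) (μ.prod μ)) :
    Integrable (fun x => Real.log (1 + ‖x‖)) μ := by
  rcases eq_or_ne μ 0 with rfl | h0
  · simp
  have : NeBot (ae μ) := ae_neBot.2 h0
  -- By Fubini one base point x has an integrable kernel, and ‖y‖ ≤ ‖x‖ + ‖x - y‖ then controls the
  -- moment.
  obtain ⟨x, hx⟩ := h.prod_right_ae.exists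
  refine Integrable.mono' (g := fun y => Real.log (1 + ‖x‖) + (Real.log 2 + |Real.log ‖x - y‖|))
    (by fun_prop) continuous_log_one_add_norm.aestronglyMeasurable (ae_of_all _ fun y => ?_)
  have hy := norm_nonneg y
  have hxy := norm_nonneg (x - y)
  rw [Real.norm_of_nonneg (Real.log_nonneg (by linarith))]
  refine le_trans ?_ (add_le_add_right (log_one_add_le_log_two_add hxy) _)
  rw [← Real.log_mul (by positivity) (by positivity)]
  refine Real.log_le_log (by linarith) ?_
  have : ‖y‖ ≤ ‖x‖ + ‖x - y‖ := by
    calc ‖y‖ = ‖x - (x - y)‖ := by simp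
      _ ≤ _ := norm_sub_le _ _
  nlinarith [norm_nonneg x]

/-- The negative part of the logarithm. -/
noncomputable def negLog (t : ℝ) : ℝ := max (-Real.log t) 0

theorem negLog_nonneg (t : ℝ) : 0 ≤ negLog t := le_max_right _ _

theorem measurable_negLog : Measurable negLog :=
  Real.measurable_log.neg.max measurable_const

theorem abs_log_sub_le (x y : ℝ) :
    |Real.log (x - y)| ≤ Real.log (1 + |x|) + Real.log (1 + |y|) + negLog (x - y) := by
  have h1 := log_sub_le x y
  have h2 := le_max_left (-Real.log (x - y)) 0
  have h3 := negLog_nonneg (x - y)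
  have h4 := log_one_add_abs_nonneg x
  have h5 := log_one_add_abs_nonneg y
  exact abs_le.2 ⟨by unfold negLog; linarith, by linarith⟩

theorem integrable_negLog : Integrable negLog := by
  have h : negLog = (Icc (-1) 1).indicator (fun t => -Real.log t) := by
    ext t
    by_cases ht : t ∈ Icc (-1 : ℝ) 1
    · rw [indicator_of_mem ht]
      refine max_eq_left ?_
      rw [← Real.log_abs]
      linarith [Real.log_nonpos (abs_nonneg t) (abs_le.2 ht)]
    · rw [indicator_of_notMem ht]
      refine max_eq_right ?_
      rw [← Real.log_abs]
      have : 1 < |t| := by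
        by_contra! hc
        exact ht (abs_le.1 hc)
      linarith [Real.log_nonneg this.le]
  rw [h, integrable_indicator_iff measurableSet_Icc, integrableOn_Icc_iff_integrableOn_Ioc,
    ← intervalIntegrable_iff_integrableOn_Ioc_of_le (by norm_num)]
  exact intervalIntegral.intervalIntegrable_log'.neg

theorem integrable_negLog_sub_prod {μ : Measure ℝ} [IsFiniteMeasure μ] :
    Integrable (fun p : ℝ × ℝ => negLog (p.1 - p.2)) (μ.prod volume) := by
  have hm : Measurable (fun p : ℝ × ℝ => negLog (p.1 - p.2)) :=
    measurable_negLog.comp (measurable_fst.sub measurable_snd)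
  refine (integrable_prod_iff hm.aestronglyMeasurable).2
    ⟨ae_of_all _ fun x => integrable_negLog.comp_sub_left x, ?_⟩
  have : (fun x : ℝ => ∫ y, ‖negLog (x - y)‖) = fun _ => ∫ y, ‖negLog y‖ := by
    ext x
    exact integral_sub_left_eq_self (fun y => ‖negLog y‖) volume x
  simp only [this]
  exact integrable_const _

/-- The singular part of the kernel is integrated against Lebesgue measure, where its integral does
not depend on the other variable. Only the growth at infinity asks something of μ. This makes
uniform measures on intervals admissible competitors. -/
theorem integrable_log_sub_prod_restrict {μ : Measure ℝ} [IsFiniteMeasure μ]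
    (h : Integrable (fun x => Real.log (1 + |x|)) μ) (c d : ℝ) :
    Integrable (fun p : ℝ × ℝ => Real.log (p.1 - p.2)) (μ.prod (volume.restrict (Icc c d))) := by
  have h2 : Integrable (fun x => Real.log (1 + |x|)) (volume.restrict (Icc c d)) :=
    (continuous_log_one_add_abs.continuousOn).integrableOn_compact isCompact_Icc
  have h3 : Integrable (fun p : ℝ × ℝ => negLog (p.1 - p.2))
      (μ.prod (volume.restrict (Icc c d))) := by
    have := (integrable_negLog_sub_prod (μ := μ)).restrict (s := univ ×ˢ Icc c d)
    rwa [← Measure.prod_restrict, Measure.restrict_univ] at this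
  refine Integrable.mono' (((h.comp_fst _).add (h2.comp_snd _)).add h3)
    (Real.measurable_log.comp (measurable_fst.sub measurable_snd)).aestronglyMeasurable
    (ae_of_all _ fun p => ?_)
  exact abs_log_sub_le p.1 p.2

/-! ### Averages of the kernel over small intervals -/

/-- The mean of `log |x - y|` over `x ∈ [x₀ - δ, x₀ + δ]`, where `u = x₀ - y`. -/
noncomputable def logMean (u δ : ℝ) : ℝ := (2 * δ)⁻¹ * ∫ t in (u - δ)..(u + δ), Real.log t

theorem logMean_le {u δ : ℝ} (hδ : 0 < δ) (hδ1 : δ ≤ 1) : logMean u δ ≤ Real.log (1 + |u|) := by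
  have h0 := abs_nonneg u
  have : ∫ t in (u - δ)..(u + δ), Real.log t ≤ ∫ _ in (u - δ)..(u + δ), Real.log (1 + |u|) := by
    refine intervalIntegral.integral_mono_on (by linarith)
      intervalIntegral.intervalIntegrable_log' (by simp) fun t ht => ?_
    rw [← Real.log_abs]
    rcases eq_or_ne t 0 with rfl | h
    · simpa using log_one_add_abs_nonneg u
    · refine Real.log_le_log (abs_pos.2 h) ?_
      exact abs_le.2 ⟨by linarith [ht.1, neg_abs_le u], by linarith [ht.2, le_abs_self u]⟩
  rw [intervalIntegral.integral_const, smul_eq_mul] at this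
  rw [logMean, inv_mul_le_iff₀ (by linarith)]
  linarith

/-- Averaging lowers the logarithm by at most a constant, uniformly in δ, which provides a
dominating function as δ → 0. If |u| ≥ 2δ the loss is at most log 2. Otherwise the interval lies in
[-3δ, 3δ], where log(3δ) - log|t| has integral 6δ, and dividing by the length 2δ gives the constant
3. -/
theorem le_logMean {u δ : ℝ} (hδ : 0 < δ) (hu : u ≠ 0) : Real.log u - 3 ≤ logMean u δ := by
  rw [logMean, le_inv_mul_iff₀ (by linarith), ← Real.log_abs]
  have hu' := abs_pos.2 hu
  rcases le_or_gt (2 * δ) |u| with h | h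
  · have : ∫ _ in (u - δ)..(u + δ), (Real.log |u| - Real.log 2)
        ≤ ∫ t in (u - δ)..(u + δ), Real.log t := by
      refine intervalIntegral.integral_mono_on (by linarith) (by simp)
        intervalIntegral.intervalIntegrable_log' fun t ht => ?_
      rw [← Real.log_abs t, ← Real.log_div hu'.ne' (by norm_num)]
      refine Real.log_le_log (by positivity) ?_
      have h1 : |u - t| ≤ δ := abs_le.2 ⟨by linarith [ht.2], by linarith [ht.1]⟩
      have h2 := abs_sub_abs_le_abs_sub u t
      linarith
    rw [intervalIntegral.integral_const, smul_eq_mul] at this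
    have := Real.log_two_lt_d9
    nlinarith
  · have hi : ∀ c d : ℝ, IntervalIntegrable (fun t => Real.log (3 * δ) - Real.log t) volume c d :=
      fun c d => (intervalIntegrable_const).sub intervalIntegral.intervalIntegrable_log'
    have hub := abs_lt.1 h
    have h1 : ∫ t in (u - δ)..(u + δ), (Real.log (3 * δ) - Real.log t)
        ≤ ∫ t in (-(3 * δ))..(3 * δ), (Real.log (3 * δ) - Real.log t) := by
      refine intervalIntegral.integral_mono_interval (by linarith) (by linarith) (by linarith)
        ?_ (hi _ _)
      filter_upwards [ae_restrict_mem measurableSet_Ioc,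
        ae_restrict_of_ae (ae_ne_of_noAtoms volume (0 : ℝ))] with t ht h0
      rw [Pi.zero_apply, sub_nonneg, ← Real.log_abs t]
      exact Real.log_le_log (abs_pos.2 h0) (abs_le.2 ⟨ht.1.le, ht.2⟩)
    rw [intervalIntegral.integral_sub intervalIntegrable_const
      intervalIntegral.intervalIntegrable_log', intervalIntegral.integral_sub
      intervalIntegrable_const intervalIntegral.intervalIntegrable_log',
      intervalIntegral.integral_const, intervalIntegral.integral_const,
      integral_log (a := -(3 * δ)), Real.log_neg_eq_log] at h1
    simp only [smul_eq_mul] at h1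
    have h2 : Real.log |u| ≤ Real.log (3 * δ) := Real.log_le_log hu' (by linarith)
    nlinarith

theorem _root_.HasDerivAt.tendsto_symmetric_slope {Φ : ℝ → ℝ} {L u : ℝ} (h : HasDerivAt Φ L u) :
    Tendsto (fun δ => (2 * δ)⁻¹ * (Φ (u + δ) - Φ (u - δ))) (𝓝[>] 0) (𝓝 L) := by
  have h1 : HasDerivAt (fun δ : ℝ => Φ (u + δ) - Φ (u - δ)) (2 * L) 0 := by
    have e1 : HasDerivAt (fun δ : ℝ => u + δ) 1 0 := (hasDerivAt_id (0 : ℝ)).const_add u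
    have e2 : HasDerivAt (fun δ : ℝ => u - δ) (-1) 0 := (hasDerivAt_id (0 : ℝ)).const_sub u
    have f1 := HasDerivAt.comp (0 : ℝ) (h₂ := Φ) (by simpa using h) e1
    have f2 := HasDerivAt.comp (0 : ℝ) (h₂ := Φ) (by simpa using h) e2
    have := f1.sub f2
    rwa [show L * 1 - L * -1 = 2 * L by ring] at this
  have h2 := (hasDerivAt_iff_tendsto_slope_zero.1 h1).mono_left
    (nhdsWithin_mono (0 : ℝ) (fun x hx => (ne_of_gt hx : x ≠ 0)) : 𝓝[>] (0 : ℝ) ≤ 𝓝[≠] 0)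
  have h3 := h2.const_mul (1 / 2 : ℝ)
  rw [show (1 / 2 : ℝ) * (2 * L) = L by ring] at h3
  refine h3.congr fun δ => ?_
  simp only [smul_eq_mul, zero_add, add_zero, sub_zero, sub_self, mul_inv]
  ring

theorem tendsto_logMean {u : ℝ} (hu : u ≠ 0) :
    Tendsto (logMean u) (𝓝[>] 0) (𝓝 (Real.log u)) := by
  have hΦ : HasDerivAt (fun t : ℝ => t * Real.log t - t) (Real.log u) u := by
    have := (Real.hasDerivAt_mul_log hu).sub (hasDerivAt_id u)
    rwa [add_sub_cancel_right] at this
  refine hΦ.tendsto_symmetric_slope.congr fun δ => ?_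
  rw [logMean, integral_log]
  ring

end ExternalSource


namespace ExternalSource

open Filter Topology ProbabilityTheory

/-! ### Positive definiteness of the logarithmic energy -/

theorem integral_add_sub_mul {X : Type*} [MeasurableSpace X] {μ : Measure X} {f g h : X → ℝ}
    (c : ℝ) (hf : Integrable f μ) (hg : Integrable g μ) (hh : Integrable h μ) :
    Integrable (fun x => f x + g x - c * h x) μ ∧
      ∫ x, f x + g x - c * h x ∂μ = ∫ x, f x ∂μ + ∫ x, g x ∂μ - c * ∫ x, h x ∂μ := by
  refine ⟨(hf.add hg).sub (hh.const_mul c), ?_⟩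
  have hfg : Integrable (fun x => f x + g x) μ := hf.add hg
  rw [integral_sub hfg (hh.const_mul c), integral_const_mul, integral_add hf hg]

theorem integrableOn_exp_sub_exp {b : ℝ} (hb : 0 < b) :
    IntegrableOn (fun t : ℝ => t⁻¹ * (Real.exp (-(b * t)) - Real.exp (-t))) (Ioi 0) := by
  have hc : 0 < min b 1 := lt_min hb one_pos
  refine Integrable.mono' (g := fun t => |b - 1| * Real.exp (-min b 1 * t))
    ((integrableOn_exp_mul_Ioi (neg_lt_zero.2 hc) 0).const_mul _)
    (by fun_prop) ?_
  filter_upwards [ae_restrict_mem measurableSet_Ioi] with t ht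
  rw [mem_Ioi] at ht
  rw [norm_mul, Real.norm_eq_abs, abs_of_pos (inv_pos.2 ht), inv_mul_le_iff₀ ht, Real.norm_eq_abs]
  have key : ∀ p q : ℝ, p ≤ q → 0 ≤ Real.exp (-(p * t)) - Real.exp (-(q * t)) ∧
      Real.exp (-(p * t)) - Real.exp (-(q * t)) ≤ t * ((q - p) * Real.exp (-p * t)) := by
    intro p q hpq
    have h1 : Real.exp (-(q * t)) = Real.exp (-(p * t)) * Real.exp (-((q - p) * t)) := by
      rw [← Real.exp_add]; ring_nf
    have h2 := Real.add_one_le_exp (-((q - p) * t))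
    have h3 := Real.exp_pos (-(p * t))
    constructor
    · exact sub_nonneg.2 (Real.exp_le_exp.2 (by nlinarith))
    · rw [h1, neg_mul]
      nlinarith
  rcases le_total b 1 with h | h
  · have := key b 1 h
    rw [one_mul] at this
    rw [abs_of_nonneg this.1, min_eq_left h, abs_of_nonpos (by linarith)]
    linarith [this.2]
  · have := key 1 b h
    rw [one_mul] at this
    rw [abs_of_nonpos (by linarith), min_eq_right h, abs_of_nonneg (by linarith)]
    linarith [this.2]

/-- Frullani's integral. With b = (x - y)² it writes the logarithmic kernel as a superposition of
Gaussian kernels, up to a term independent of x and y. -/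
theorem integral_exp_sub_exp {b : ℝ} (hb : 0 < b) :
    ∫ t in Ioi 0, t⁻¹ * (Real.exp (-(b * t)) - Real.exp (-t)) = -Real.log b := by
  have h := Frullani.integral_Ioi_eq (f := fun t => Real.exp (-t)) (a := b) (b := 1) (L := 1)
    (R := 0) ((by fun_prop : Continuous fun t : ℝ => Real.exp (-t)).locallyIntegrable.locallyIntegrableOn _) hb one_pos
    (by
      have : Continuous fun t : ℝ => Real.exp (-t) := by fun_prop
      simpa using (this.tendsto 0).mono_left nhdsWithin_le_nhds)
    (Real.tendsto_exp_neg_atTop_nhds_zero)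
    (by simpa using integrableOn_exp_sub_exp hb)
  simpa [Real.log_inv] using h

/-- The integrand has a constant sign, decided by whether b ≤ 1, so no cancellation occurs.
Integrability of the logarithm is therefore exactly what Fubini needs. -/
theorem integral_norm_exp_sub_exp {b : ℝ} (hb : 0 < b) :
    ∫ t in Ioi 0, ‖t⁻¹ * (Real.exp (-(b * t)) - Real.exp (-t))‖ = |Real.log b| := by
  rcases le_total b 1 with h | h
  · rw [abs_of_nonpos (Real.log_nonpos hb.le h), ← integral_exp_sub_exp hb]
    refine setIntegral_congr_fun measurableSet_Ioi fun t ht => Real.norm_of_nonneg ?_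
    rw [mem_Ioi] at ht
    exact mul_nonneg (inv_pos.2 ht).le (sub_nonneg.2 (Real.exp_le_exp.2 (by nlinarith)))
  · rw [abs_of_nonneg (Real.log_nonneg h), ← neg_eq_iff_eq_neg.2 (integral_exp_sub_exp hb),
      ← integral_neg]
    refine setIntegral_congr_fun measurableSet_Ioi fun t ht => Real.norm_of_nonpos ?_
    rw [mem_Ioi] at ht
    exact mul_nonpos_of_nonneg_of_nonpos (inv_pos.2 ht).le
      (sub_nonpos.2 (Real.exp_le_exp.2 (by nlinarith)))

/-- The Gaussian mutual energy at scale `t`. -/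
noncomputable def gaussEnergy (π : Measure (ℝ × ℝ)) (t : ℝ) : ℝ :=
  ∫ p, Real.exp (-((p.1 - p.2) ^ 2 * t)) ∂π

theorem integrable_gauss_prod {π : Measure (ℝ × ℝ)} [SFinite π]
    (hd : ∀ᵐ p ∂π, p.1 ≠ p.2)
    (hi : Integrable (fun p : ℝ × ℝ => Real.log (p.1 - p.2)) π) :
    Integrable (fun q : (ℝ × ℝ) × ℝ =>
      q.2⁻¹ * (Real.exp (-((q.1.1 - q.1.2) ^ 2 * q.2)) - Real.exp (-q.2)))
      (π.prod (volume.restrict (Ioi 0))) := by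
  refine (integrable_prod_iff (by fun_prop)).2 ⟨?_, ?_⟩
  · filter_upwards [hd] with p hp
    exact integrableOn_exp_sub_exp (by have := sub_ne_zero.2 hp; positivity)
  · refine (hi.norm.const_mul 2).congr ?_
    filter_upwards [hd] with p hp
    have := sub_ne_zero.2 hp
    rw [integral_norm_exp_sub_exp (by positivity), Real.log_pow, abs_mul, Real.norm_eq_abs]
    simp

theorem integrableOn_gaussEnergy {π : Measure (ℝ × ℝ)} [IsProbabilityMeasure π]
    (hd : ∀ᵐ p ∂π, p.1 ≠ p.2)
    (hi : Integrable (fun p : ℝ × ℝ => Real.log (p.1 - p.2)) π) :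
    IntegrableOn (fun t => t⁻¹ * (gaussEnergy π t - Real.exp (-t))) (Ioi 0) := by
  refine (integrable_gauss_prod hd hi).integral_prod_right.congr ?_
  filter_upwards [ae_restrict_mem measurableSet_Ioi] with t ht
  rw [mem_Ioi] at ht
  rw [integral_const_mul, integral_sub _ (integrable_const _), gaussEnergy]
  · simp
  · refine Integrable.of_bound (by fun_prop) 1 (ae_of_all _ fun p => ?_)
    rw [Real.norm_of_nonneg (Real.exp_pos _).le, Real.exp_le_one_iff]
    have : 0 ≤ (p.1 - p.2) ^ 2 * t := by positivity
    linarith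

theorem integral_gaussEnergy {π : Measure (ℝ × ℝ)} [IsProbabilityMeasure π]
    (hd : ∀ᵐ p ∂π, p.1 ≠ p.2)
    (hi : Integrable (fun p : ℝ × ℝ => Real.log (p.1 - p.2)) π) :
    ∫ t in Ioi 0, t⁻¹ * (gaussEnergy π t - Real.exp (-t)) =
      -2 * ∫ p, Real.log (p.1 - p.2) ∂π := by
  have h1 := integral_prod _ (integrable_gauss_prod hd hi)
  rw [integral_prod_symm _ (integrable_gauss_prod hd hi)] at h1
  rw [← integral_const_mul]
  refine Eq.trans ?_ (h1.trans ?_)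
  · refine setIntegral_congr_fun measurableSet_Ioi fun t ht => ?_
    rw [mem_Ioi] at ht
    dsimp only
    rw [integral_const_mul, integral_sub _ (integrable_const _), gaussEnergy]
    · simp
    · refine Integrable.of_bound (by fun_prop) 1 (ae_of_all _ fun p => ?_)
      rw [Real.norm_of_nonneg (Real.exp_pos _).le, Real.exp_le_one_iff]
      have : 0 ≤ (p.1 - p.2) ^ 2 * t := by positivity
      linarith
  · refine integral_congr_ae ?_
    filter_upwards [hd] with p hp
    have := sub_ne_zero.2 hp
    rw [integral_exp_sub_exp (by positivity), Real.log_pow]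
    simp

/-- The Gaussian kernel is the characteristic function of a Gaussian. The variance v corresponds to
the scale v/2 because that function is exp(-v t²/2). Positive definiteness becomes visible on the
side of characteristic functions. -/
theorem gaussEnergy_eq_integral_charFun (μ ν : Measure ℝ) [IsProbabilityMeasure μ]
    [IsProbabilityMeasure ν] (v : NNReal) :
    Integrable (fun ξ => (charFun μ ξ * starRingEnd ℂ (charFun ν ξ)).re) (gaussianReal 0 v) ∧
    ∫ ξ, (charFun μ ξ * starRingEnd ℂ (charFun ν ξ)).re ∂(gaussianReal 0 v) =
      gaussEnergy (μ.prod ν) (v / 2) := by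
  have h1 : ∀ ξ, charFun μ ξ * starRingEnd ℂ (charFun ν ξ) =
      ∫ p : ℝ × ℝ, Complex.exp ((p.1 - p.2) * ξ * Complex.I) ∂(μ.prod ν) := by
    intro ξ
    rw [charFun_apply_real, ← charFun_neg, charFun_apply_real, ← integral_prod_mul]
    refine integral_congr_ae (ae_of_all _ fun p => ?_)
    simp only
    rw [← Complex.exp_add]
    congr 1
    push_cast
    ring
  have hb : ∀ x y ξ : ℝ, ‖Complex.exp ((x - y) * ξ * Complex.I)‖ = 1 := fun x y ξ => by
    exact_mod_cast Complex.norm_exp_ofReal_mul_I ((x - y) * ξ)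
  have h2 : Integrable (fun q : ℝ × (ℝ × ℝ) => Complex.exp ((q.2.1 - q.2.2) * q.1 * Complex.I))
      ((gaussianReal 0 v).prod (μ.prod ν)) :=
    Integrable.of_bound (by fun_prop) 1 (ae_of_all _ fun q => (hb _ _ _).le)
  simp_rw [h1]
  refine ⟨h2.integral_prod_left.re, ?_⟩
  have h3 := integral_re h2.integral_prod_left
  simp only [RCLike.re_eq_complex_re] at h3
  rw [h3, ← integral_prod _ h2, integral_prod_symm _ h2, gaussEnergy]
  have h4 : ∀ p : ℝ × ℝ, ∫ ξ : ℝ, Complex.exp ((p.1 - p.2) * ξ * Complex.I) ∂(gaussianReal 0 v) =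
      ((Real.exp (-((p.1 - p.2) ^ 2 * (v / 2))) : ℝ) : ℂ) := by
    intro p
    have := charFun_gaussianReal (μ := 0) (v := v) (p.1 - p.2)
    rw [charFun_apply_real] at this
    push_cast at this ⊢
    rw [this]
    congr 1
    ring
  simp_rw [h4]
  rw [integral_complex_ofReal, Complex.ofReal_re]

/-- The energy of μ - ν is an integral over the scales t > 0 of Gaussian-weighted L² norms of the
difference of characteristic functions. The hypothesis makes it nonpositive, so almost every such
norm vanishes. A single scale is enough, since the weight is positive and characteristic functions
are continuous. -/
theorem eq_of_energy_le {μ ν : Measure ℝ} [IsProbabilityMeasure μ] [IsProbabilityMeasure ν]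
    [NullSingletonClass μ] [NullSingletonClass ν]
    (hμ : Integrable (fun p : ℝ × ℝ => Real.log (p.1 - p.2)) (μ.prod μ))
    (hν : Integrable (fun p : ℝ × ℝ => Real.log (p.1 - p.2)) (ν.prod ν))
    (hμν : Integrable (fun p : ℝ × ℝ => Real.log (p.1 - p.2)) (μ.prod ν))
    (h : 2 * ∫ p, Real.log (p.1 - p.2) ∂(μ.prod ν) ≤
      ∫ p, Real.log (p.1 - p.2) ∂(μ.prod μ) + ∫ p, Real.log (p.1 - p.2) ∂(ν.prod ν)) :
    μ = ν := by
  have nonneg : ∀ t : ℝ, 0 < t → ∃ v : NNReal, v ≠ 0 ∧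
      Integrable (fun ξ => ‖charFun μ ξ - charFun ν ξ‖ ^ 2) (gaussianReal 0 v) ∧
      ∫ ξ, ‖charFun μ ξ - charFun ν ξ‖ ^ 2 ∂(gaussianReal 0 v) =
      gaussEnergy (μ.prod μ) t + gaussEnergy (ν.prod ν) t - 2 * gaussEnergy (μ.prod ν) t := by
    intro t ht
    refine ⟨Real.toNNReal (2 * t), (Real.toNNReal_pos.2 (by positivity)).ne', ?_⟩
    set v := Real.toNNReal (2 * t) with hv0
    have hv : (v : ℝ) / 2 = t := by rw [hv0, Real.coe_toNNReal _ (by positivity)]; ring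
    obtain ⟨i1, e1⟩ := gaussEnergy_eq_integral_charFun μ μ v
    obtain ⟨i2, e2⟩ := gaussEnergy_eq_integral_charFun ν ν v
    obtain ⟨i3, e3⟩ := gaussEnergy_eq_integral_charFun μ ν v
    rw [hv] at e1 e2 e3
    have hS : ∀ ξ, ‖charFun μ ξ - charFun ν ξ‖ ^ 2 =
        (charFun μ ξ * starRingEnd ℂ (charFun μ ξ)).re
        + (charFun ν ξ * starRingEnd ℂ (charFun ν ξ)).re
        - 2 * (charFun μ ξ * starRingEnd ℂ (charFun ν ξ)).re := by
      intro ξ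
      rw [← Complex.normSq_eq_norm_sq, Complex.normSq_sub, Complex.mul_conj, Complex.mul_conj,
        Complex.ofReal_re, Complex.ofReal_re]
    simp_rw [hS]
    have := integral_add_sub_mul 2 i1 i2 i3
    rwa [e1, e2, e3] at this
  obtain ⟨hint, hval⟩ := integral_add_sub_mul 2 (integrableOn_gaussEnergy (ae_fst_ne_snd μ μ) hμ)
    (integrableOn_gaussEnergy (ae_fst_ne_snd ν ν) hν) (integrableOn_gaussEnergy (ae_fst_ne_snd μ ν) hμν)
  rw [integral_gaussEnergy (ae_fst_ne_snd μ μ) hμ, integral_gaussEnergy (ae_fst_ne_snd ν ν) hν,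
    integral_gaussEnergy (ae_fst_ne_snd μ ν) hμν] at hval
  -- The subtracted exponentials, needed for convergence of the separate integrals, cancel because
  -- both measures have mass one.
  have hsum : ∀ t : ℝ, t⁻¹ * (gaussEnergy (μ.prod μ) t - Real.exp (-t))
      + t⁻¹ * (gaussEnergy (ν.prod ν) t - Real.exp (-t))
      - 2 * (t⁻¹ * (gaussEnergy (μ.prod ν) t - Real.exp (-t))) =
      t⁻¹ * (gaussEnergy (μ.prod μ) t + gaussEnergy (ν.prod ν) t
        - 2 * gaussEnergy (μ.prod ν) t) := fun t => by ring
  simp_rw [hsum] at hint hval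
  have hnn : 0 ≤ᵐ[volume.restrict (Ioi 0)] fun t : ℝ =>
      t⁻¹ * (gaussEnergy (μ.prod μ) t + gaussEnergy (ν.prod ν) t
        - 2 * gaussEnergy (μ.prod ν) t) := by
    filter_upwards [ae_restrict_mem measurableSet_Ioi] with t ht
    obtain ⟨v, -, -, he⟩ := nonneg t ht
    rw [← he]
    exact mul_nonneg (inv_pos.2 ht).le (integral_nonneg fun ξ => by positivity)
  have hzero := (integral_eq_zero_iff_of_nonneg_ae hnn hint).1
    (le_antisymm (hval.trans_le (by linarith)) (integral_nonneg_of_ae hnn))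
  have hne : NeBot (ae (volume.restrict (Ioi (0 : ℝ)))) := by
    rw [ae_neBot, Ne, Measure.restrict_eq_zero]
    simp
  obtain ⟨t, ht0, ht⟩ := (hzero.and (ae_restrict_mem measurableSet_Ioi)).exists
  obtain ⟨v, hv, hvi, he⟩ := nonneg t ht
  simp only [Pi.zero_apply] at ht0
  rw [← he, mul_eq_zero, or_iff_right (inv_pos.2 ht).ne'] at ht0
  have h0 := (integral_eq_zero_iff_of_nonneg (fun ξ => by positivity) hvi).1 ht0
  have h1 : charFun μ =ᵐ[volume] charFun ν := by
    filter_upwards [(gaussianReal_absolutelyContinuous' 0 hv).ae_le h0] with ξ hξ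
    simpa [sub_eq_zero] using hξ
  refine Measure.ext_of_charFun ?_
  exact (Continuous.ae_eq_iff_eq volume continuous_charFun continuous_charFun).1 h1

end ExternalSource


namespace ExternalSource

open Filter Topology

/-! ### Variational conditions for minimizers of the weighted logarithmic energy -/

/-- `μ` minimizes the weighted logarithmic energy `∬ log (1 / |x - y|) + ∫ Q` among the probability
measures on the line of finite energy. -/
structure IsLogMinimizer (Q : ℝ → ℝ) (μ : Measure ℝ) : Prop where
  isProb : IsProbabilityMeasure μ
  noAtoms : NullSingletonClass μ
  integrable_log : Integrable (fun p : ℝ × ℝ => Real.log (p.1 - p.2)) (μ.prod μ)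
  integrable_field : Integrable Q μ
  minimal : ∀ ν : Measure ℝ, IsProbabilityMeasure ν → NullSingletonClass ν →
    Integrable (fun p : ℝ × ℝ => Real.log (p.1 - p.2)) (ν.prod ν) → Integrable Q ν →
    -∫ p, Real.log (p.1 - p.2) ∂(μ.prod μ) + ∫ x, Q x ∂μ ≤
      -∫ p, Real.log (p.1 - p.2) ∂(ν.prod ν) + ∫ x, Q x ∂ν

/-- The logarithmic potential of a measure on the line. -/
noncomputable def pot (μ : Measure ℝ) (x : ℝ) : ℝ := -∫ y, Real.log (x - y) ∂μ

/-- The constant in the variational conditions. -/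
noncomputable def robin (Q : ℝ → ℝ) (μ : Measure ℝ) : ℝ :=
  -2 * ∫ p, Real.log (p.1 - p.2) ∂(μ.prod μ) + ∫ x, Q x ∂μ

theorem integrable_log_sub_swap {μ ν : Measure ℝ} [SFinite μ] [SFinite ν]
    (h : Integrable (fun p : ℝ × ℝ => Real.log (p.1 - p.2)) (μ.prod ν)) :
    Integrable (fun p : ℝ × ℝ => Real.log (p.1 - p.2)) (ν.prod μ) ∧
      ∫ p, Real.log (p.1 - p.2) ∂(ν.prod μ) = ∫ p, Real.log (p.1 - p.2) ∂(μ.prod ν) := by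
  have e : (fun p : ℝ × ℝ => Real.log (p.swap.1 - p.swap.2)) =
      fun p => Real.log (p.1 - p.2) := by
    ext p
    rw [Prod.fst_swap, Prod.snd_swap, ← neg_sub, Real.log_neg_eq_log]
  have h1 := h.swap
  have h2 := integral_prod_swap (μ := μ) (ν := ν) (fun p : ℝ × ℝ => Real.log (p.1 - p.2))
  simp only [Function.comp_def, e] at h1
  rw [e] at h2
  exact ⟨h1, h2⟩

theorem integral_prod_mix {μ ν : Measure ℝ} [SFinite μ] [SFinite ν] {f : ℝ × ℝ → ℝ} {s t : ℝ}
    (hs : 0 ≤ s) (ht : 0 ≤ t) (h1 : Integrable f (μ.prod μ)) (h2 : Integrable f (μ.prod ν))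
    (h3 : Integrable f (ν.prod μ)) (h4 : Integrable f (ν.prod ν)) :
    let M := ENNReal.ofReal s • μ + ENNReal.ofReal t • ν
    Integrable f (M.prod M) ∧ ∫ p, f p ∂(M.prod M) =
      s * (s * ∫ p, f p ∂(μ.prod μ)) + t * (s * ∫ p, f p ∂(ν.prod μ)) +
      (s * (t * ∫ p, f p ∂(μ.prod ν)) + t * (t * ∫ p, f p ∂(ν.prod ν))) := by
  intro M
  have e : M.prod M = ENNReal.ofReal s • ENNReal.ofReal s • μ.prod μ
      + ENNReal.ofReal t • ENNReal.ofReal s • ν.prod μ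
      + (ENNReal.ofReal s • ENNReal.ofReal t • μ.prod ν
      + ENNReal.ofReal t • ENNReal.ofReal t • ν.prod ν) := by
    simp only [M, Measure.prod_add, Measure.add_prod, Measure.prod_smul_left,
      Measure.prod_smul_right]
    rw [smul_add, smul_add, smul_comm (ENNReal.ofReal t) (ENNReal.ofReal s) (ν.prod μ),
      smul_comm (ENNReal.ofReal t) (ENNReal.ofReal s) (μ.prod ν)]
  have hi : ∀ {π : Measure (ℝ × ℝ)} (u v : ℝ), Integrable f π →
      Integrable f (ENNReal.ofReal u • ENNReal.ofReal v • π) := fun u v h =>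
    (h.smul_measure ENNReal.ofReal_ne_top).smul_measure ENNReal.ofReal_ne_top
  rw [e]
  refine ⟨((hi _ _ h1).add_measure (hi _ _ h3)).add_measure
    ((hi _ _ h2).add_measure (hi _ _ h4)), ?_⟩
  rw [integral_add_measure ((hi _ _ h1).add_measure (hi _ _ h3))
    ((hi _ _ h2).add_measure (hi _ _ h4)), integral_add_measure (hi _ _ h1) (hi _ _ h3),
    integral_add_measure (hi _ _ h2) (hi _ _ h4)]
  simp only [integral_smul_measure, ENNReal.toReal_ofReal hs, ENNReal.toReal_ofReal ht,
    smul_eq_mul]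

namespace IsLogMinimizer

variable {Q : ℝ → ℝ} {μ : Measure ℝ}

theorem integrable_log_one_add (h : IsLogMinimizer Q μ) :
    Integrable (fun x => Real.log (1 + |x|)) μ := by
  have := h.isProb
  refine integrable_log_one_add_norm (E := ℝ) (h.integrable_log.congr (ae_of_all _ fun p => ?_))
  simp

/-- First variation in the direction of another measure of finite energy. -/
theorem robin_le (h : IsLogMinimizer Q μ) {ν : Measure ℝ} [IsProbabilityMeasure ν]
    [NullSingletonClass ν] (h1 : Integrable (fun p : ℝ × ℝ => Real.log (p.1 - p.2)) (ν.prod ν))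
    (h2 : Integrable (fun p : ℝ × ℝ => Real.log (p.1 - p.2)) (μ.prod ν)) (h3 : Integrable Q ν) :
    robin Q μ ≤ -2 * ∫ p, Real.log (p.1 - p.2) ∂(μ.prod ν) + ∫ x, Q x ∂ν := by
  have := h.isProb
  have := h.noAtoms
  obtain ⟨h2', e2⟩ := integrable_log_sub_swap h2
  set X := ∫ p, Real.log (p.1 - p.2) ∂(μ.prod μ) with hX
  set Y := ∫ p, Real.log (p.1 - p.2) ∂(μ.prod ν) with hY
  set Z := ∫ p, Real.log (p.1 - p.2) ∂(ν.prod ν) with hZ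
  set q := ∫ x, Q x ∂μ with hq
  set r := ∫ x, Q x ∂ν with hr
  -- This is the increment of the energy from μ to (1 - t)μ + tν, divided by t. Its limit at t = 0
  -- is the first variation.
  have key : ∀ t ∈ Ioo (0 : ℝ) 1, 0 ≤ 2 * X - 2 * Y + r - q + t * (2 * Y - X - Z) := by
    intro t ht
    have ht1 : 0 ≤ 1 - t := by linarith [ht.2]
    obtain ⟨i, e⟩ := integral_prod_mix ht1 ht.1.le h.integrable_log h2 h2' h1
    set M := ENNReal.ofReal (1 - t) • μ + ENNReal.ofReal t • ν with hM
    have hp : IsProbabilityMeasure M := ⟨by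
      simp only [hM, Measure.coe_add, Measure.coe_smul, Pi.add_apply, Pi.smul_apply, measure_univ,
        smul_eq_mul, mul_one]
      rw [← ENNReal.ofReal_add ht1 ht.1.le]
      simp⟩
    have hn : NullSingletonClass M := ⟨fun x => by simp [hM]⟩
    have j1 : Integrable Q (ENNReal.ofReal (1 - t) • μ) :=
      h.integrable_field.smul_measure ENNReal.ofReal_ne_top
    have j2 : Integrable Q (ENNReal.ofReal t • ν) := h3.smul_measure ENNReal.ofReal_ne_top
    have hmin := h.minimal M hp hn i (j1.add_measure j2)
    rw [e, e2, hM, integral_add_measure j1 j2, integral_smul_measure, integral_smul_measure,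
      ENNReal.toReal_ofReal ht1, ENNReal.toReal_ofReal ht.1.le, smul_eq_mul, smul_eq_mul,
      ← hX, ← hY, ← hZ, ← hq, ← hr] at hmin
    have : 0 ≤ t * (2 * X - 2 * Y + r - q + t * (2 * Y - X - Z)) := by linarith
    exact nonneg_of_mul_nonneg_right this ht.1
  have hlim : Tendsto (fun t : ℝ => 2 * X - 2 * Y + r - q + t * (2 * Y - X - Z)) (𝓝[>] 0)
      (𝓝 (2 * X - 2 * Y + r - q + 0 * (2 * Y - X - Z))) :=
    (Continuous.tendsto (by fun_prop) 0).mono_left nhdsWithin_le_nhds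
  have := ge_of_tendsto hlim (by filter_upwards [Ioo_mem_nhdsGT one_pos] with t ht using key t ht)
  rw [robin, ← hX, ← hq]
  linarith

/-- A point mass at x has infinite energy, so the first variation is taken towards uniform measures
on [x - δ, x + δ] and δ is sent to 0. -/
theorem robin_le_pot (h : IsLogMinimizer Q μ) (hQ : Continuous Q) {x : ℝ}
    (hx : Integrable (fun y => Real.log (x - y)) μ) : robin Q μ ≤ 2 * pot μ x + Q x := by
  have := h.isProb
  have := h.noAtoms
  have hlog := h.integrable_log_one_add
  -- the uniform measures on small intervals
  let lam : ℝ → Measure ℝ := fun δ =>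
    ENNReal.ofReal (2 * δ)⁻¹ • volume.restrict (Icc (x - δ) (x + δ))
  have hint : ∀ (f : ℝ → ℝ) {δ : ℝ}, 0 < δ →
      ∫ t, f t ∂(lam δ) = (2 * δ)⁻¹ * ∫ t in (x - δ)..(x + δ), f t := by
    intro f δ hδ
    rw [integral_smul_measure, ENNReal.toReal_ofReal (by positivity), smul_eq_mul,
      integral_Icc_eq_integral_Ioc, intervalIntegral.integral_of_le (by linarith)]
  have hlogmean : ∀ {δ : ℝ}, 0 < δ → ∀ y,
      ∫ t, Real.log (y - t) ∂(lam δ) = logMean (x - y) δ := by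
    intro δ hδ y
    rw [hint _ hδ, logMean]
    have h1 : ∀ t : ℝ, Real.log (y - t) = Real.log (t - y) := fun t => by
      rw [← neg_sub, Real.log_neg_eq_log]
    simp_rw [h1]
    rw [intervalIntegral.integral_comp_sub_right (fun t => Real.log t) y]
    ring_nf
  have step : ∀ δ ∈ Ioc (0 : ℝ) 1, robin Q μ ≤
      -2 * ∫ y, logMean (x - y) δ ∂μ + (2 * δ)⁻¹ * ∫ t in (x - δ)..(x + δ), Q t := by
    intro δ hδ
    have hδ0 := hδ.1
    have hp : IsProbabilityMeasure (lam δ) := ⟨by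
      simp only [lam, Measure.smul_apply, Measure.restrict_apply MeasurableSet.univ, univ_inter,
        Real.volume_Icc, smul_eq_mul]
      rw [← ENNReal.ofReal_mul (by positivity), ENNReal.ofReal_eq_one]
      field_simp
      ring⟩
    have hn : NullSingletonClass (lam δ) := ⟨fun z => by
      simp only [lam, Measure.smul_apply, measure_singleton, smul_zero]⟩
    have hi : ∀ (ν : Measure ℝ) [IsFiniteMeasure ν], Integrable (fun x => Real.log (1 + |x|)) ν →
        Integrable (fun p : ℝ × ℝ => Real.log (p.1 - p.2)) (ν.prod (lam δ)) := by
      intro ν _ hν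
      simp only [lam, Measure.prod_smul_right]
      exact (integrable_log_sub_prod_restrict hν _ _).smul_measure ENNReal.ofReal_ne_top
    have hc : ∀ f : ℝ → ℝ, Continuous f → Integrable f (lam δ) := fun f hf =>
      (hf.continuousOn.integrableOn_compact isCompact_Icc).smul_measure ENNReal.ofReal_ne_top
    have hrob := h.robin_le (ν := lam δ) (hi _ (hc _ continuous_log_one_add_abs)) (hi μ hlog)
      (hc _ hQ)
    rw [integral_prod _ (hi μ hlog), hint Q hδ0] at hrob
    simpa only [hlogmean hδ0] using hrob
  -- The means are dominated from below through `le_logMean` and from above through `logMean_le`.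
  -- The finiteness of the potential at x makes the dominating function integrable.
  have lim1 : Tendsto (fun δ => ∫ y, logMean (x - y) δ ∂μ) (𝓝[>] 0)
      (𝓝 (∫ y, Real.log (x - y) ∂μ)) := by
    refine tendsto_integral_filter_of_dominated_convergence
      (fun y => |Real.log (x - y)| + 3 + (Real.log (1 + |x|) + Real.log (1 + |y|))) ?_ ?_ ?_ ?_
    · refine Eventually.of_forall fun δ => Measurable.aestronglyMeasurable ?_
      unfold logMean
      simp_rw [integral_log]
      fun_prop
    · filter_upwards [Ioc_mem_nhdsGT one_pos] with δ hδ
      filter_upwards [ae_ne_of_noAtoms μ x] with y hy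
      have h1 := le_logMean hδ.1 (sub_ne_zero.2 hy.symm)
      have h2 := logMean_le hδ.1 hδ.2 (u := x - y)
      have h3 : Real.log (1 + |x - y|) ≤ Real.log (1 + |x|) + Real.log (1 + |y|) := by
        rw [← Real.log_mul (by positivity) (by positivity)]
        exact Real.log_le_log (by positivity)
          (by nlinarith [abs_sub x y, abs_nonneg x, abs_nonneg y])
      have h4 := log_one_add_abs_nonneg x
      have h5 := log_one_add_abs_nonneg y
      rw [Real.norm_eq_abs, abs_le]
      constructor <;> linarith [abs_nonneg (Real.log (x - y)), neg_abs_le (Real.log (x - y))]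
    · exact (hx.abs.add (integrable_const _)).add ((integrable_const _).add hlog)
    · filter_upwards [ae_ne_of_noAtoms μ x] with y hy
      exact tendsto_logMean (sub_ne_zero.2 hy.symm)
  have lim2 : Tendsto (fun δ => (2 * δ)⁻¹ * ∫ t in (x - δ)..(x + δ), Q t) (𝓝[>] 0) (𝓝 (Q x)) := by
    refine ((hQ.integral_hasStrictDerivAt 0 x).hasDerivAt.tendsto_symmetric_slope).congr
      fun δ => ?_
    rw [intervalIntegral.integral_interval_sub_left (hQ.intervalIntegrable _ _)
      (hQ.intervalIntegrable _ _)]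
  have := ge_of_tendsto ((lim1.const_mul (-2)).add lim2)
    (by filter_upwards [Ioc_mem_nhdsGT one_pos] with δ hδ using step δ hδ)
  rw [pot]
  linarith

/-- Lower semicontinuity of the potential, by Fatou's lemma applied to the nonnegative kernel log(1
+ |x|) + log(1 + |y|) - log|x - y|. Integrability at the limit point is part of the conclusion
because an integral that diverges has the default value 0. -/
theorem pot_lsc (h : IsLogMinimizer Q μ) {x : ℝ} {u : ℕ → ℝ} {b : ℕ → ℝ} {B : ℝ}
    (hu : Tendsto u atTop (𝓝 x)) (hb : Tendsto b atTop (𝓝 B))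
    (hi : ∀ n, Integrable (fun y => Real.log (u n - y)) μ) (hle : ∀ n, pot μ (u n) ≤ b n) :
    Integrable (fun y => Real.log (x - y)) μ ∧ pot μ x ≤ B := by
  have := h.isProb
  have := h.noAtoms
  have hlog := h.integrable_log_one_add
  set M := ∫ y, Real.log (1 + |y|) ∂μ with hM
  have hκ : ∀ x y : ℝ, 0 ≤ Real.log (1 + |x|) + Real.log (1 + |y|) - Real.log (x - y) :=
    fun x y => sub_nonneg.2 (log_sub_le x y)
  have hmeas : ∀ x : ℝ, Measurable
      fun y => Real.log (1 + |x|) + Real.log (1 + |y|) - Real.log (x - y) := by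
    intro x
    fun_prop
  have hint : ∀ n, ∫⁻ y, ENNReal.ofReal
      (Real.log (1 + |u n|) + Real.log (1 + |y|) - Real.log (u n - y)) ∂μ
      ≤ ENNReal.ofReal (Real.log (1 + |u n|) + M + b n) := by
    intro n
    have h1 : Integrable (fun y => Real.log (1 + |u n|) + Real.log (1 + |y|)) μ :=
      (integrable_const _).add hlog
    have h3 : Integrable
        (fun y => Real.log (1 + |u n|) + Real.log (1 + |y|) - Real.log (u n - y)) μ :=
      h1.sub (hi n)
    rw [← ofReal_integral_eq_lintegral_ofReal h3 (ae_of_all _ (hκ (u n)))]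
    refine ENNReal.ofReal_le_ofReal ?_
    have h2 := hle n
    rw [integral_sub h1 (hi n), integral_add (integrable_const _) hlog]
    simp only [integral_const, probReal_univ, one_smul]
    unfold pot at h2
    linarith
  have hlim : Tendsto (fun n => Real.log (1 + |u n|) + M + b n) atTop
      (𝓝 (Real.log (1 + |x|) + M + B)) :=
    (((continuous_log_one_add_abs.tendsto x).comp hu).add_const M).add hb
  have hfatou : ∫⁻ y, ENNReal.ofReal
      (Real.log (1 + |x|) + Real.log (1 + |y|) - Real.log (x - y)) ∂μ
      ≤ ENNReal.ofReal (Real.log (1 + |x|) + M + B) := by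
    calc _ = ∫⁻ y, liminf (fun n => ENNReal.ofReal
          (Real.log (1 + |u n|) + Real.log (1 + |y|) - Real.log (u n - y))) atTop ∂μ := by
          refine lintegral_congr_ae ?_
          filter_upwards [ae_ne_of_noAtoms μ x] with y hy
          refine (Tendsto.liminf_eq (ENNReal.tendsto_ofReal ?_)).symm
          refine (((continuous_log_one_add_abs.tendsto x).comp hu).add_const _).sub ?_
          exact (Real.continuousAt_log (sub_ne_zero.2 hy.symm)).tendsto.comp (hu.sub_const y)
      _ ≤ liminf (fun n => ∫⁻ y, ENNReal.ofReal
          (Real.log (1 + |u n|) + Real.log (1 + |y|) - Real.log (u n - y)) ∂μ) atTop :=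
          lintegral_liminf_le fun n => (hmeas (u n)).ennreal_ofReal
      _ ≤ liminf (fun n => ENNReal.ofReal (Real.log (1 + |u n|) + M + b n)) atTop :=
          liminf_le_liminf (Eventually.of_forall hint)
      _ = _ := (ENNReal.tendsto_ofReal hlim).liminf_eq
  have hκi : Integrable
      (fun y => Real.log (1 + |x|) + Real.log (1 + |y|) - Real.log (x - y)) μ := by
    refine ⟨(hmeas x).aestronglyMeasurable, ?_⟩
    rw [hasFiniteIntegral_iff_ofReal (ae_of_all _ (hκ x))]
    exact hfatou.trans_lt ENNReal.ofReal_lt_top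
  have h1 : Integrable (fun y => Real.log (1 + |x|) + Real.log (1 + |y|)) μ :=
    (integrable_const _).add hlog
  have hxi : Integrable (fun y => Real.log (x - y)) μ :=
    (h1.sub hκi).congr (ae_of_all _ fun y => by simp)
  refine ⟨hxi, ?_⟩
  rw [← ofReal_integral_eq_lintegral_ofReal hκi (ae_of_all _ (hκ x)),
    ENNReal.ofReal_le_ofReal_iff (ge_of_tendsto' hlim fun n => ?_), integral_sub h1 hxi,
    integral_add (integrable_const _) hlog] at hfatou
  · simp only [integral_const, probReal_univ, one_smul] at hfatou
    unfold pot
    linarith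
  -- The bounds must be nonnegative for `ENNReal.ofReal` to be removed; they dominate integrals of a
  -- nonnegative kernel.
  · have h3 := hint n
    have h4 : Integrable (fun y => Real.log (1 + |u n|) + Real.log (1 + |y|)) μ :=
      (integrable_const _).add hlog
    have h5 : 0 ≤ ∫ y, (Real.log (1 + |u n|) + Real.log (1 + |y|) - Real.log (u n - y)) ∂μ :=
      integral_nonneg (hκ (u n))
    have h2 := hle n
    rw [integral_sub h4 (hi n), integral_add (integrable_const _) hlog] at h5
    simp only [integral_const, probReal_univ, one_smul] at h5
    unfold pot at h2
    linarith

/-- The difference of the two sides is nonnegative, and its μ-integral is zero by the definition of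
`robin`. -/
theorem ae_pot_eq (h : IsLogMinimizer Q μ) (hQ : Continuous Q) :
    ∀ᵐ x ∂μ, Integrable (fun y => Real.log (x - y)) μ ∧ 2 * pot μ x + Q x = robin Q μ := by
  have := h.isProb
  have h1 := h.integrable_log.prod_right_ae
  have h2 : Integrable (pot μ) μ := h.integrable_log.integral_prod_left.neg
  have h3 : Integrable (fun x => 2 * pot μ x + Q x - robin Q μ) μ :=
    ((h2.const_mul 2).add h.integrable_field).sub (integrable_const _)
  have h4 : 0 ≤ᵐ[μ] fun x => 2 * pot μ x + Q x - robin Q μ := by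
    filter_upwards [h1] with x hx
    exact sub_nonneg.2 (h.robin_le_pot hQ hx)
  have h5 : ∫ x, (2 * pot μ x + Q x - robin Q μ) ∂μ = 0 := by
    have h6 : Integrable (fun x => 2 * pot μ x + Q x) μ := (h2.const_mul 2).add h.integrable_field
    have h7 : ∫ x, pot μ x ∂μ = -∫ p, Real.log (p.1 - p.2) ∂(μ.prod μ) := by
      rw [integral_prod _ h.integrable_log, ← integral_neg]
      rfl
    rw [integral_sub h6 (integrable_const _), integral_add (h2.const_mul 2) h.integrable_field,
      integral_const_mul, h7, robin]
    simp
  filter_upwards [h1, (integral_eq_zero_iff_of_nonneg_ae h4 h3).1 h5] with x hx hx'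
  exact ⟨hx, sub_eq_zero.1 hx'⟩

/-- Points of the support are limits of points where equality holds. Semicontinuity carries one
inequality to the limit and `robin_le_pot` is the other. -/
theorem pot_eq_on_support (h : IsLogMinimizer Q μ) (hQ : Continuous Q) {x : ℝ}
    (hx : x ∈ μ.support) :
    Integrable (fun y => Real.log (x - y)) μ ∧ 2 * pot μ x + Q x = robin Q μ := by
  have hcl : x ∈ closure {x | Integrable (fun y => Real.log (x - y)) μ ∧
      2 * pot μ x + Q x = robin Q μ} := by
    refine mem_closure_iff_nhds.2 fun U hU => ?_
    have hpos := (Measure.mem_support_iff_forall x).1 hx U hU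
    by_contra hne
    rw [not_nonempty_iff_eq_empty, ← disjoint_iff_inter_eq_empty] at hne
    exact hpos.ne' (measure_mono_null (fun y hy => hne.notMem_of_mem_left hy)
      (h.ae_pot_eq hQ))
  obtain ⟨u, hu, hux⟩ := mem_closure_iff_seq_limit.1 hcl
  have hb : Tendsto (fun n => (robin Q μ - Q (u n)) / 2) atTop (𝓝 ((robin Q μ - Q x) / 2)) :=
    (((hQ.tendsto x).comp hux).const_sub _).div_const 2
  obtain ⟨h1, h2⟩ := h.pot_lsc hux hb (fun n => (hu n).1)
    (fun n => by have := (hu n).2; linarith)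
  exact ⟨h1, le_antisymm (by linarith) (h.robin_le_pot hQ h1)⟩

theorem integrable_log_of_notMem_support (h : IsLogMinimizer Q μ) {x : ℝ}
    (hx : x ∉ μ.support) : Integrable (fun y => Real.log (x - y)) μ := by
  have := h.isProb
  obtain ⟨δ, hδ, hball⟩ := Metric.isOpen_iff.1 Measure.isOpen_compl_support x hx
  refine Integrable.mono' (g := fun y => |Real.log δ| + (Real.log (1 + |x|) + Real.log (1 + |y|)))
    ((integrable_const _).add ((integrable_const _).add h.integrable_log_one_add))
    (Measurable.aestronglyMeasurable (by fun_prop)) ?_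
  filter_upwards [Measure.support_mem_ae (μ := μ)] with y hy
  have hd : δ ≤ |x - y| := by
    by_contra! hc
    exact hball (by rwa [Metric.mem_ball, dist_comm, Real.dist_eq]) hy
  have h1 := Real.log_le_log hδ hd
  have h2 := log_sub_le x y
  have h3 := log_one_add_abs_nonneg x
  have h4 := log_one_add_abs_nonneg y
  rw [Real.log_abs] at h1
  rw [Real.norm_eq_abs, abs_le]
  constructor <;> linarith [abs_nonneg (Real.log δ), neg_abs_le (Real.log δ)]

theorem integrable_log_sub (h : IsLogMinimizer Q μ) (hQ : Continuous Q) (x : ℝ) :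
    Integrable (fun y => Real.log (x - y)) μ := by
  by_cases hx : x ∈ μ.support
  · exact (h.pot_eq_on_support hQ hx).1
  · exact h.integrable_log_of_notMem_support hx

/-- The minimizer lives on a compact set if the external field beats the logarithm. -/
theorem isCompact_support (h : IsLogMinimizer Q μ) (hQ : Continuous Q)
    (hgrow : Tendsto (fun x => Q x - 2 * Real.log (1 + |x|)) (cocompact ℝ) atTop) :
    IsCompact μ.support := by
  have := h.isProb
  have hlog := h.integrable_log_one_add
  set M := ∫ y, Real.log (1 + |y|) ∂μ with hM
  -- On the support 2U + Q equals the Robin constant, while 2U(x) ≥ -2 log(1 + |x|) - 2M. So Q - 2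
  -- log(1 + |x|) cannot exceed this threshold there.
  have hev := hgrow.eventually_gt_atTop (robin Q μ + 2 * M)
  obtain ⟨K, hK, hKs⟩ := mem_cocompact.1 hev
  refine hK.of_isClosed_subset Measure.isClosed_support fun x hx => ?_
  by_contra hxK
  have h1 := hKs hxK
  obtain ⟨hi, he⟩ := h.pot_eq_on_support hQ hx
  have h2 : ∫ y, Real.log (x - y) ∂μ ≤ ∫ y, (Real.log (1 + |x|) + Real.log (1 + |y|)) ∂μ :=
    integral_mono hi ((integrable_const _).add hlog) (log_sub_le x)
  rw [integral_add (integrable_const _) hlog] at h2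
  simp only [integral_const, probReal_univ, one_smul] at h2
  rw [mem_ofPred_eq] at h1
  unfold pot at he
  linarith

end IsLogMinimizer
end ExternalSource


namespace ExternalSource

open Filter Topology

/-! ### Symmetry of the minimizer -/

namespace IsLogMinimizer

variable {Q : ℝ → ℝ} {μ : Measure ℝ}

/-- Makes the mutual energy of μ and its reflection finite before symmetry is known. The potential
at -x is compared with the potential at the point w of the support nearest to -x. Since |w - y| ≤
2|-x - y| on the support, only log 2 is lost, and at w the variational equality bounds the
potential. -/
theorem exists_integral_abs_log_le (h : IsLogMinimizer Q μ) (hQ : Continuous Q)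
    (hK : IsCompact μ.support) :
    ∃ C, ∀ x ∈ μ.support, ∫ y, |Real.log (-x - y)| ∂μ ≤ C := by
  have := h.isProb
  have := h.noAtoms
  have hlog := h.integrable_log_one_add
  set M := ∫ y, Real.log (1 + |y|) ∂μ with hM
  obtain ⟨B, hB⟩ := hK.exists_bound_of_continuousOn hQ.continuousOn
  obtain ⟨B', hB'⟩ := hK.exists_bound_of_continuousOn continuous_log_one_add_abs.continuousOn
  have hne : μ.support.Nonempty := Measure.nonempty_support (IsProbabilityMeasure.ne_zero μ)
  refine ⟨2 * (B' + M) + (Real.log 2 + (robin Q μ + B) / 2), fun x hx => ?_⟩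
  obtain ⟨w, hw, hmin⟩ := hK.exists_infDist_eq_dist hne (-x)
  have hw' : ∀ y ∈ μ.support, |w - y| ≤ 2 * |-x - y| := by
    intro y hy
    have h1 : dist (-x) w ≤ dist (-x) y := hmin ▸ Metric.infDist_le_dist_of_mem hy
    rw [Real.dist_eq, Real.dist_eq] at h1
    have h2 : |w - y| ≤ |-x - w| + |-x - y| := by
      rw [show w - y = (-x - y) - (-x - w) by ring]
      linarith [abs_sub (-x - y) (-x - w)]
    linarith
  have i1 := h.integrable_log_sub hQ (-x)
  have i2 := h.integrable_log_sub hQ w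
  have h1 : pot μ (-x) ≤ Real.log 2 + pot μ w := by
    have e1 : ∫ y, Real.log (w - y) ∂μ ≤ ∫ y, (Real.log 2 + Real.log (-x - y)) ∂μ := by
      refine integral_mono_ae i2 ((integrable_const _).add i1) ?_
      filter_upwards [Measure.support_mem_ae (μ := μ), ae_ne_of_noAtoms μ w,
        ae_ne_of_noAtoms μ (-x)] with y hy hyw hyx
      have p1 : 0 < |w - y| := abs_pos.2 (sub_ne_zero.2 hyw.symm)
      have p2 : 0 < |-x - y| := abs_pos.2 (sub_ne_zero.2 hyx.symm)
      rw [← Real.log_abs (w - y), ← Real.log_abs (-x - y),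
        ← Real.log_mul (by norm_num) p2.ne']
      exact Real.log_le_log p1 (hw' y hy)
    rw [integral_add (integrable_const _) i1] at e1
    simp only [integral_const, probReal_univ, one_smul] at e1
    unfold pot
    linarith
  have h2 := (h.pot_eq_on_support hQ hw).2
  have h3 : -Q w ≤ B := (neg_le_abs _).trans (hB w hw)
  have h4 : Real.log (1 + |x|) ≤ B' := (le_abs_self _).trans (hB' x hx)
  have h5 : ∫ y, |Real.log (-x - y)| ∂μ ≤
      ∫ y, (2 * (Real.log (1 + |x|) + Real.log (1 + |y|)) - Real.log (-x - y)) ∂μ := by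
    refine integral_mono i1.abs
      ((((integrable_const _).add hlog).const_mul 2).sub i1) fun y => ?_
    have e1 := log_sub_le (-x) y
    have e2 := log_one_add_abs_nonneg x
    have e3 := log_one_add_abs_nonneg y
    rw [abs_neg] at e1
    refine abs_le.2 ⟨?_, ?_⟩ <;> dsimp only <;> linarith
  have h6 : Integrable (fun y => Real.log (1 + |x|) + Real.log (1 + |y|)) μ :=
    (integrable_const _).add hlog
  rw [integral_sub (h6.const_mul 2) i1, integral_const_mul, integral_add (integrable_const _) hlog]
    at h5
  simp only [integral_const, probReal_univ, one_smul] at h5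
  unfold pot at h1 h2
  linarith

/-- The reflected measure has the same self-energy and the same field integral. The first variation
towards it reduces to a comparison of the mutual energy with the self-energy, and positive
definiteness forces equality. -/
theorem map_neg_eq (h : IsLogMinimizer Q μ) (hQ : Continuous Q) (hK : IsCompact μ.support)
    (heven : ∀ x, Q (-x) = Q x) : μ.map (fun x => -x) = μ := by
  have := h.isProb
  have := h.noAtoms
  have hmeas : Measurable (fun p : ℝ × ℝ => Real.log (p.1 - p.2)) := by fun_prop
  have hneg : Measurable (fun x : ℝ => -x) := measurable_neg
  have hp : IsProbabilityMeasure (μ.map fun x => -x) := Measure.isProbabilityMeasure_map (by fun_prop)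
  have hn : NullSingletonClass (μ.map fun x => -x) := ⟨fun x => by
    rw [Measure.map_apply hneg (measurableSet_singleton x)]
    have : (fun x : ℝ => -x) ⁻¹' {x} = {-x} := by
      ext y
      simp
    rw [this, measure_singleton]⟩
  have e1 : μ.prod (μ.map fun x => -x) = (μ.prod μ).map (Prod.map id fun x => -x) := by
    conv_lhs => rw [← Measure.map_id (μ := μ), Measure.map_map (by fun_prop) (by fun_prop)]
    rw [← Measure.map_prod_map _ _ measurable_id hneg]
    rfl
  have e2 : (μ.map fun x => -x).prod (μ.map fun x => -x) =
      (μ.prod μ).map (Prod.map (fun x => -x) fun x => -x) :=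
    Measure.map_prod_map _ _ hneg hneg
  have e3 : ∀ p : ℝ × ℝ, Real.log (-p.1 - -p.2) = Real.log (p.1 - p.2) := fun p => by
    rw [← Real.log_neg_eq_log (p.1 - p.2)]
    ring_nf
  have i2 : Integrable (fun p : ℝ × ℝ => Real.log (p.1 - p.2))
      ((μ.map fun x => -x).prod (μ.map fun x => -x)) := by
    rw [e2, integrable_map_measure hmeas.aestronglyMeasurable (by fun_prop)]
    exact h.integrable_log.congr (ae_of_all _ fun p => (e3 p).symm)
  have v2 : ∫ p, Real.log (p.1 - p.2) ∂((μ.map fun x => -x).prod (μ.map fun x => -x)) =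
      ∫ p, Real.log (p.1 - p.2) ∂(μ.prod μ) := by
    rw [e2, integral_map (by fun_prop) hmeas.aestronglyMeasurable]
    exact integral_congr_ae (ae_of_all _ fun p => e3 p)
  have i1 : Integrable (fun p : ℝ × ℝ => Real.log (p.1 - p.2)) (μ.prod (μ.map fun x => -x)) := by
    rw [e1, integrable_map_measure hmeas.aestronglyMeasurable (by fun_prop)]
    have hm : Measurable (fun p : ℝ × ℝ => Real.log (p.1 - -p.2)) := by fun_prop
    have e4 : ∀ x y : ℝ, Real.log (x - -y) = Real.log (-x - y) := fun x y => by
      rw [← Real.log_neg_eq_log (x - -y)]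
      ring_nf
    refine (integrable_prod_iff hm.aestronglyMeasurable).2 ⟨ae_of_all _ fun x => ?_, ?_⟩
    · simp only [e4]
      exact h.integrable_log_sub hQ (-x)
    · obtain ⟨C, hC⟩ := h.exists_integral_abs_log_le hQ hK
      refine Integrable.of_bound
        hm.norm.stronglyMeasurable.integral_prod_right.aestronglyMeasurable C ?_
      filter_upwards [Measure.support_mem_ae (μ := μ)] with x hx
      rw [Real.norm_of_nonneg (integral_nonneg fun y => norm_nonneg _)]
      simp only [e4]
      exact hC x hx
  have iQ : Integrable Q (μ.map fun x => -x) := by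
    rw [integrable_map_measure hQ.aestronglyMeasurable (by fun_prop)]
    exact h.integrable_field.congr (ae_of_all _ fun x => (heven x).symm)
  have vQ : ∫ x, Q x ∂(μ.map fun x => -x) = ∫ x, Q x ∂μ := by
    rw [integral_map (by fun_prop) hQ.aestronglyMeasurable]
    simp_rw [heven]
  have hle := h.robin_le i2 i1 iQ
  rw [robin, vQ] at hle
  exact (eq_of_energy_le h.integrable_log i2 i1 (by rw [v2]; linarith)).symm

end IsLogMinimizer

/-! ### The external field -/

/-- The constraint on the measure `m` on the imaginary axis (parametrized by the real line). -/
structure IsConstrained (a : ℝ) (m : Measure ℝ) : Prop where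
  isFinite : IsFiniteMeasure m
  le : m ≤ ENNReal.ofReal (a / Real.pi) • volume
  integrable_log : Integrable (fun y => Real.log (1 + |y|)) m

/-- The effect of a measure on the imaginary axis, as a function of `s = x²`. -/
noncomputable def imLog (m : Measure ℝ) (s : ℝ) : ℝ := ∫ y, 1 / 2 * Real.log (s + y ^ 2) ∂m

/-- The external field acting on measures on the real axis. -/
noncomputable def extField (V : Polynomial ℝ) (a : ℝ) (m : Measure ℝ) (x : ℝ) : ℝ :=
  V.eval x - a * |x| + imLog m (x ^ 2)

/-- The derivative of the external field. -/
noncomputable def extFieldDeriv (V : Polynomial ℝ) (a : ℝ) (m : Measure ℝ) (x : ℝ) : ℝ :=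
  V.derivative.eval x - a * SignType.sign x + x * ∫ y, 1 / (x ^ 2 + y ^ 2) ∂m

namespace IsConstrained

variable {a : ℝ} {m : Measure ℝ}

theorem ae_ne_zero (h : IsConstrained a m) : ∀ᵐ y ∂m, y ≠ 0 := by
  have : m ≪ volume := (Measure.absolutelyContinuous_of_le h.le).trans
    Measure.smul_absolutelyContinuous
  exact this.ae_le (ae_ne_of_noAtoms volume (0 : ℝ))

/-- The constraint bounds the density of m, so the logarithmic singularity at the origin is
integrable. This is why the field is continuous even at x = 0. -/
theorem integrable_negLog (h : IsConstrained a m) : Integrable negLog m :=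
  (ExternalSource.integrable_negLog.smul_measure ENNReal.ofReal_ne_top).mono_measure h.le

theorem abs_half_log_le (s : ℝ) (hs : 0 ≤ s) {y : ℝ} (hy : y ≠ 0) :
    |1 / 2 * Real.log (s + y ^ 2)| ≤ Real.log (1 + s) + Real.log (1 + |y|) + negLog y := by
  have hy2 : 0 < y ^ 2 := by positivity
  have h1 : Real.log (s + y ^ 2) ≤ Real.log (1 + s) + 2 * Real.log (1 + |y|) := by
    rw [show 2 * Real.log (1 + |y|) = Real.log ((1 + |y|) ^ 2) by rw [Real.log_pow]; norm_num,
      ← Real.log_mul (by positivity) (by positivity)]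
    refine Real.log_le_log (by positivity) ?_
    rw [← sq_abs y]
    nlinarith [abs_nonneg y, mul_nonneg hs (abs_nonneg y), mul_nonneg hs (sq_nonneg |y|)]
  have h2 : 2 * Real.log y ≤ Real.log (s + y ^ 2) := by
    rw [show 2 * Real.log y = Real.log (y ^ 2) by rw [Real.log_pow]; norm_num]
    exact Real.log_le_log hy2 (by linarith)
  have h3 : -Real.log y ≤ negLog y := le_max_left _ _
  have h4 := negLog_nonneg y
  have h5 := log_one_add_abs_nonneg y
  have h6 := Real.log_nonneg (show 1 ≤ 1 + s by linarith)
  exact abs_le.2 ⟨by linarith, by linarith⟩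

theorem integrable_half_log (h : IsConstrained a m) {s : ℝ} (hs : 0 ≤ s) :
    Integrable (fun y => 1 / 2 * Real.log (s + y ^ 2)) m := by
  have := h.isFinite
  refine Integrable.mono' (g := fun y => Real.log (1 + s) + Real.log (1 + |y|) + negLog y)
    (((integrable_const _).add h.integrable_log).add h.integrable_negLog)
    (Measurable.aestronglyMeasurable (by fun_prop)) ?_
  filter_upwards [h.ae_ne_zero] with y hy
  exact abs_half_log_le s hs hy

theorem continuousOn_imLog (h : IsConstrained a m) : ContinuousOn (imLog m) (Ici 0) := by
  have := h.isFinite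
  intro s hs
  refine continuousWithinAt_of_dominated
    (bound := fun y => Real.log (1 + (s + 1)) + Real.log (1 + |y|) + negLog y) ?_ ?_
    (((integrable_const _).add h.integrable_log).add h.integrable_negLog) ?_
  · exact Eventually.of_forall fun t => Measurable.aestronglyMeasurable (by fun_prop)
  · filter_upwards [self_mem_nhdsWithin, mem_nhdsWithin_of_mem_nhds (Iic_mem_nhds (lt_add_one s))]
      with t ht ht1
    filter_upwards [h.ae_ne_zero] with y hy
    refine (abs_half_log_le t ht hy).trans ?_
    rw [mem_Ici] at ht hs
    rw [mem_Iic] at ht1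
    have := Real.log_le_log (by linarith) (by linarith : 1 + t ≤ 1 + (s + 1))
    linarith
  · filter_upwards [h.ae_ne_zero] with y hy
    rw [mem_Ici] at hs
    have : s + y ^ 2 ≠ 0 := by positivity
    exact (ContinuousAt.const_mul ((continuousAt_id.add continuousAt_const).log this)
      _).continuousWithinAt

theorem hasDerivAt_imLog (h : IsConstrained a m) {s : ℝ} (hs : 0 < s) :
    HasDerivAt (imLog m) (1 / 2 * ∫ y, 1 / (s + y ^ 2) ∂m) s := by
  have := h.isFinite
  rw [← integral_const_mul]
  refine (hasDerivAt_integral_of_dominated_loc_of_deriv_le (s := Ioi (s / 2))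
    (F := fun t y => 1 / 2 * Real.log (t + y ^ 2))
    (F' := fun t y => 1 / 2 * (1 / (t + y ^ 2)))
    (bound := fun _ => 1 / s) (Ioi_mem_nhds (by linarith)) ?_ (h.integrable_half_log hs.le) ?_ ?_
    (integrable_const _) ?_).2
  · exact Eventually.of_forall fun t => Measurable.aestronglyMeasurable (by fun_prop)
  · exact Measurable.aestronglyMeasurable (by fun_prop)
  · refine ae_of_all _ fun y t ht => ?_
    rw [mem_Ioi] at ht
    have : s / 2 ≤ t + y ^ 2 := by nlinarith [sq_nonneg y]
    have h0 : 0 < t + y ^ 2 := by linarith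
    rw [Real.norm_of_nonneg (by positivity)]
    calc 1 / 2 * (1 / (t + y ^ 2)) ≤ 1 / 2 * (1 / (s / 2)) := by gcongr
      _ = 1 / s := by field_simp
  · refine ae_of_all _ fun y t ht => ?_
    rw [mem_Ioi] at ht
    have : t + y ^ 2 ≠ 0 := by nlinarith [sq_nonneg y]
    exact (((hasDerivAt_id t).add_const _).log this).const_mul _

theorem continuous_extField (h : IsConstrained a m) (V : Polynomial ℝ) :
    Continuous (extField V a m) := by
  refine Continuous.add (by fun_prop) ?_
  exact h.continuousOn_imLog.comp_continuous (by fun_prop) fun x => sq_nonneg x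

theorem hasDerivAt_extField (h : IsConstrained a m) (V : Polynomial ℝ) {x : ℝ} (hx : x ≠ 0) :
    HasDerivAt (extField V a m) (extFieldDeriv V a m x) x := by
  have h1 := (h.hasDerivAt_imLog (s := x ^ 2) (by positivity)).comp x
    ((hasDerivAt_id x).pow 2)
  have h2 := ((V.hasDerivAt x).sub ((hasDerivAt_abs hx).const_mul a)).add h1
  refine h2.congr_deriv ?_
  simp [extFieldDeriv]
  ring

theorem hasDerivAt_extField_sqrt (h : IsConstrained a m) (V : Polynomial ℝ) {s : ℝ} (hs : 0 < s) :
    HasDerivAt (fun s => extField V a m √s) (extFieldDeriv V a m √s / (2 * √s)) s := by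
  have := (h.hasDerivAt_extField V (Real.sqrt_pos.2 hs).ne').comp s
    (Real.hasDerivAt_sqrt hs.ne')
  refine this.congr_deriv ?_
  ring

theorem integrable_one_div_sq_add {s : ℝ} (hs : 0 < s) :
    Integrable (fun y : ℝ => 1 / (s + y ^ 2)) := by
  have h1 := integrable_inv_one_add_sq.comp_mul_left' (inv_pos.2 (Real.sqrt_pos.2 hs)).ne'
  refine (h1.const_mul (1 / s)).congr (ae_of_all _ fun y => ?_)
  have := Real.sq_sqrt hs.le
  have h2 := Real.sqrt_pos.2 hs
  dsimp only
  rw [mul_pow, inv_pow, this]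
  field_simp

theorem integral_one_div_sq_add {s : ℝ} (hs : 0 < s) :
    ∫ y : ℝ, 1 / (s + y ^ 2) = Real.pi / √s := by
  have h2 := Real.sqrt_pos.2 hs
  have h1 := Measure.integral_comp_mul_left (fun y : ℝ => (1 + y ^ 2)⁻¹) (√s)⁻¹
  rw [integral_univ_inv_one_add_sq, inv_inv, abs_of_pos h2, smul_eq_mul] at h1
  have h3 : ∀ y : ℝ, 1 / (s + y ^ 2) = 1 / s * (1 + ((√s)⁻¹ * y) ^ 2)⁻¹ := by
    intro y
    rw [mul_pow, inv_pow, Real.sq_sqrt hs.le]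
    field_simp
  simp_rw [h3]
  rw [integral_const_mul, h1]
  nth_rewrite 1 [← Real.mul_self_sqrt hs.le]
  field_simp

/-- The term a/√s is the same integral taken against σ, so the difference is minus the integral of
1/(s + y²) against the positive measure σ - m. -/
theorem strictMonoOn_aux (h : IsConstrained a m) (ha : 0 < a) :
    StrictMonoOn (fun s => (∫ y, 1 / (s + y ^ 2) ∂m) - a / √s) (Ioi 0) := by
  have := h.isFinite
  set σ : Measure ℝ := ENNReal.ofReal (a / Real.pi) • volume with hσ
  set ρ := σ - m
  have hadd : ρ + m = σ := Measure.sub_add_cancel_of_le h.le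
  have iσ : ∀ {s : ℝ}, 0 < s → Integrable (fun y => 1 / (s + y ^ 2)) σ := fun hs =>
    (integrable_one_div_sq_add hs).smul_measure ENNReal.ofReal_ne_top
  have iρ : ∀ {s : ℝ}, 0 < s → Integrable (fun y => 1 / (s + y ^ 2)) ρ := fun hs =>
    (iσ hs).mono_measure (hadd ▸ Measure.le_add_right le_rfl)
  have im : ∀ {s : ℝ}, 0 < s → Integrable (fun y => 1 / (s + y ^ 2)) m := fun hs =>
    (iσ hs).mono_measure h.le
  have key : ∀ {s : ℝ}, 0 < s →
      (∫ y, 1 / (s + y ^ 2) ∂m) - a / √s = -∫ y, 1 / (s + y ^ 2) ∂ρ := by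
    intro s hs
    have e1 : ∫ y, 1 / (s + y ^ 2) ∂σ = a / √s := by
      rw [hσ, integral_smul_measure, integral_one_div_sq_add hs,
        ENNReal.toReal_ofReal (by positivity), smul_eq_mul]
      field_simp
    rw [← hadd, integral_add_measure (iρ hs) (im hs)] at e1
    linarith
  -- Strictness needs σ ≠ m, which holds because σ has infinite mass and m does not.
  have hρ : 0 < ρ univ := by
    refine pos_iff_ne_zero.2 fun h0 => ?_
    have h1 : (ρ + m) univ = σ univ := by rw [hadd]
    rw [Measure.add_apply, h0, zero_add, hσ, Measure.smul_apply, Real.volume_univ, smul_eq_mul,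
      ENNReal.mul_top (by simpa using by positivity)] at h1
    exact measure_ne_top m univ h1
  intro s hs t ht hst
  rw [mem_Ioi] at hs ht
  dsimp only
  rw [key hs, key ht, neg_lt_neg_iff, ← sub_pos, ← integral_sub (iρ hs) (iρ ht)]
  have hpos : ∀ y : ℝ, 0 < 1 / (s + y ^ 2) - 1 / (t + y ^ 2) := fun y =>
    sub_pos.2 (one_div_lt_one_div_of_lt (by positivity) (by linarith))
  rw [integral_pos_iff_support_of_nonneg (fun y => (hpos y).le) ((iρ hs).sub (iρ ht))]
  rwa [show Function.support (fun y : ℝ => 1 / (s + y ^ 2) - 1 / (t + y ^ 2)) = univ from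
    eq_univ_of_forall fun y => (hpos y).ne']

variable {V : Polynomial ℝ}

/-- The function is the derivative of the field in s = x². The polynomial part is monotone by
convexity and the remaining part is half of `strictMonoOn_aux`. -/
theorem strictMonoOn_extFieldDeriv (h : IsConstrained a m) (ha : 0 < a)
    (hconv : ConvexOn ℝ (Ioi (0 : ℝ)) (fun x : ℝ => V.eval √x)) :
    StrictMonoOn (fun s => extFieldDeriv V a m √s / (2 * √s)) (Ioi 0) := by
  have hd : ∀ s ∈ Ioi (0 : ℝ), HasDerivAt (fun x : ℝ => V.eval √x)
      (V.derivative.eval √s / (2 * √s)) s := by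
    intro s hs
    refine ((V.hasDerivAt √s).comp s (Real.hasDerivAt_sqrt (ne_of_gt hs))).congr_deriv ?_
    ring
  have h1 : MonotoneOn (fun s => V.derivative.eval √s / (2 * √s)) (Ioi 0) :=
    (hconv.monotoneOn_deriv fun s hs => (hd s hs).differentiableAt).congr
      fun s hs => (hd s hs).deriv
  have h2 : StrictMonoOn (fun s => 1 / 2 * ((∫ y, 1 / (s + y ^ 2) ∂m) - a / √s)) (Ioi 0) :=
    fun s hs t ht hst => mul_lt_mul_of_pos_left (h.strictMonoOn_aux ha hs ht hst) (by norm_num)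
  refine (h1.add_strictMono h2).congr fun s hs => ?_
  have h3 := Real.sqrt_pos.2 hs
  simp only [extFieldDeriv, Real.sq_sqrt (le_of_lt hs), sign_pos h3, SignType.coe_one]
  field_simp
  ring

theorem strictConvexOn_extField (h : IsConstrained a m) (ha : 0 < a)
    (hconv : ConvexOn ℝ (Ioi (0 : ℝ)) (fun x : ℝ => V.eval √x)) :
    StrictConvexOn ℝ (Ici 0) (fun s => extField V a m √s) := by
  refine StrictMonoOn.strictConvexOn_of_deriv (convex_Ici 0)
    ((h.continuous_extField V).comp Real.continuous_sqrt).continuousOn ?_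
  rw [interior_Ici]
  exact (h.strictMonoOn_extFieldDeriv ha hconv).congr
    fun s hs => (h.hasDerivAt_extField_sqrt V hs).deriv.symm

theorem tendsto_extField
    (hVeven : ∀ x : ℝ, V.eval (-x) = V.eval x) (hVdeg : 0 < V.natDegree)
    (hVlead : 0 < V.leadingCoeff) :
    Tendsto (fun x => extField V a m x - 2 * Real.log (1 + |x|)) (cocompact ℝ) atTop := by
  -- Evenness excludes degree one, so V grows faster than any linear function.
  have hdeg : 1 < V.natDegree := by
    by_contra! hc
    obtain ⟨b, c, rfl⟩ := Polynomial.exists_eq_X_add_C_of_natDegree_le_one hc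
    have h1 := hVeven 1
    simp only [Polynomial.eval_add, Polynomial.eval_mul, Polynomial.eval_C, Polynomial.eval_X]
      at h1
    obtain rfl : b = 0 := by linarith
    simp at hVdeg
  -- The slope a + 2 pays for -a|x| and for 2 log(1 + |x|) ≤ 2|x|.
  have h1 : Tendsto (fun x => (V - Polynomial.C (a + 2) * Polynomial.X).eval x) atTop atTop := by
    have hlt : (Polynomial.C (a + 2) * Polynomial.X).degree < V.degree :=
      (Polynomial.degree_C_mul_X_le _).trans_lt
        (by rw [Polynomial.degree_eq_natDegree (by rintro rfl; simp at hVdeg)]; exact_mod_cast hdeg)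
    refine Polynomial.tendsto_atTop_of_leadingCoeff_nonneg _ ?_ ?_
    · rw [Polynomial.degree_sub_eq_left_of_degree_lt hlt]
      exact Polynomial.natDegree_pos_iff_degree_pos.1 hVdeg
    · rw [Polynomial.leadingCoeff_sub_of_degree_lt hlt]
      exact hVlead.le
  refine tendsto_atTop_mono' _ ?_ (h1.comp (tendsto_norm_cocompact_atTop (E := ℝ)))
  have h2 : ∀ᶠ x : ℝ in cocompact ℝ, 1 ≤ ‖x‖ :=
    tendsto_norm_cocompact_atTop.eventually_ge_atTop 1
  filter_upwards [h2] with x hx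
  rw [Real.norm_eq_abs] at hx
  have h3 : V.eval |x| = V.eval x := by
    rcases abs_choice x with h | h <;> rw [h]
    exact hVeven x
  -- For |x| ≥ 1 the logarithm of x² + y² is nonnegative, so the contribution of m can be dropped.
  have h4 : 0 ≤ imLog m (x ^ 2) := by
    refine integral_nonneg fun y => mul_nonneg (by norm_num) (Real.log_nonneg ?_)
    nlinarith [sq_nonneg y, sq_abs x]
  have h5 : Real.log (1 + |x|) ≤ |x| := by
    linarith [Real.log_le_sub_one_of_pos (show 0 < 1 + |x| by positivity)]
  simp only [Function.comp_apply, Real.norm_eq_abs, Polynomial.eval_sub, Polynomial.eval_mul,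
    Polynomial.eval_C, Polynomial.eval_X, h3, extField]
  linarith

theorem extField_neg (hVeven : ∀ x : ℝ, V.eval (-x) = V.eval x) (x : ℝ) :
    extField V a m (-x) = extField V a m x := by
  simp [extField, hVeven]

end IsConstrained
end ExternalSource


namespace ExternalSource

open Filter Topology

/-! ### The support of the minimizer -/

theorem integral_comp_neg_of_map_neg {E : Type*} [NormedAddCommGroup E] [NormedSpace ℝ E]
    {μ : Measure ℝ} (hs : μ.map (fun x => -x) = μ) (f : ℝ → E) :
    ∫ x, f (-x) ∂μ = ∫ x, f x ∂μ := by
  conv_rhs => rw [← hs]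
  exact (integral_map_equiv (MeasurableEquiv.neg ℝ) f).symm

theorem integrable_comp_neg_of_map_neg {E : Type*} [NormedAddCommGroup E]
    {μ : Measure ℝ} (hs : μ.map (fun x => -x) = μ) {f : ℝ → E} (hf : Integrable f μ) :
    Integrable (fun x => f (-x)) μ := by
  rw [← hs] at hf
  exact (integrable_map_equiv (MeasurableEquiv.neg ℝ) f).1 hf

theorem neg_mem_support_of_map_neg {μ : Measure ℝ} (hs : μ.map (fun x => -x) = μ) {x : ℝ}
    (hx : x ∈ μ.support) : -x ∈ μ.support := by
  refine (Measure.mem_support_iff_forall _).2 fun U hU => ?_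
  rw [← hs]
  have h1 : (MeasurableEquiv.neg ℝ) ⁻¹' U ∈ 𝓝 x := continuous_neg.continuousAt hU
  have h2 := (Measure.mem_support_iff_forall x).1 hx _ h1
  rwa [← MeasurableEquiv.map_apply] at h2

theorem abs_mem_support_iff {μ : Measure ℝ} (hs : μ.map (fun x => -x) = μ) {x : ℝ} :
    |x| ∈ μ.support ↔ x ∈ μ.support := by
  rcases abs_choice x with h | h <;> rw [h]
  exact ⟨fun h => by simpa using neg_mem_support_of_map_neg hs h, neg_mem_support_of_map_neg hs⟩

/-- The logarithm is midpoint concave along `s ↦ s - t` off the zero. -/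
theorem log_sub_midpoint {s₁ s₂ t : ℝ} (h : t < s₁ ∧ t < s₂ ∨ s₁ < t ∧ s₂ < t) :
    1 / 2 * (Real.log (s₁ - t) + Real.log (s₂ - t)) ≤ Real.log ((s₁ + s₂) / 2 - t) := by
  have key : ∀ p q : ℝ, 0 < p → 0 < q →
      1 / 2 * (Real.log p + Real.log q) ≤ Real.log ((p + q) / 2) := by
    intro p q hp hq
    have h1 : Real.log p + Real.log q ≤ Real.log (((p + q) / 2) ^ 2) := by
      rw [← Real.log_mul hp.ne' hq.ne']
      exact Real.log_le_log (by positivity) (by nlinarith [sq_nonneg (p - q)])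
    rw [Real.log_pow] at h1
    push_cast at h1
    linarith
  rcases h with h | h
  · have := key (s₁ - t) (s₂ - t) (by linarith) (by linarith)
    rwa [show (s₁ - t + (s₂ - t)) / 2 = (s₁ + s₂) / 2 - t by ring] at this
  · have := key (t - s₁) (t - s₂) (by linarith) (by linarith)
    rwa [show (t - s₁ + (t - s₂)) / 2 = -((s₁ + s₂) / 2 - t) by ring, Real.log_neg_eq_log,
      ← neg_sub s₁, ← neg_sub s₂, Real.log_neg_eq_log, Real.log_neg_eq_log] at this

namespace IsLogMinimizer

variable {Q : ℝ → ℝ} {μ : Measure ℝ}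

theorem robin_le_total (h : IsLogMinimizer Q μ) (hQ : Continuous Q) (x : ℝ) :
    robin Q μ ≤ 2 * pot μ x + Q x :=
  h.robin_le_pot hQ (h.integrable_log_sub hQ x)

/-- Averaging the kernel over y and -y turns the potential of an even measure into a function of x².
This is what allows convexity in s to be used. -/
theorem pot_sq (h : IsLogMinimizer Q μ) (hQ : Continuous Q) (hs : μ.map (fun x => -x) = μ) (x : ℝ) :
    Integrable (fun y => Real.log (x ^ 2 - y ^ 2)) μ ∧
      2 * pot μ x = -∫ y, Real.log (x ^ 2 - y ^ 2) ∂μ := by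
  have := h.noAtoms
  have i1 := h.integrable_log_sub hQ x
  have i2 := integrable_comp_neg_of_map_neg hs i1
  have e2 := integral_comp_neg_of_map_neg hs fun y => Real.log (x - y)
  have e : ∀ᵐ y ∂μ, Real.log (x - y) + Real.log (x - -y) = Real.log (x ^ 2 - y ^ 2) := by
    filter_upwards [ae_ne_of_noAtoms μ x, ae_ne_of_noAtoms μ (-x)] with y h1 h2
    rw [← Real.log_mul (sub_ne_zero.2 h1.symm) (fun h3 => h2 (by linarith))]
    ring_nf
  refine ⟨(i1.add i2).congr e, ?_⟩
  rw [← integral_congr_ae e, integral_add i1 i2, e2, pot]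
  ring

theorem pot_neg (hs : μ.map (fun x => -x) = μ) (x : ℝ) : pot μ (-x) = pot μ x := by
  rw [pot, pot, ← integral_comp_neg_of_map_neg hs fun y => Real.log (x - y)]
  refine congrArg Neg.neg (integral_congr_ae (ae_of_all _ fun y => ?_))
  dsimp only
  rw [← Real.log_neg_eq_log]
  ring_nf

/-- Across a gap of the support the total potential lies strictly below its chords (in the
variable `x²`), so that it cannot be extremal at both ends. -/
theorem two_mul_robin_lt (h : IsLogMinimizer Q μ) (hQ : Continuous Q)
    (hs : μ.map (fun x => -x) = μ) (hconv : StrictConvexOn ℝ (Ici 0) (fun s => Q √s)) {u v : ℝ}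
    (hu : 0 ≤ u) (huv : u < v) (hgap : ∀ y ∈ μ.support, y ∉ Ioo u v) :
    2 * robin Q μ < (2 * pot μ u + Q u) + (2 * pot μ v + Q v) := by
  have := h.isProb
  have := h.noAtoms
  have hlt : u ^ 2 < v ^ 2 := by nlinarith
  set s := (u ^ 2 + v ^ 2) / 2 with hsdef
  have hs0 : 0 ≤ s := by positivity
  -- The lower bound is used at the midpoint in the variable s. Concavity of the logarithm and
  -- strict convexity of the field then put the midpoint value strictly below the mean of the end
  -- values.
  have h1 := h.robin_le_total hQ √s
  obtain ⟨iu, eu⟩ := h.pot_sq hQ hs u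
  obtain ⟨iv, ev⟩ := h.pot_sq hQ hs v
  obtain ⟨im, em⟩ := h.pot_sq hQ hs √s
  rw [Real.sq_sqrt hs0] at im em
  have h2 : ∫ y, 1 / 2 * (Real.log (u ^ 2 - y ^ 2) + Real.log (v ^ 2 - y ^ 2)) ∂μ ≤
      ∫ y, Real.log (s - y ^ 2) ∂μ := by
    refine integral_mono_ae ((iu.add iv).const_mul _) im ?_
    filter_upwards [Measure.support_mem_ae (μ := μ), ae_ne_of_noAtoms μ u,
      ae_ne_of_noAtoms μ (-u), ae_ne_of_noAtoms μ v, ae_ne_of_noAtoms μ (-v)]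
      with y hy n1 n2 n3 n4
    refine log_sub_midpoint ?_
    have hg := hgap |y| ((abs_mem_support_iff hs).2 hy)
    have m1 : |y| ≠ u := fun hc => by
      rcases abs_choice y with h' | h'
      · exact n1 (h' ▸ hc)
      · exact n2 (by rw [← hc, h', neg_neg])
    have m3 : |y| ≠ v := fun hc => by
      rcases abs_choice y with h' | h'
      · exact n3 (h' ▸ hc)
      · exact n4 (by rw [← hc, h', neg_neg])
    have hy0 := abs_nonneg y
    rw [← sq_abs y]
    rcases lt_or_gt_of_ne m1 with h' | h'
    · left
      constructor <;> nlinarith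
    · right
      have : v < |y| := lt_of_le_of_ne (by
        by_contra! hc
        exact hg ⟨h', hc⟩) m3.symm
      constructor <;> nlinarith
  rw [integral_const_mul, integral_add iu iv] at h2
  have h3 := hconv.2 (mem_Ici.2 (sq_nonneg u)) (mem_Ici.2 (sq_nonneg v)) hlt.ne
    (by norm_num : (0 : ℝ) < 1 / 2) (by norm_num : (0 : ℝ) < 1 / 2) (by norm_num)
  simp only [smul_eq_mul] at h3
  rw [Real.sqrt_sq hu, Real.sqrt_sq (hu.trans huv.le),
    show 1 / 2 * u ^ 2 + 1 / 2 * v ^ 2 = s by rw [hsdef]; ring] at h3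
  linarith

/-- The gap inequality is applied between |x| and a nearest point of the support: the last one in
[0, |x|] or, if there is none, the first one to the right. Equality holds at that point, so the
strict inequality falls on x. -/
theorem robin_lt_of_notMem_support (h : IsLogMinimizer Q μ) (hQ : Continuous Q)
    (hK : IsCompact μ.support) (hs : μ.map (fun x => -x) = μ) (heven : ∀ x, Q (-x) = Q x)
    (hconv : StrictConvexOn ℝ (Ici 0) (fun s => Q √s)) {x : ℝ}
    (hx : x ∉ μ.support) : robin Q μ < 2 * pot μ x + Q x := by
  have := h.isProb
  wlog hx0 : 0 ≤ x generalizing x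
  · have h1 : -x ∉ μ.support := fun hc => hx (by simpa using neg_mem_support_of_map_neg hs hc)
    have := this h1 (by linarith)
    rwa [pot_neg hs, heven] at this
  by_cases hne : (μ.support ∩ Icc 0 x).Nonempty
  · have hc := hK.inter_right (isClosed_Icc (a := 0) (b := x))
    have hu := hc.sSup_mem hne
    set u := sSup (μ.support ∩ Icc 0 x) with hudef
    have hux : u < x := lt_of_le_of_ne hu.2.2 fun hc => hx (hc ▸ hu.1)
    have h1 := h.two_mul_robin_lt hQ hs hconv hu.2.1 hux fun y hy hyI =>
      (le_csSup hc.bddAbove ⟨hy, hu.2.1.trans hyI.1.le, hyI.2.le⟩).not_gt hyI.1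
    have h2 := (h.pot_eq_on_support hQ hu.1).2
    linarith
  · have hne' : (μ.support ∩ Ici x).Nonempty := by
      obtain ⟨y, hy⟩ := Measure.nonempty_support (IsProbabilityMeasure.ne_zero μ)
      refine ⟨|y|, (abs_mem_support_iff hs).2 hy, ?_⟩
      rw [mem_Ici]
      by_contra! hc
      exact hne ⟨|y|, (abs_mem_support_iff hs).2 hy, abs_nonneg y, hc.le⟩
    have hc := hK.inter_right (isClosed_Ici (a := x))
    have hv := hc.sInf_mem hne'
    set v := sInf (μ.support ∩ Ici x)
    have hxv : x < v := lt_of_le_of_ne hv.2 fun hc => hx (hc ▸ hv.1)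
    have h1 := h.two_mul_robin_lt hQ hs hconv hx0 hxv fun y hy hyI =>
      (csInf_le hc.bddBelow ⟨hy, hyI.1.le⟩).not_gt hyI.2
    have h2 := (h.pot_eq_on_support hQ hv.1).2
    linarith

/-- The ends of a gap would both satisfy the variational equality, against `two_mul_robin_lt`. -/
theorem Icc_subset_support (h : IsLogMinimizer Q μ) (hQ : Continuous Q)
    (hK : IsCompact μ.support) (hs : μ.map (fun x => -x) = μ)
    (hconv : StrictConvexOn ℝ (Ici 0) (fun s => Q √s)) {x₁ x₂ : ℝ} (h0 : 0 ≤ x₁)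
    (h1 : x₁ ∈ μ.support) (h2 : x₂ ∈ μ.support) : Icc x₁ x₂ ⊆ μ.support := by
  intro x hx
  by_contra hxs
  have hc := hK.inter_right (isClosed_Icc (a := x₁) (b := x))
  have hu := hc.sSup_mem ⟨x₁, h1, le_rfl, hx.1⟩
  set u := sSup (μ.support ∩ Icc x₁ x)
  have hc' := hK.inter_right (isClosed_Icc (a := x) (b := x₂))
  have hv := hc'.sInf_mem ⟨x₂, h2, hx.2, le_rfl⟩
  set v := sInf (μ.support ∩ Icc x x₂)
  have hux : u < x := lt_of_le_of_ne hu.2.2 fun hc => hxs (hc ▸ hu.1)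
  have hxv : x < v := lt_of_le_of_ne hv.2.1 fun hc => hxs (hc ▸ hv.1)
  have h3 := h.two_mul_robin_lt hQ hs hconv (h0.trans hu.2.1) (hux.trans hxv) fun y hy hyI => by
    rcases le_total y x with hyx | hyx
    · exact (le_csSup hc.bddAbove ⟨hy, hu.2.1.trans hyI.1.le, hyx⟩).not_gt hyI.1
    · exact (csInf_le hc'.bddBelow ⟨hy, hyx, hyI.2.le.trans hv.2.2⟩).not_gt hyI.2
  have h4 := (h.pot_eq_on_support hQ hu.1).2
  have h5 := (h.pot_eq_on_support hQ hv.1).2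
  linarith

theorem exists_support_eq (h : IsLogMinimizer Q μ) (hQ : Continuous Q)
    (hK : IsCompact μ.support) (hs : μ.map (fun x => -x) = μ)
    (hconv : StrictConvexOn ℝ (Ici 0) (fun s => Q √s)) :
    ∃ α β : ℝ, 0 ≤ α ∧ α < β ∧ ∀ x, x ∈ μ.support ↔ α ≤ |x| ∧ |x| ≤ β := by
  have := h.isProb
  have := h.noAtoms
  have hne : (μ.support ∩ Ici 0).Nonempty := by
    obtain ⟨y, hy⟩ := Measure.nonempty_support (IsProbabilityMeasure.ne_zero μ)
    exact ⟨|y|, (abs_mem_support_iff hs).2 hy, abs_nonneg y⟩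
  have hc := hK.inter_right (isClosed_Ici (a := (0 : ℝ)))
  have hα := hc.sInf_mem hne
  have hβ := hc.sSup_mem hne
  set α := sInf (μ.support ∩ Ici 0)
  set β := sSup (μ.support ∩ Ici 0)
  have hiff : ∀ x, x ∈ μ.support ↔ α ≤ |x| ∧ |x| ≤ β := by
    intro x
    rw [← abs_mem_support_iff hs]
    exact ⟨fun hx => ⟨csInf_le hc.bddBelow ⟨hx, abs_nonneg x⟩,
      le_csSup hc.bddAbove ⟨hx, abs_nonneg x⟩⟩,
      fun hx => h.Icc_subset_support hQ hK hs hconv hα.2 hα.1 hβ.1 hx⟩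
  refine ⟨α, β, hα.2, ?_, hiff⟩
  by_contra! hle
  -- A degenerate interval would leave at most two points in the support, which is null for a
  -- measure without atoms.
  have hsub : μ.support ⊆ {α, -α} := fun x hx => by
    have h1 := (hiff x).1 hx
    have h2 : |x| = α := le_antisymm (h1.2.trans hle) h1.1
    rcases abs_choice x with h' | h'
    · exact Or.inl (h' ▸ h2)
    · exact Or.inr (by rw [mem_singleton_iff, ← h2, h', neg_neg])
  have h1 : μ {α, -α} = 0 := (Set.toFinite _).measure_zero μ
  have h2 := Measure.measure_compl_support (μ := μ)
  have h3 := measure_univ (μ := μ)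
  rw [← union_compl_self μ.support] at h3
  have h4 := (measure_union_le μ.support μ.supportᶜ).trans_eq
    (by rw [h2, measure_mono_null hsub h1, add_zero])
  rw [h3] at h4
  simp at h4

end IsLogMinimizer
end ExternalSource


namespace ExternalSource

open Filter Topology

/-! ### The Schwinger–Dyson equation -/

namespace IsLogMinimizer

variable {Q : ℝ → ℝ} {μ : Measure ℝ}

/-- The minimizer is stationary under deformations of the line that fix the origin. -/
theorem integral_divided_difference (h : IsLogMinimizer Q μ) (hQ : Continuous Q)
    (hK : IsCompact μ.support) {Q' : ℝ → ℝ} (hQ' : ∀ x, x ≠ 0 → HasDerivAt Q (Q' x) x)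
    (hmQ' : Measurable Q') (hbQ' : ∀ R, ∃ B, ∀ x, |x| ≤ R → |x * Q' x| ≤ B)
    {φ : ℝ → ℝ} {L : ℝ} (hφm : Measurable φ) (hL : 0 < L)
    (hφ : ∀ x y, |φ x - φ y| ≤ L * |x - y|) (hφ0 : ∀ x, |φ x| ≤ L * |x|) :
    ∫ p, (φ p.1 - φ p.2) / (p.1 - p.2) ∂(μ.prod μ) = ∫ x, Q' x * φ x ∂μ := by
  have := h.isProb
  have := h.noAtoms
  obtain ⟨R, hR0, hR⟩ := hK.isBounded.exists_pos_norm_le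
  obtain ⟨B, hB⟩ := hbQ' (2 * R)
  set q : ℝ × ℝ → ℝ := fun p => (φ p.1 - φ p.2) / (p.1 - p.2) with hq
  have hqm : Measurable q := by fun_prop
  have hqL : ∀ p, |q p| ≤ L := by
    intro p
    rw [hq]
    dsimp only
    rw [abs_div]
    exact div_le_of_le_mul₀ (abs_nonneg _) hL.le (hφ _ _)
  -- For |ε| < δ the map x ↦ x + εφ(x) is injective, and |εφ(x)| ≤ |x|/2. So no point other than 0
  -- is moved to 0, where Q may fail to be differentiable.
  set δ := 1 / (2 * L) with hδ
  have hδ0 : 0 < δ := by positivity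
  have hεL : ∀ ε ∈ Metric.ball (0 : ℝ) δ, |ε| * L ≤ 1 / 2 := by
    intro ε hε
    rw [mem_ball_zero_iff, Real.norm_eq_abs] at hε
    calc |ε| * L ≤ δ * L := by gcongr
      _ = 1 / 2 := by rw [hδ]; field_simp
  have hεq : ∀ ε ∈ Metric.ball (0 : ℝ) δ, ∀ p, |ε * q p| ≤ 1 / 2 := fun ε hε p => by
    rw [abs_mul]
    exact (mul_le_mul_of_nonneg_left (hqL p) (abs_nonneg _)).trans (hεL ε hε)
  have hεφ : ∀ ε ∈ Metric.ball (0 : ℝ) δ, ∀ x, |ε * φ x| ≤ 1 / 2 * |x| := fun ε hε x => by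
    rw [abs_mul]
    calc |ε| * |φ x| ≤ |ε| * (L * |x|) := mul_le_mul_of_nonneg_left (hφ0 x) (abs_nonneg _)
      _ = |ε| * L * |x| := by ring
      _ ≤ 1 / 2 * |x| := by gcongr; exact hεL ε hε
  have h0 : (0 : ℝ) ∈ Metric.ball (0 : ℝ) δ := Metric.mem_ball_self hδ0
  have hlogint : ∀ ε ∈ Metric.ball (0 : ℝ) δ,
      Integrable (fun p => Real.log (1 + ε * q p)) (μ.prod μ) := by
    intro ε hε
    refine Integrable.of_bound (Measurable.aestronglyMeasurable (by fun_prop)) (Real.log 2)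
      (ae_of_all _ fun p => ?_)
    have h1 := abs_le.1 (hεq ε hε p)
    rw [Real.norm_eq_abs, abs_le, ← Real.log_inv]
    exact ⟨Real.log_le_log (by norm_num) (by linarith), Real.log_le_log (by linarith) (by linarith)⟩
  have hQint : ∀ ε ∈ Metric.ball (0 : ℝ) δ, Integrable (fun x => Q (x + ε * φ x)) μ := by
    intro ε hε
    obtain ⟨C, hC⟩ := (isCompact_Icc (a := -(2 * R)) (b := 2 * R)).exists_bound_of_continuousOn
      hQ.continuousOn
    refine Integrable.of_bound (Measurable.aestronglyMeasurable (hQ.measurable.comp (by fun_prop))) C ?_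
    filter_upwards [Measure.support_mem_ae (μ := μ)] with x hx
    refine hC _ (abs_le.1 ?_)
    have h1 := hR x hx
    rw [Real.norm_eq_abs] at h1
    linarith [abs_add_le x (ε * φ x), hεφ ε hε x]
  have hmin : ∀ ε ∈ Metric.ball (0 : ℝ) δ, ∫ x, Q x ∂μ ≤
      -∫ p, Real.log (1 + ε * q p) ∂(μ.prod μ) + ∫ x, Q (x + ε * φ x) ∂μ := by
    intro ε hε
    set T : ℝ → ℝ := fun x => x + ε * φ x with hT
    have hTm : Measurable T := by fun_prop
    have hinj : Function.Injective T := by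
      intro x y hxy
      have h1 : |x - y| ≤ 1 / 2 * |x - y| := by
        calc |x - y| = |ε * (φ x - φ y)| := by
              rw [← abs_neg (ε * _)]
              congr 1
              simp only [hT] at hxy
              linarith
          _ ≤ |ε| * (L * |x - y|) := by
              rw [abs_mul]
              exact mul_le_mul_of_nonneg_left (hφ x y) (abs_nonneg _)
          _ = |ε| * L * |x - y| := by ring
          _ ≤ 1 / 2 * |x - y| := by gcongr; exact hεL ε hε
      exact sub_eq_zero.1 (abs_eq_zero.1 (by linarith [abs_nonneg (x - y)]))
    have hp : IsProbabilityMeasure (μ.map T) := Measure.isProbabilityMeasure_map hTm.aemeasurable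
    have hn : NullSingletonClass (μ.map T) := ⟨fun x => by
      rw [Measure.map_apply hTm (measurableSet_singleton x)]
      exact (subsingleton_singleton.preimage hinj).measure_zero μ⟩
    have hmeas : Measurable (fun p : ℝ × ℝ => Real.log (p.1 - p.2)) := by fun_prop
    have e1 : (μ.map T).prod (μ.map T) = (μ.prod μ).map (Prod.map T T) :=
      Measure.map_prod_map _ _ hTm hTm
    -- The deformation changes the kernel only by log(1 + εq), which is bounded, so the energy of
    -- the deformed measure stays finite.
    have e2 : (fun p : ℝ × ℝ => Real.log (p.1 - p.2) + Real.log (1 + ε * q p)) =ᵐ[μ.prod μ]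
        fun p => Real.log (T p.1 - T p.2) := by
      filter_upwards [ae_fst_ne_snd μ μ] with p hp
      have h1 := sub_ne_zero.2 hp
      have h2 := abs_le.1 (hεq ε hε p)
      rw [← Real.log_mul h1 (by linarith)]
      congr 1
      rw [hq, hT]
      field_simp
      ring
    have i1 : Integrable (fun p : ℝ × ℝ => Real.log (p.1 - p.2)) ((μ.map T).prod (μ.map T)) := by
      rw [e1, integrable_map_measure hmeas.aestronglyMeasurable (by fun_prop)]
      exact (h.integrable_log.add (hlogint ε hε)).congr e2
    have v1 : ∫ p, Real.log (p.1 - p.2) ∂((μ.map T).prod (μ.map T)) =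
        ∫ p, Real.log (p.1 - p.2) ∂(μ.prod μ) + ∫ p, Real.log (1 + ε * q p) ∂(μ.prod μ) := by
      rw [e1, integral_map (by fun_prop) hmeas.aestronglyMeasurable,
        ← integral_add h.integrable_log (hlogint ε hε)]
      exact (integral_congr_ae e2).symm
    have i2 : Integrable Q (μ.map T) := by
      rw [integrable_map_measure hQ.aestronglyMeasurable (by fun_prop)]
      exact hQint ε hε
    have v2 : ∫ x, Q x ∂(μ.map T) = ∫ x, Q (x + ε * φ x) ∂μ :=
      integral_map (by fun_prop) hQ.aestronglyMeasurable
    have := h.minimal _ hp hn i1 i2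
    rw [v1, v2] at this
    linarith
  have hd1 : HasDerivAt (fun ε => ∫ p, Real.log (1 + ε * q p) ∂(μ.prod μ))
      (∫ p, q p / (1 + 0 * q p) ∂(μ.prod μ)) 0 := by
    refine (hasDerivAt_integral_of_dominated_loc_of_deriv_le (s := Metric.ball 0 δ)
      (F := fun ε p => Real.log (1 + ε * q p)) (F' := fun ε p => q p / (1 + ε * q p))
      (bound := fun _ => 2 * L) (Metric.ball_mem_nhds _ hδ0) ?_ (hlogint 0 h0) ?_ ?_
      (integrable_const _) ?_).2
    · exact Eventually.of_forall fun ε => Measurable.aestronglyMeasurable (by fun_prop)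
    · exact Measurable.aestronglyMeasurable (by fun_prop)
    · refine ae_of_all _ fun p ε hε => ?_
      have h1 := abs_le.1 (hεq ε hε p)
      rw [norm_div, Real.norm_eq_abs, Real.norm_eq_abs, abs_of_pos (a := 1 + ε * q p) (by linarith),
        div_le_iff₀ (by linarith)]
      nlinarith [hqL p]
    · refine ae_of_all _ fun p ε hε => ?_
      have h1 := abs_le.1 (hεq ε hε p)
      have h2 : HasDerivAt (fun ε : ℝ => 1 + ε * q p) (q p) ε := by
        simpa using ((hasDerivAt_id ε).mul_const (q p)).const_add 1
      exact h2.log (by linarith)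
  have hd2 : HasDerivAt (fun ε => ∫ x, Q (x + ε * φ x) ∂μ)
      (∫ x, Q' (x + 0 * φ x) * φ x ∂μ) 0 := by
    refine (hasDerivAt_integral_of_dominated_loc_of_deriv_le (s := Metric.ball 0 δ)
      (F := fun ε x => Q (x + ε * φ x)) (F' := fun ε x => Q' (x + ε * φ x) * φ x)
      (bound := fun _ => 2 * L * B) (Metric.ball_mem_nhds _ hδ0) ?_ (hQint 0 h0) ?_ ?_
      (integrable_const _) ?_).2
    · exact Eventually.of_forall fun ε =>
        Measurable.aestronglyMeasurable (hQ.measurable.comp (by fun_prop))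
    · exact Measurable.aestronglyMeasurable ((hmQ'.comp (by fun_prop)).mul hφm)
    · filter_upwards [Measure.support_mem_ae (μ := μ)] with x hx ε hε
      have h1 := hR x hx
      rw [Real.norm_eq_abs] at h1
      have h2 := hεφ ε hε x
      have h3 := abs_sub_abs_le_abs_sub x (-(ε * φ x))
      rw [sub_neg_eq_add, abs_neg] at h3
      -- Only x Q'(x) is bounded, not Q'(x) itself. The factor φ compensates, since |φ(x)| ≤ 2L|x +
      -- εφ(x)|.
      have h4 := hB (x + ε * φ x) (by linarith [abs_add_le x (ε * φ x)])
      rw [abs_mul] at h4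
      rw [norm_mul, Real.norm_eq_abs, Real.norm_eq_abs]
      calc |Q' (x + ε * φ x)| * |φ x| ≤ |Q' (x + ε * φ x)| * (L * (2 * |x + ε * φ x|)) := by
            refine mul_le_mul_of_nonneg_left ((hφ0 x).trans ?_) (abs_nonneg _)
            exact mul_le_mul_of_nonneg_left (by linarith) hL.le
        _ = 2 * L * (|x + ε * φ x| * |Q' (x + ε * φ x)|) := by ring
        _ ≤ 2 * L * B := by gcongr
    · filter_upwards [ae_ne_of_noAtoms μ 0] with x hx ε hε
      have h2 := hεφ ε hε x
      have hx' := abs_pos.2 hx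
      have h1 : x + ε * φ x ≠ 0 := by
        intro hc
        have h4 := congrArg abs (eq_neg_of_add_eq_zero_left hc)
        rw [abs_neg] at h4
        linarith
      have h3 : HasDerivAt (fun ε : ℝ => x + ε * φ x) (φ x) ε := by
        simpa using ((hasDerivAt_id ε).mul_const (φ x)).const_add x
      exact (hQ' _ h1).comp ε h3
  have hmin0 : IsLocalMin (fun ε => -∫ p, Real.log (1 + ε * q p) ∂(μ.prod μ)
      + ∫ x, Q (x + ε * φ x) ∂μ) 0 := by
    filter_upwards [Metric.ball_mem_nhds _ hδ0] with ε hε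
    simpa using hmin ε hε
  have := hmin0.hasDerivAt_eq_zero (hd1.neg.add hd2)
  simp only [zero_mul, add_zero, div_one] at this
  linarith

theorem integral_divided_difference_complex (h : IsLogMinimizer Q μ) (hQ : Continuous Q)
    (hK : IsCompact μ.support) {Q' : ℝ → ℝ} (hQ' : ∀ x, x ≠ 0 → HasDerivAt Q (Q' x) x)
    (hmQ' : Measurable Q') (hbQ' : ∀ R, ∃ B, ∀ x, |x| ≤ R → |x * Q' x| ≤ B)
    {φ : ℝ → ℂ} {L : ℝ} (hφm : Measurable φ) (hL : 0 < L)
    (hφ : ∀ x y, ‖φ x - φ y‖ ≤ L * |x - y|) (hφ0 : ∀ x, ‖φ x‖ ≤ L * |x|) :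
    ∫ p, (φ p.1 - φ p.2) / ((p.1 - p.2 : ℝ) : ℂ) ∂(μ.prod μ) = ∫ x, (Q' x : ℂ) * φ x ∂μ := by
  have := h.isProb
  obtain ⟨R, hR0, hR⟩ := hK.isBounded.exists_pos_norm_le
  obtain ⟨B, hB⟩ := hbQ' R
  have hre := h.integral_divided_difference hQ hK hQ' hmQ' hbQ' (φ := fun x => (φ x).re)
    (Complex.measurable_re.comp hφm) hL
    (fun x y => (Complex.abs_re_le_norm (φ x - φ y)).trans (hφ x y))
    (fun x => (Complex.abs_re_le_norm _).trans (hφ0 x))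
  have him := h.integral_divided_difference hQ hK hQ' hmQ' hbQ' (φ := fun x => (φ x).im)
    (Complex.measurable_im.comp hφm) hL
    (fun x y => (Complex.abs_im_le_norm (φ x - φ y)).trans (hφ x y))
    (fun x => (Complex.abs_im_le_norm _).trans (hφ0 x))
  have i1 : Integrable (fun p : ℝ × ℝ => (φ p.1 - φ p.2) / ((p.1 - p.2 : ℝ) : ℂ))
      (μ.prod μ) := by
    refine Integrable.of_bound (Measurable.aestronglyMeasurable (by fun_prop)) L
      (ae_of_all _ fun p => ?_)
    rw [norm_div, Complex.norm_real, Real.norm_eq_abs]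
    exact div_le_of_le_mul₀ (abs_nonneg _) hL.le (hφ _ _)
  have i2 : Integrable (fun x => (Q' x : ℂ) * φ x) μ := by
    refine Integrable.of_bound (Measurable.aestronglyMeasurable (by fun_prop)) (L * B) ?_
    filter_upwards [Measure.support_mem_ae (μ := μ)] with x hx
    have h1 := hB x (hR x hx)
    rw [abs_mul] at h1
    rw [norm_mul, Complex.norm_real, Real.norm_eq_abs]
    calc |Q' x| * ‖φ x‖ ≤ |Q' x| * (L * |x|) :=
          mul_le_mul_of_nonneg_left (hφ0 x) (abs_nonneg _)
      _ = L * (|x| * |Q' x|) := by ring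
      _ ≤ L * B := by gcongr
  have r1 := integral_re i1
  have m1 := integral_im i1
  have r2 := integral_re i2
  have m2 := integral_im i2
  simp only [RCLike.re_eq_complex_re, RCLike.im_eq_complex_im] at r1 m1 r2 m2
  refine Complex.ext ?_ ?_
  · rw [← r1, ← r2]
    simpa only [Complex.div_ofReal_re, Complex.re_ofReal_mul, Complex.sub_re] using hre
  · rw [← m1, ← m2]
    simpa only [Complex.div_ofReal_im, Complex.im_ofReal_mul, Complex.sub_im] using him

end IsLogMinimizer

/-- The Stieltjes transform of a measure on the line. -/
noncomputable def stieltjes (μ : Measure ℝ) (z : ℂ) : ℂ := ∫ x : ℝ, 1 / (z - x) ∂μ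

/-- Quadratic growth of the denominator, uniform in x. It makes the test function x/(w - x²)
globally Lipschitz. -/
theorem exists_le_norm_sub_sq {w : ℂ} (hw : w.im ≠ 0) :
    ∃ c > 0, ∀ x : ℝ, c * (1 + x ^ 2) ≤ ‖w - (x : ℂ) ^ 2‖ := by
  have hi := abs_pos.2 hw
  refine ⟨((1 + ‖w‖) / |w.im| + 1)⁻¹, by positivity, fun x => ?_⟩
  have h1 : |w.im| ≤ ‖w - (x : ℂ) ^ 2‖ := by
    have := Complex.abs_im_le_norm (w - ((x ^ 2 : ℝ) : ℂ))
    rw [Complex.sub_im, Complex.ofReal_im, sub_zero] at this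
    exact_mod_cast this
  have h2 : x ^ 2 ≤ ‖w‖ + ‖w - (x : ℂ) ^ 2‖ := by
    have := norm_sub_le w (w - (x : ℂ) ^ 2)
    rw [sub_sub_cancel, norm_pow, Complex.norm_real, Real.norm_eq_abs, sq_abs] at this
    exact this
  rw [inv_mul_le_iff₀ (by positivity), add_mul, one_mul]
  have h3 : 1 + ‖w‖ ≤ (1 + ‖w‖) / |w.im| * ‖w - (x : ℂ) ^ 2‖ := by
    rw [div_mul_eq_mul_div, le_div_iff₀ hi]
    gcongr
  linarith

theorem sub_sq_ne_zero {w : ℂ} (hw : w.im ≠ 0) (x : ℝ) : w - (x : ℂ) ^ 2 ≠ 0 := by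
  intro h
  apply hw
  rw [sub_eq_zero.1 h, ← Complex.ofReal_pow, Complex.ofReal_im]

theorem integrable_one_div_sub_sq {μ : Measure ℝ} [IsFiniteMeasure μ] {w : ℂ} (hw : w.im ≠ 0) :
    Integrable (fun x : ℝ => 1 / (w - (x : ℂ) ^ 2)) μ := by
  obtain ⟨c, hc, hcx⟩ := exists_le_norm_sub_sq hw
  refine Integrable.of_bound (Measurable.aestronglyMeasurable (by fun_prop)) c⁻¹
    (ae_of_all _ fun x => ?_)
  rw [norm_div, norm_one, one_div]
  exact inv_anti₀ hc (by nlinarith [hcx x, sq_nonneg x])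

theorem integrable_div_sub_sq {μ : Measure ℝ} [IsFiniteMeasure μ] {w : ℂ} (hw : w.im ≠ 0) :
    Integrable (fun x : ℝ => (x : ℂ) / (w - (x : ℂ) ^ 2)) μ := by
  obtain ⟨c, hc, hcx⟩ := exists_le_norm_sub_sq hw
  refine Integrable.of_bound (Measurable.aestronglyMeasurable (by fun_prop)) c⁻¹
    (ae_of_all _ fun x => ?_)
  have h1 := hcx x
  have h2 : 0 < c * (1 + x ^ 2) := by positivity
  rw [norm_div, Complex.norm_real, Real.norm_eq_abs, div_le_iff₀ (h2.trans_le h1),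
    inv_mul_eq_div, le_div_iff₀ hc]
  nlinarith [sq_abs x, sq_nonneg (|x| - 1), abs_nonneg x]

/-- The Stieltjes transform of a symmetric measure. -/
theorem stieltjes_eq_mul {μ : Measure ℝ} [IsFiniteMeasure μ] (hs : μ.map (fun x => -x) = μ) {z : ℂ}
    (hz : (z ^ 2).im ≠ 0) : stieltjes μ z = z * ∫ x : ℝ, 1 / (z ^ 2 - (x : ℂ) ^ 2) ∂μ := by
  have i1 := integrable_one_div_sub_sq (μ := μ) hz
  have i2 := integrable_div_sub_sq (μ := μ) hz
  have h0 : ∫ x : ℝ, (x : ℂ) / (z ^ 2 - (x : ℂ) ^ 2) ∂μ = 0 := by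
    have h1 := integral_comp_neg_of_map_neg hs fun x : ℝ => (x : ℂ) / (z ^ 2 - (x : ℂ) ^ 2)
    simp only [Complex.ofReal_neg, neg_sq, neg_div] at h1
    rw [integral_neg] at h1
    exact self_eq_neg.1 h1.symm
  have h2 : ∀ x : ℝ, 1 / (z - (x : ℂ)) =
      z * (1 / (z ^ 2 - (x : ℂ) ^ 2)) + (x : ℂ) / (z ^ 2 - (x : ℂ) ^ 2) := by
    intro x
    have h3 := sub_sq_ne_zero hz x
    have h4 : z - (x : ℂ) ≠ 0 := fun hc => h3 (by rw [sub_eq_zero.1 hc]; ring)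
    field_simp
    ring
  rw [stieltjes]
  simp_rw [h2]
  rw [integral_add (i1.const_mul z) i2, h0, add_zero, integral_const_mul]

/-- The test function x/(w - x²) vanishes at the origin, and its divided difference (w + xy)/((w -
x²)(w - y²)) is a sum of two products. The product with numerator xy integrates to zero by symmetry,
and the other gives w(∫ 1/(w - x²) dμ)², the square of the Stieltjes transform. -/
theorem IsLogMinimizer.stieltjes_sq {Q : ℝ → ℝ} {μ : Measure ℝ}
    (h : IsLogMinimizer Q μ) (hQ : Continuous Q)
    (hK : IsCompact μ.support) (hs : μ.map (fun x => -x) = μ)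
    {Q' : ℝ → ℝ} (hQ' : ∀ x, x ≠ 0 → HasDerivAt Q (Q' x) x)
    (hmQ' : Measurable Q') (hbQ' : ∀ R, ∃ B, ∀ x, |x| ≤ R → |x * Q' x| ≤ B)
    {z : ℂ} (hz : (z ^ 2).im ≠ 0) :
    stieltjes μ z ^ 2 = ∫ x : ℝ, ((x * Q' x : ℝ) : ℂ) / (z ^ 2 - (x : ℂ) ^ 2) ∂μ := by
  have := h.isProb
  have := h.noAtoms
  obtain ⟨c, hc, hcx⟩ := exists_le_norm_sub_sq hz
  have i1 := integrable_one_div_sub_sq (μ := μ) hz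
  have i2 := integrable_div_sub_sq (μ := μ) hz
  have h0 : ∫ x : ℝ, (x : ℂ) / (z ^ 2 - (x : ℂ) ^ 2) ∂μ = 0 := by
    have h1 := integral_comp_neg_of_map_neg hs fun x : ℝ => (x : ℂ) / (z ^ 2 - (x : ℂ) ^ 2)
    simp only [Complex.ofReal_neg, neg_sq, neg_div] at h1
    rw [integral_neg] at h1
    exact self_eq_neg.1 h1.symm
  set w := z ^ 2 with hw
  have hdiff : ∀ x y : ℝ, (x : ℂ) / (w - (x : ℂ) ^ 2) - (y : ℂ) / (w - (y : ℂ) ^ 2) =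
      ((x - y : ℝ) : ℂ) * ((w + x * y) / ((w - (x : ℂ) ^ 2) * (w - (y : ℂ) ^ 2))) := by
    intro x y
    have h1 := sub_sq_ne_zero hz x
    have h2 := sub_sq_ne_zero hz y
    push_cast
    field_simp
    ring
  have hb : ∀ x y : ℝ, ‖(w + x * y) / ((w - (x : ℂ) ^ 2) * (w - (y : ℂ) ^ 2))‖ ≤
      (‖w‖ + 1) / c ^ 2 := by
    intro x y
    have h1 := hcx x
    have h2 := hcx y
    rw [norm_div, norm_mul]
    have h3 : ‖w + x * y‖ ≤ (‖w‖ + 1) * ((1 + x ^ 2) * (1 + y ^ 2)) := by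
      calc ‖w + x * y‖ ≤ ‖w‖ + |x| * |y| := by
            refine (norm_add_le _ _).trans_eq ?_
            rw [norm_mul, Complex.norm_real, Complex.norm_real, Real.norm_eq_abs, Real.norm_eq_abs]
        _ ≤ ‖w‖ * ((1 + x ^ 2) * (1 + y ^ 2)) + 1 * ((1 + x ^ 2) * (1 + y ^ 2)) := by
            have h4 : |x| ≤ 1 + x ^ 2 := by nlinarith [sq_abs x, sq_nonneg (|x| - 1), abs_nonneg x]
            have h5 : |y| ≤ 1 + y ^ 2 := by nlinarith [sq_abs y, sq_nonneg (|y| - 1), abs_nonneg y]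
            refine add_le_add (le_mul_of_one_le_right (norm_nonneg _) ?_) ?_
            · nlinarith [sq_nonneg x, sq_nonneg y, mul_nonneg (sq_nonneg x) (sq_nonneg y)]
            · rw [one_mul]
              gcongr
        _ = _ := by ring
    have hx0 : 0 < c * (1 + x ^ 2) := by positivity
    have hy0 : 0 < c * (1 + y ^ 2) := by positivity
    rw [div_le_div_iff₀ (mul_pos (hx0.trans_le h1) (hy0.trans_le h2)) (by positivity)]
    calc ‖w + x * y‖ * c ^ 2 ≤ (‖w‖ + 1) * ((1 + x ^ 2) * (1 + y ^ 2)) * c ^ 2 := by gcongr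
      _ = (‖w‖ + 1) * ((c * (1 + x ^ 2)) * (c * (1 + y ^ 2))) := by ring
      _ ≤ _ := by gcongr
  have hSD := h.integral_divided_difference_complex hQ hK hQ' hmQ' hbQ'
    (φ := fun x => (x : ℂ) / (w - (x : ℂ) ^ 2)) (L := (‖w‖ + 1) / c ^ 2 + c⁻¹)
    (by fun_prop) (by positivity)
    (fun x y => by
      rw [hdiff, norm_mul, Complex.norm_real, Real.norm_eq_abs, mul_comm]
      refine mul_le_mul_of_nonneg_right ((hb x y).trans ?_) (abs_nonneg _)
      linarith [inv_pos.2 hc])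
    (fun x => by
      have h1 := hcx x
      have h2 : 0 < c * (1 + x ^ 2) := by positivity
      rw [norm_div, Complex.norm_real, Real.norm_eq_abs, div_eq_inv_mul]
      refine mul_le_mul_of_nonneg_right ?_ (abs_nonneg _)
      have h3 : ‖w - (x : ℂ) ^ 2‖⁻¹ ≤ c⁻¹ := inv_anti₀ hc (by nlinarith [sq_nonneg x])
      have h4 : 0 ≤ (‖w‖ + 1) / c ^ 2 := by positivity
      linarith)
  have e1 : ∫ p : ℝ × ℝ, ((p.1 : ℂ) / (w - (p.1 : ℂ) ^ 2) - (p.2 : ℂ) / (w - (p.2 : ℂ) ^ 2)) /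
      ((p.1 - p.2 : ℝ) : ℂ) ∂(μ.prod μ) = w * ((∫ x : ℝ, 1 / (w - (x : ℂ) ^ 2) ∂μ) *
        ∫ x : ℝ, 1 / (w - (x : ℂ) ^ 2) ∂μ) + (∫ x : ℝ, (x : ℂ) / (w - (x : ℂ) ^ 2) ∂μ) *
        ∫ x : ℝ, (x : ℂ) / (w - (x : ℂ) ^ 2) ∂μ := by
    rw [← integral_prod_mul, ← integral_prod_mul, ← integral_const_mul,
      ← integral_add ((i1.mul_prod i1).const_mul w) (i2.mul_prod i2)]
    refine integral_congr_ae ?_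
    filter_upwards [ae_fst_ne_snd μ μ] with p hp
    have h1 : ((p.1 - p.2 : ℝ) : ℂ) ≠ 0 := Complex.ofReal_ne_zero.2 (sub_ne_zero.2 hp)
    have h2 := sub_sq_ne_zero hz p.1
    have h3 := sub_sq_ne_zero hz p.2
    rw [hdiff, mul_div_cancel_left₀ _ h1]
    field_simp
  rw [e1, h0, mul_zero, add_zero] at hSD
  rw [stieltjes_eq_mul hs hz, mul_pow, ← hw, sq, hSD]
  refine integral_congr_ae (ae_of_all _ fun x => ?_)
  push_cast
  ring

end ExternalSource


namespace ExternalSource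

open Filter Topology

/-! ### Analytic continuation of the quadratic equation for the Stieltjes transform -/

/-- The right half-plane. -/
def rightHalfPlane : Set ℂ := {z | 0 < z.re}

theorem isOpen_rightHalfPlane : IsOpen rightHalfPlane :=
  isOpen_lt continuous_const Complex.continuous_re

/-- The poles -τ lie in the closed left half-plane, at distance at least Re z from z. Every
nonpolynomial integral met below has this form or splits into two of it. -/
theorem differentiableOn_integral_div {X : Type*} [MeasurableSpace X] {ν : Measure X}
    [IsFiniteMeasure ν] {τ c : X → ℂ} (hτ : Measurable τ) (hτ0 : ∀ ω, 0 ≤ (τ ω).re)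
    (hc : Measurable c) {C : ℝ} (hC : ∀ ω, ‖c ω‖ ≤ C) :
    DifferentiableOn ℂ (fun z => ∫ ω, c ω / (z + τ ω) ∂ν) rightHalfPlane := by
  intro z hz
  have hz0 : 0 < z.re := hz
  have hre : ∀ w : ℂ, z.re / 2 < w.re → ∀ ω, z.re / 2 ≤ ‖w + τ ω‖ := fun w hw ω => by
    refine le_trans ?_ (Complex.re_le_norm _)
    rw [Complex.add_re]
    linarith [hτ0 ω]
  refine (hasDerivAt_integral_of_dominated_loc_of_deriv_le (s := {w | z.re / 2 < w.re})
    (F := fun w ω => c ω / (w + τ ω)) (F' := fun w ω => -c ω / (w + τ ω) ^ 2)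
    (bound := fun _ => C / (z.re / 2) ^ 2)
    ((isOpen_lt continuous_const Complex.continuous_re).mem_nhds (by
      rw [mem_ofPred_eq]; linarith)) ?_ ?_ ?_ ?_
    (integrable_const _) ?_).2.differentiableAt.differentiableWithinAt
  · exact Eventually.of_forall fun w => Measurable.aestronglyMeasurable (by fun_prop)
  · refine Integrable.of_bound (Measurable.aestronglyMeasurable (by fun_prop)) (C / (z.re / 2))
      (ae_of_all _ fun ω => ?_)
    rw [norm_div]
    exact div_le_div₀ ((norm_nonneg _).trans (hC ω)) (hC ω) (by positivity)
      (hre z (by linarith) ω)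
  · exact Measurable.aestronglyMeasurable (by fun_prop)
  · refine ae_of_all _ fun ω w hw => ?_
    rw [norm_div, norm_neg, norm_pow]
    exact div_le_div₀ ((norm_nonneg _).trans (hC ω)) (hC ω) (by positivity)
      (pow_le_pow_left₀ (by positivity) (hre w hw ω) 2)
  · refine ae_of_all _ fun ω w hw => ?_
    have h0 : w + τ ω ≠ 0 := by
      rw [← norm_pos_iff]
      exact lt_of_lt_of_le (by positivity) (hre w hw ω)
    refine ((hasDerivAt_const w (c ω)).div ((hasDerivAt_id w).add_const (τ ω)) h0).congr_deriv ?_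
    simp

theorem integrable_of_continuous_of_isCompact_support {E : Type*} [NormedAddCommGroup E]
    {μ : Measure ℝ} [IsFiniteMeasure μ] (hK : IsCompact μ.support) {f : ℝ → E}
    (hf : Continuous f) : Integrable f μ := by
  have h1 : IntegrableOn f μ.support μ := hf.continuousOn.integrableOn_compact hK
  have h2 : μ.restrict μ.support = μ := Measure.restrict_eq_self_of_ae_mem Measure.support_mem_ae
  rwa [IntegrableOn, h2] at h1

theorem sub_ofReal_ne_zero {z : ℂ} (hz : z.im ≠ 0) (x : ℝ) : z - (x : ℂ) ≠ 0 := by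
  intro h
  exact hz (by rw [sub_eq_zero.1 h, Complex.ofReal_im])

theorem exists_polynomial_divided_difference {μ : Measure ℝ} [IsFiniteMeasure μ]
    (hK : IsCompact μ.support) (R : Polynomial ℂ) :
    ∃ S : Polynomial ℂ, ∀ z : ℂ, z.im ≠ 0 →
      ∫ x : ℝ, (R.eval z - R.eval (x : ℂ)) / (z - x) ∂μ = S.eval z := by
  have hint : ∀ (P : Polynomial ℂ) {z : ℂ}, z.im ≠ 0 →
      Integrable (fun x : ℝ => (P.eval z - P.eval (x : ℂ)) / (z - x)) μ := fun P z hz =>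
    integrable_of_continuous_of_isCompact_support hK
      (Continuous.div (by fun_prop) (by fun_prop) (sub_ofReal_ne_zero hz))
  induction R using Polynomial.induction_on' with
  | add P Q hP hQ =>
    obtain ⟨S, hS⟩ := hP
    obtain ⟨T, hT⟩ := hQ
    refine ⟨S + T, fun z hz => ?_⟩
    rw [Polynomial.eval_add (p := S), ← hS z hz, ← hT z hz, ← integral_add (hint P hz) (hint Q hz)]
    refine integral_congr_ae (ae_of_all _ fun x => ?_)
    simp only [Polynomial.eval_add]
    ring
  | monomial n c =>
    refine ⟨∑ i ∈ Finset.range n, Polynomial.C (∫ x : ℝ, c * (x : ℂ) ^ (n - 1 - i) ∂μ)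
      * Polynomial.X ^ i, fun z hz => ?_⟩
    have h1 : ∀ x : ℝ, ((Polynomial.monomial n c).eval z -
        (Polynomial.monomial n c).eval (x : ℂ)) / (z - x) =
        ∑ i ∈ Finset.range n, c * (x : ℂ) ^ (n - 1 - i) * z ^ i := by
      intro x
      have h2 := geom_sum₂_mul z (x : ℂ) n
      rw [div_eq_iff (sub_ofReal_ne_zero hz x), Polynomial.eval_monomial,
        Polynomial.eval_monomial, ← mul_sub, ← h2, ← mul_assoc, Finset.mul_sum]
      congr 1
      exact Finset.sum_congr rfl fun i _ => by ring
    simp_rw [h1]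
    rw [integral_finsetSum _ fun i _ =>
      integrable_of_continuous_of_isCompact_support hK (by fun_prop)]
    simp only [Polynomial.eval_finsetSum, Polynomial.eval_mul, Polynomial.eval_C,
      Polynomial.eval_pow, Polynomial.eval_X]
    exact Finset.sum_congr rfl fun i _ => integral_mul_const _ _

/-- The analytic continuation of the derivative of the external field from the positive axis to
the right half-plane. -/
noncomputable def extFieldC (V : Polynomial ℝ) (a : ℝ) (m : Measure ℝ) (z : ℂ) : ℂ :=
  Polynomial.aeval z V.derivative - a + ∫ y : ℝ, z / (z ^ 2 + (y : ℂ) ^ 2) ∂m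

theorem add_mul_I_ne_zero {z : ℂ} (hz : z ∈ rightHalfPlane) (y : ℝ) : z + y * Complex.I ≠ 0 := by
  intro h
  have h1 : (z + y * Complex.I).re = 0 := by rw [h]; simp
  have h2 : 0 < z.re := hz
  simp at h1
  linarith

theorem div_sq_add_sq {z : ℂ} (hz : z ∈ rightHalfPlane) (y : ℝ) :
    z ^ 2 + (y : ℂ) ^ 2 ≠ 0 ∧ z / (z ^ 2 + (y : ℂ) ^ 2) =
      1 / 2 / (z + y * Complex.I) + 1 / 2 / (z + -(y * Complex.I)) := by
  have h1 := add_mul_I_ne_zero hz y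
  have h2 : z + -(y * Complex.I) ≠ 0 := by
    have := add_mul_I_ne_zero hz (-y)
    push_cast at this
    rwa [neg_mul] at this
  have h3 : z ^ 2 + (y : ℂ) ^ 2 = (z + y * Complex.I) * (z + -(y * Complex.I)) := by
    linear_combination (y : ℂ) ^ 2 * Complex.I_sq
  refine ⟨by rw [h3]; exact mul_ne_zero h1 h2, ?_⟩
  rw [h3]
  field_simp
  ring

theorem integrable_div_add {X : Type*} [MeasurableSpace X] {ν : Measure X}
    [IsFiniteMeasure ν] {τ c : X → ℂ} (hτ : Measurable τ) (hτ0 : ∀ ω, 0 ≤ (τ ω).re)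
    (hc : Measurable c) {C : ℝ} (hC : ∀ ω, ‖c ω‖ ≤ C) {z : ℂ} (hz : z ∈ rightHalfPlane) :
    Integrable (fun ω => c ω / (z + τ ω)) ν := by
  have hz0 : 0 < z.re := hz
  refine Integrable.of_bound (Measurable.aestronglyMeasurable (by fun_prop)) (C / z.re)
    (ae_of_all _ fun ω => ?_)
  rw [norm_div]
  refine div_le_div₀ ((norm_nonneg _).trans (hC ω)) (hC ω) hz0 ?_
  refine le_trans ?_ (Complex.re_le_norm _)
  rw [Complex.add_re]
  linarith [hτ0 ω]

/-- Integrals of `c(y) z / (z² + y²)` are analytic in the right half-plane. -/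
theorem differentiableOn_integral_div_sq_add {ν : Measure ℝ} [IsFiniteMeasure ν] {c : ℝ → ℂ}
    (hc : Measurable c) {C : ℝ} (hC : ∀ y, ‖c y‖ ≤ C) :
    (∀ z ∈ rightHalfPlane, Integrable (fun y : ℝ => c y * (z / (z ^ 2 + (y : ℂ) ^ 2))) ν) ∧
    DifferentiableOn ℂ (fun z => ∫ y : ℝ, c y * (z / (z ^ 2 + (y : ℂ) ^ 2)) ∂ν)
      rightHalfPlane := by
  have hc2 : Measurable fun y => c y * (1 / 2) := by fun_prop
  have hC2 : ∀ y, ‖c y * (1 / 2)‖ ≤ C := fun y => by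
    rw [norm_mul]
    have h0 : ‖(1 / 2 : ℂ)‖ = 1 / 2 := by simp
    rw [h0]
    linarith [hC y, norm_nonneg (c y)]
  have m1 : Measurable fun y : ℝ => (y : ℂ) * Complex.I := by fun_prop
  have m2 : Measurable fun y : ℝ => -((y : ℂ) * Complex.I) := by fun_prop
  have e : ∀ z ∈ rightHalfPlane, ∀ y : ℝ, c y * (1 / 2) / (z + y * Complex.I) +
      c y * (1 / 2) / (z + -(y * Complex.I)) = c y * (z / (z ^ 2 + (y : ℂ) ^ 2)) := by
    intro z hz y
    rw [(div_sq_add_sq hz y).2]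
    ring
  have i1 := fun z hz => integrable_div_add (ν := ν) m1 (fun y => by simp) hc2 hC2 (z := z) hz
  have i2 := fun z hz => integrable_div_add (ν := ν) m2 (fun y => by simp) hc2 hC2 (z := z) hz
  refine ⟨fun z hz => ((i1 z hz).add (i2 z hz)).congr (ae_of_all _ (e z hz)), ?_⟩
  refine ((differentiableOn_integral_div (ν := ν) m1 (fun y => by simp) hc2 hC2).add
    (differentiableOn_integral_div (ν := ν) m2 (fun y => by simp) hc2 hC2)).congr fun z hz => ?_
  rw [Pi.add_apply, ← integral_add (i1 z hz) (i2 z hz)]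
  exact integral_congr_ae (ae_of_all _ fun y => (e z hz y).symm)

theorem differentiableOn_extFieldC (V : Polynomial ℝ) (a : ℝ) (m : Measure ℝ)
    [IsFiniteMeasure m] : DifferentiableOn ℂ (extFieldC V a m) rightHalfPlane := by
  have h1 := (differentiableOn_integral_div_sq_add (ν := m) (c := fun _ => 1) measurable_const
    (C := 1) (by simp)).2
  simp only [one_mul] at h1
  refine DifferentiableOn.add (DifferentiableOn.sub_const ?_ _) h1
  exact (Polynomial.differentiable_aeval _).differentiableOn

theorem extFieldC_ofReal (V : Polynomial ℝ) (a : ℝ) (m : Measure ℝ) {x : ℝ} (hx : 0 < x) :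
    extFieldC V a m x = (extFieldDeriv V a m x : ℝ) := by
  rw [extFieldC, extFieldDeriv, sign_pos hx, ← integral_const_mul]
  push_cast
  rw [← integral_complex_ofReal]
  have h1 : Polynomial.aeval (x : ℂ) V.derivative = ((V.derivative.eval x : ℝ) : ℂ) := by
    rw [show (x : ℂ) = algebraMap ℝ ℂ x from rfl, Polynomial.aeval_algebraMap_apply,
      Polynomial.coe_aeval_eq_eval]
    rfl
  rw [h1]
  push_cast
  simp only [mul_one_div, SignType.coe_one, Complex.ofReal_one, mul_one]

theorem derivative_eval_neg {V : Polynomial ℝ} (hVeven : ∀ x : ℝ, V.eval (-x) = V.eval x) (x : ℝ) :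
    V.derivative.eval (-x) = -V.derivative.eval x := by
  have h1 := ((V.hasDerivAt (-x)).comp x (hasDerivAt_neg x))
  have h2 : (fun x => V.eval x) ∘ (fun x => -x) = fun x => V.eval x := funext hVeven
  rw [show (Neg.neg : ℝ → ℝ) = fun x => -x from rfl, h2] at h1
  have := h1.unique (V.hasDerivAt x)
  linarith

theorem measurable_extFieldDeriv (V : Polynomial ℝ) (a : ℝ) (m : Measure ℝ) [SFinite m] :
    Measurable (extFieldDeriv V a m) := by
  have h1 : Measurable fun x : ℝ => ∫ y, 1 / (x ^ 2 + y ^ 2) ∂m := by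
    have : StronglyMeasurable fun p : ℝ × ℝ => 1 / (p.1 ^ 2 + p.2 ^ 2) :=
      Measurable.stronglyMeasurable (by fun_prop)
    exact this.integral_prod_right.measurable
  have h2 : Measurable fun x : ℝ => ((SignType.sign x : SignType) : ℝ) := by
    have : (fun x : ℝ => ((SignType.sign x : SignType) : ℝ)) =
        fun x => if 0 < x then 1 else if x < 0 then -1 else 0 := by
      ext x
      rcases lt_trichotomy x 0 with h | rfl | h
      · simp [h, h.le.not_gt]
      · simp
      · simp [h]
    rw [this]
    exact Measurable.ite measurableSet_Ioi measurable_const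
      (Measurable.ite measurableSet_Iio measurable_const measurable_const)
  unfold extFieldDeriv
  fun_prop

/-- Multiplication by x removes the jump at the origin and leaves the integrand x²/(x² + y²), which
is at most one. Hence x Q'(x) is locally bounded. -/
theorem mul_extFieldDeriv (V : Polynomial ℝ) (a : ℝ) (m : Measure ℝ) (x : ℝ) :
    x * extFieldDeriv V a m x =
      x * V.derivative.eval x - a * |x| + ∫ y, x ^ 2 / (x ^ 2 + y ^ 2) ∂m := by
  have h1 : ∫ y, x ^ 2 / (x ^ 2 + y ^ 2) ∂m = x ^ 2 * ∫ y, 1 / (x ^ 2 + y ^ 2) ∂m := by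
    rw [← integral_const_mul]
    simp only [mul_one_div]
  rw [h1, extFieldDeriv, ← sign_mul_self]
  ring

theorem sq_div_add_sq_mem (x y : ℝ) : |x ^ 2 / (x ^ 2 + y ^ 2)| ≤ 1 := by
  rw [abs_of_nonneg (by positivity)]
  exact div_le_one_of_le₀ (by nlinarith [sq_nonneg y]) (by positivity)

theorem exists_bound_mul_extFieldDeriv (V : Polynomial ℝ) (a : ℝ) (m : Measure ℝ)
    [IsFiniteMeasure m] (R : ℝ) : ∃ B, ∀ x, |x| ≤ R → |x * extFieldDeriv V a m x| ≤ B := by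
  obtain ⟨B, hB⟩ := (isCompact_Icc (a := -R) (b := R)).exists_bound_of_continuousOn
    (f := fun x : ℝ => x * V.derivative.eval x - a * |x|) (by fun_prop)
  refine ⟨B + 1 * m.real univ, fun x hx => ?_⟩
  rw [mul_extFieldDeriv]
  refine (abs_add_le _ _).trans (add_le_add (hB x (abs_le.1 hx)) ?_)
  exact norm_integral_le_of_norm_le_const 
    (ae_of_all _ fun y => (Real.norm_eq_abs _).trans_le (sq_div_add_sq_mem x y))

/-- The left side is the integral of (zQ'(z) - xQ'(x))/(z² - x²), with Q' continued from the
positive axis. The numerator vanishes at x² = z² in each of its parts: the polynomial part leaves a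
polynomial over z, the part a(z - |x|) leaves a/(z + |x|), and the part of m leaves y²/((z² + y²)(x²
+ y²)). None of these has a pole for Re z > 0. -/
theorem exists_differentiableOn_eq {V : Polynomial ℝ} {a : ℝ} {m μ : Measure ℝ}
    (hm : IsConstrained a m) (h : IsLogMinimizer (extField V a m) μ) (hK : IsCompact μ.support)
    (hs : μ.map (fun x => -x) = μ) (hVeven : ∀ x : ℝ, V.eval (-x) = V.eval x) :
    ∃ J : ℂ → ℂ, DifferentiableOn ℂ J rightHalfPlane ∧ ∀ z ∈ rightHalfPlane, z.im ≠ 0 →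
      extFieldC V a m z * stieltjes μ z - stieltjes μ z ^ 2 = J z := by
  have := h.isProb
  have := hm.isFinite
  obtain ⟨S, hS⟩ := exists_polynomial_divided_difference hK
    (Polynomial.X * V.derivative.map (algebraMap ℝ ℂ))
  set c : ℝ → ℂ := fun y => ∫ x : ℝ, ((y ^ 2 / (y ^ 2 + x ^ 2) : ℝ) : ℂ) ∂μ with hc
  have hcm : Measurable c := by
    have : StronglyMeasurable fun p : ℝ × ℝ => ((p.1 ^ 2 / (p.1 ^ 2 + p.2 ^ 2) : ℝ) : ℂ) :=
      Measurable.stronglyMeasurable (by fun_prop)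
    exact this.integral_prod_right.measurable
  have hc1 : ∀ y, ‖c y‖ ≤ 1 := by
    intro y
    have := norm_integral_le_of_norm_le_const (μ := μ)
      (f := fun x : ℝ => ((y ^ 2 / (y ^ 2 + x ^ 2) : ℝ) : ℂ)) (C := 1)
      (ae_of_all _ fun x => by
        rw [Complex.norm_real]
        exact sq_div_add_sq_mem y x)
    rwa [probReal_univ, mul_one] at this
  obtain ⟨-, hdc⟩ := differentiableOn_integral_div_sq_add (ν := m) hcm hc1
  have hd1 := differentiableOn_integral_div (ν := μ) (τ := fun x : ℝ => ((|x| : ℝ) : ℂ))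
    (c := fun _ => 1) (by fun_prop) (fun x => by simp) measurable_const (C := 1) (by simp)
  refine ⟨fun z => S.eval z / z - a * ∫ x : ℝ, 1 / (z + ((|x| : ℝ) : ℂ)) ∂μ
    + (∫ y : ℝ, c y * (z / (z ^ 2 + (y : ℂ) ^ 2)) ∂m) / z, ?_, ?_⟩
  · have hz0 : ∀ z ∈ rightHalfPlane, z ≠ 0 := by
      rintro z hz rfl
      exact lt_irrefl (0 : ℝ) hz
    refine DifferentiableOn.add (DifferentiableOn.sub ?_ (hd1.const_mul _)) ?_
    · exact S.differentiable.differentiableOn.div differentiableOn_id hz0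
    · exact hdc.div differentiableOn_id hz0
  intro z hz hzi
  have hzr : 0 < z.re := hz
  have hw : (z ^ 2).im ≠ 0 := by
    rw [sq, Complex.mul_im]
    intro h0
    have : z.re * z.im = 0 := by linarith
    rcases mul_eq_zero.1 this with h1 | h1
    · exact hzr.ne' h1
    · exact hzi h1
  have hz0 : z ≠ 0 := by
    rintro rfl
    simp at hzi
  have hsq := h.stieltjes_sq (hm.continuous_extField V) hK hs
    (fun x hx => hm.hasDerivAt_extField V hx) (measurable_extFieldDeriv V a m)
    (exists_bound_mul_extFieldDeriv V a m) hw
  set w := z ^ 2 with hwdef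
  have i0 := integrable_one_div_sub_sq (μ := μ) hw
  -- the three parts of the divided difference
  set P : ℂ → ℂ := fun u => (Polynomial.X * V.derivative.map (algebraMap ℝ ℂ)).eval u with hP
  have hPc : Continuous P := by fun_prop
  have hPr : ∀ x : ℝ, P x = ((x * V.derivative.eval x : ℝ) : ℂ) := by
    intro x
    simp only [hP, Polynomial.eval_mul, Polynomial.eval_X, Polynomial.eval_map_algebraMap]
    rw [show (x : ℂ) = algebraMap ℝ ℂ x from rfl, Polynomial.aeval_algebraMap_apply,
      Polynomial.coe_aeval_eq_eval]
    simp
  have hcont : ∀ f : ℝ → ℂ, Continuous f →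
      Integrable (fun x : ℝ => f x / (w - (x : ℂ) ^ 2)) μ := fun f hf =>
    integrable_of_continuous_of_isCompact_support hK
      (hf.div (by fun_prop) (sub_sq_ne_zero hw))
  have p1 : z * ∫ x : ℝ, (P z - P x) / (w - (x : ℂ) ^ 2) ∂μ = S.eval z := by
    rw [← hS z hzi, ← integral_const_mul]
    -- The denominators are z - x on one side and z² - x² on the other. The extra factor z + x
    -- contributes only z, because P is even on the real axis and the x-term is odd.
    have h0 : ∫ x : ℝ, (x : ℂ) * (P z - P x) / (w - (x : ℂ) ^ 2) ∂μ = 0 := by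
      have h1 := integral_comp_neg_of_map_neg hs
        fun x : ℝ => (x : ℂ) * (P z - P x) / (w - (x : ℂ) ^ 2)
      have h2 : ∀ x : ℝ, ((-x : ℝ) : ℂ) * (P z - P (-x : ℝ)) / (w - ((-x : ℝ) : ℂ) ^ 2) =
          -((x : ℂ) * (P z - P x) / (w - (x : ℂ) ^ 2)) := by
        intro x
        rw [hPr, hPr, derivative_eval_neg hVeven]
        push_cast
        ring
      simp_rw [h2] at h1
      rw [integral_neg] at h1
      exact self_eq_neg.1 h1.symm
    rw [← add_zero (∫ x : ℝ, _ ∂μ), ← h0, ← integral_add ((hcont _ (by fun_prop)).const_mul z)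
      (hcont _ (by fun_prop))]
    refine integral_congr_ae (ae_of_all _ fun x => ?_)
    have h1 := sub_sq_ne_zero hw x
    have h2 := sub_ofReal_ne_zero hzi x
    dsimp only
    rw [← mul_div_assoc, ← add_div, div_eq_div_iff h1 h2, hwdef]
    ring
  have p2 : ∫ x : ℝ, (z - ((|x| : ℝ) : ℂ)) / (w - (x : ℂ) ^ 2) ∂μ =
      ∫ x : ℝ, 1 / (z + ((|x| : ℝ) : ℂ)) ∂μ := by
    refine integral_congr_ae (ae_of_all _ fun x => ?_)
    have h1 := sub_sq_ne_zero hw x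
    have h3 : (w - (x : ℂ) ^ 2) = (z - ((|x| : ℝ) : ℂ)) * (z + ((|x| : ℝ) : ℂ)) := by
      rw [← Complex.ofReal_pow, ← sq_abs, hwdef]
      push_cast
      ring
    rw [h3] at h1
    dsimp only
    rw [h3, div_mul_eq_div_div, div_self (left_ne_zero_of_mul h1)]
  set T : ℝ → ℝ := fun x => ∫ y, x ^ 2 / (x ^ 2 + y ^ 2) ∂m with hT
  have hTm : Measurable T := by
    have : StronglyMeasurable fun p : ℝ × ℝ => p.1 ^ 2 / (p.1 ^ 2 + p.2 ^ 2) :=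
      Measurable.stronglyMeasurable (by fun_prop)
    exact this.integral_prod_right.measurable
  have hTb : ∀ x, |T x| ≤ 1 * m.real univ := fun x =>
    norm_integral_le_of_norm_le_const
      (ae_of_all _ fun y => (Real.norm_eq_abs _).trans_le (sq_div_add_sq_mem x y))
  have iT : Integrable (fun x : ℝ => (T x : ℂ) / (w - (x : ℂ) ^ 2)) μ := by
    refine Integrable.mono' (i0.norm.const_mul (1 * m.real univ))
      (Measurable.aestronglyMeasurable (by fun_prop)) (ae_of_all _ fun x => ?_)
    rw [norm_div, norm_div, Complex.norm_real, Real.norm_eq_abs, norm_one, mul_one_div]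
    exact div_le_div_of_nonneg_right (hTb x) (norm_nonneg _)
  set E : ℂ := ∫ y : ℝ, z / (w + (y : ℂ) ^ 2) ∂m with hE
  have iE : Integrable (fun y : ℝ => z / (w + (y : ℂ) ^ 2)) m := by
    have := (differentiableOn_integral_div_sq_add (ν := m) (c := fun _ => 1) measurable_const
      (C := 1) (by simp)).1 z hz
    simpa only [one_mul] using this
  have p3 : z * ∫ x : ℝ, (z * E - T x) / (w - (x : ℂ) ^ 2) ∂μ =
      ∫ y : ℝ, c y * (z / (w + (y : ℂ) ^ 2)) ∂m := by
    have hfi : Integrable (fun p : ℝ × ℝ => ((p.2 ^ 2 / (p.2 ^ 2 + p.1 ^ 2) : ℝ) : ℂ) *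
        (z / (w + (p.2 : ℂ) ^ 2))) (μ.prod m) := by
      refine Integrable.mono (iE.comp_snd μ) (Measurable.aestronglyMeasurable (by fun_prop))
        (ae_of_all _ fun p => ?_)
      rw [norm_mul, Complex.norm_real, Real.norm_eq_abs]
      exact mul_le_of_le_one_left (norm_nonneg _) (sq_div_add_sq_mem _ _)
    have h1 : ∀ y : ℝ, c y * (z / (w + (y : ℂ) ^ 2)) = ∫ x : ℝ,
        ((y ^ 2 / (y ^ 2 + x ^ 2) : ℝ) : ℂ) * (z / (w + (y : ℂ) ^ 2)) ∂μ := fun y =>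
      (integral_mul_const _ _).symm
    simp_rw [h1]
    rw [← integral_prod_symm _ hfi, integral_prod _ hfi, ← integral_const_mul]
    refine integral_congr_ae (ae_of_all _ fun x => ?_)
    have h2 := sub_sq_ne_zero hw x
    have iT' : Integrable (fun y : ℝ => ((x ^ 2 / (x ^ 2 + y ^ 2) : ℝ) : ℂ)) m := by
      refine Integrable.of_bound (Measurable.aestronglyMeasurable (by fun_prop)) 1
        (ae_of_all _ fun y => ?_)
      rw [Complex.norm_real]
      exact sq_div_add_sq_mem x y
    dsimp only
    rw [hT, hE, ← integral_complex_ofReal, ← integral_const_mul,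
      ← integral_sub (iE.const_mul z) iT', ← integral_div, ← integral_const_mul]
    refine integral_congr_ae ?_
    -- Excluding y = 0 keeps x² + y² away from zero also at x = 0, where the identity would meet the
    -- default value of division.
    filter_upwards [hm.ae_ne_zero] with y hy
    have h3 := (div_sq_add_sq hz y).1
    have h4 : (y : ℂ) ^ 2 + (x : ℂ) ^ 2 ≠ 0 := by
      have : y ^ 2 + x ^ 2 ≠ 0 := by positivity
      exact_mod_cast this
    have h5 : (x : ℂ) ^ 2 + (y : ℂ) ^ 2 ≠ 0 := by rwa [add_comm]
    rw [← hwdef] at h3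
    push_cast
    field_simp
    rw [hwdef]
    ring
  have hsub : ∀ (A : ℂ) (f : ℝ → ℂ), Integrable (fun x : ℝ => f x / (w - (x : ℂ) ^ 2)) μ →
      ∫ x : ℝ, (A - f x) / (w - (x : ℂ) ^ 2) ∂μ =
      A * ∫ x : ℝ, 1 / (w - (x : ℂ) ^ 2) ∂μ - ∫ x : ℝ, f x / (w - (x : ℂ) ^ 2) ∂μ := by
    intro A f hf
    rw [← integral_const_mul, ← integral_sub (i0.const_mul _) hf]
    exact integral_congr_ae (ae_of_all _ fun x => by dsimp only; ring)
  have q1 := hsub (P z) (fun x => P x) (hcont _ (by fun_prop))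
  have q2 := hsub z (fun x => ((|x| : ℝ) : ℂ)) (hcont _ (by fun_prop))
  have q3 := hsub (z * E) (fun x => T x) iT
  have q4 : ∫ x : ℝ, ((x * extFieldDeriv V a m x : ℝ) : ℂ) / (w - (x : ℂ) ^ 2) ∂μ =
      ∫ x : ℝ, P x / (w - (x : ℂ) ^ 2) ∂μ
        - a * ∫ x : ℝ, ((|x| : ℝ) : ℂ) / (w - (x : ℂ) ^ 2) ∂μ
        + ∫ x : ℝ, (T x : ℂ) / (w - (x : ℂ) ^ 2) ∂μ := by
    have j1 := hcont (fun x : ℝ => P x) (by fun_prop)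
    have j2 := (hcont (fun x : ℝ => ((|x| : ℝ) : ℂ)) (by fun_prop)).const_mul (a : ℂ)
    have j3 : Integrable (fun x : ℝ => P x / (w - (x : ℂ) ^ 2)
        - a * (((|x| : ℝ) : ℂ) / (w - (x : ℂ) ^ 2))) μ := j1.sub j2
    rw [← integral_const_mul, ← integral_sub j1 j2, ← integral_add j3 iT]
    refine integral_congr_ae (ae_of_all _ fun x => ?_)
    dsimp only
    rw [mul_extFieldDeriv, hPr]
    push_cast
    ring
  have hPz : P z = z * Polynomial.aeval z V.derivative := by
    simp only [hP, Polynomial.eval_mul, Polynomial.eval_X, Polynomial.eval_map_algebraMap]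
  have hp1 := p1
  have hp3 := p3
  rw [q1, hPz] at hp1
  rw [q2] at p2
  rw [q3] at hp3
  dsimp only
  rw [hsq, q4, stieltjes_eq_mul hs hw, extFieldC, ← hwdef, ← hE, ← hp1, ← p2, ← hp3,
    mul_div_cancel_left₀ _ hz0, mul_div_cancel_left₀ _ hz0]
  ring

end ExternalSource


namespace ExternalSource

open Filter Topology

/-! ### Inversion of the Stieltjes transform -/

/-- The Stieltjes transform of `μ` solves a quadratic equation with coefficients that are analytic
in the right half-plane and real on the positive axis. -/
structure HasQuadraticEquation (μ : Measure ℝ) (A D : ℂ → ℂ) : Prop where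
  differentiableOn_A : DifferentiableOn ℂ A rightHalfPlane
  differentiableOn_D : DifferentiableOn ℂ D rightHalfPlane
  im_A : ∀ x : ℝ, 0 < x → (A x).im = 0
  im_D : ∀ x : ℝ, 0 < x → (D x).im = 0
  eq : ∀ z ∈ rightHalfPlane, z.im ≠ 0 → (stieltjes μ z - A z) ^ 2 = D z

theorem stieltjes_conj (μ : Measure ℝ) (z : ℂ) :
    stieltjes μ (starRingEnd ℂ z) = starRingEnd ℂ (stieltjes μ z) := by
  rw [stieltjes, stieltjes, ← integral_conj]
  simp

theorem extFieldC_conj (V : Polynomial ℝ) (a : ℝ) (m : Measure ℝ) (z : ℂ) :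
    extFieldC V a m (starRingEnd ℂ z) = starRingEnd ℂ (extFieldC V a m z) := by
  rw [extFieldC, extFieldC, map_add, map_sub, ← integral_conj, Complex.conj_ofReal,
    Polynomial.aeval_conj]
  simp

theorem ofReal_mem_rightHalfPlane {x : ℝ} (hx : 0 < x) : (x : ℂ) ∈ rightHalfPlane := by
  simpa [rightHalfPlane] using hx

theorem add_mul_I_mem_rightHalfPlane {x : ℝ} (hx : 0 < x) (ε : ℝ) :
    (x : ℂ) + ε * Complex.I ∈ rightHalfPlane := by
  simpa [rightHalfPlane] using hx

theorem tendsto_add_mul_I (x : ℝ) :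
    Tendsto (fun ε : ℝ => (x : ℂ) + ε * Complex.I) (𝓝[>] 0) (𝓝 x) := by
  have : Continuous fun ε : ℝ => (x : ℂ) + ε * Complex.I := by fun_prop
  simpa using (this.tendsto 0).mono_left nhdsWithin_le_nhds

theorem continuousAt_of_rightHalfPlane {A : ℂ → ℂ} (hA : DifferentiableOn ℂ A rightHalfPlane)
    {z : ℂ} (hz : z ∈ rightHalfPlane) : ContinuousAt A z :=
  (hA.differentiableAt (isOpen_rightHalfPlane.mem_nhds hz)).continuousAt

/-- Completing the square in Q'G - G² = J gives D = (Q'/2)² - J. Both G and Q' commute with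
conjugation, so the limits of D from above and from below the axis are conjugate; by continuity they
coincide, and D is real there. -/
theorem hasQuadraticEquation {V : Polynomial ℝ} {a : ℝ} {m μ : Measure ℝ}
    (hm : IsConstrained a m) (h : IsLogMinimizer (extField V a m) μ) (hK : IsCompact μ.support)
    (hs : μ.map (fun x => -x) = μ) (hVeven : ∀ x : ℝ, V.eval (-x) = V.eval x) :
    ∃ D : ℂ → ℂ, HasQuadraticEquation μ (fun z => extFieldC V a m z / 2) D := by
  have := hm.isFinite
  obtain ⟨J, hJ, hJe⟩ := exists_differentiableOn_eq hm h hK hs hVeven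
  have hA : DifferentiableOn ℂ (fun z => extFieldC V a m z / 2) rightHalfPlane :=
    (differentiableOn_extFieldC V a m).div_const 2
  have hD : DifferentiableOn ℂ (fun z => (extFieldC V a m z / 2) ^ 2 - J z) rightHalfPlane :=
    (hA.pow 2).sub hJ
  have heq : ∀ z ∈ rightHalfPlane, z.im ≠ 0 →
      (stieltjes μ z - extFieldC V a m z / 2) ^ 2 = (extFieldC V a m z / 2) ^ 2 - J z := by
    intro z hz hzi
    rw [← hJe z hz hzi]
    ring
  refine ⟨_, hA, hD, fun x hx => ?_, fun x hx => ?_, heq⟩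
  · rw [extFieldC_ofReal V a m hx]
    simp
  · refine Complex.conj_eq_iff_im.1 ?_
    have hc := continuousAt_of_rightHalfPlane hD (ofReal_mem_rightHalfPlane hx)
    have h1 := hc.tendsto.comp (tendsto_add_mul_I x)
    have h2 := (Complex.continuous_conj.tendsto _).comp h1
    have h3 : Tendsto (fun ε : ℝ => starRingEnd ℂ ((x : ℂ) + ε * Complex.I)) (𝓝[>] 0) (𝓝 x) := by
      have := (Complex.continuous_conj.tendsto _).comp (tendsto_add_mul_I x)
      rwa [Complex.conj_ofReal] at this
    have h4 := hc.tendsto.comp h3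
    refine tendsto_nhds_unique h2 (h4.congr' ?_)
    filter_upwards [self_mem_nhdsWithin] with ε hε
    have hz := add_mul_I_mem_rightHalfPlane hx ε
    have hzi : ((x : ℂ) + ε * Complex.I).im ≠ 0 := by simpa using ne_of_gt hε
    have hz' : starRingEnd ℂ ((x : ℂ) + ε * Complex.I) ∈ rightHalfPlane := by
      simpa [rightHalfPlane] using hx
    have hzi' : (starRingEnd ℂ ((x : ℂ) + ε * Complex.I)).im ≠ 0 := by simpa using ne_of_gt hε
    simp only [Function.comp_apply]
    rw [← heq _ hz hzi, ← heq _ hz' hzi', stieltjes_conj, extFieldC_conj]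
    simp only [map_sub, map_pow, map_div₀, map_ofNat]

theorem norm_one_div_sub_le {z : ℂ} (hz : z.im ≠ 0) (y : ℝ) : ‖1 / (z - (y : ℂ))‖ ≤ |z.im|⁻¹ := by
  rw [norm_div, norm_one, one_div]
  refine inv_anti₀ (abs_pos.2 hz) ?_
  simpa using Complex.abs_im_le_norm (z - (y : ℂ))

theorem integrable_one_div_sub {μ : Measure ℝ} [IsFiniteMeasure μ] {z : ℂ} (hz : z.im ≠ 0) :
    Integrable (fun y : ℝ => 1 / (z - (y : ℂ))) μ :=
  Integrable.of_bound (Measurable.aestronglyMeasurable (by fun_prop)) _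
    (ae_of_all _ (norm_one_div_sub_le hz))

/-- The imaginary part of the Stieltjes transform is a Poisson integral. -/
theorem im_stieltjes (μ : Measure ℝ) [IsFiniteMeasure μ] (x : ℝ) {ε : ℝ} (hε : 0 < ε) :
    (stieltjes μ (x + ε * Complex.I)).im = -∫ y, ε / ((x - y) ^ 2 + ε ^ 2) ∂μ := by
  have hz : ((x : ℂ) + ε * Complex.I).im ≠ 0 := by simpa using hε.ne'
  have h1 := integral_im (integrable_one_div_sub (μ := μ) hz)
  simp only [RCLike.im_eq_complex_im] at h1
  rw [stieltjes, ← h1, ← integral_neg]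
  refine integral_congr_ae (ae_of_all _ fun y => ?_)
  simp only [one_div, Complex.inv_im, Complex.normSq_apply, Complex.sub_im, Complex.add_im,
    Complex.ofReal_im, Complex.mul_im, Complex.ofReal_re, Complex.I_im, mul_one, Complex.I_re,
    mul_zero, add_zero, zero_add, sub_zero, Complex.sub_re, Complex.add_re, Complex.mul_re,
    sub_self, neg_div]
  ring_nf

theorem im_stieltjes_nonpos (μ : Measure ℝ) [IsFiniteMeasure μ] (x : ℝ) {ε : ℝ} (hε : 0 < ε) :
    (stieltjes μ (x + ε * Complex.I)).im ≤ 0 := by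
  rw [im_stieltjes μ x hε, neg_nonpos]
  exact integral_nonneg fun y => by positivity

/-- The density of `μ`, as a function of `|x|`. -/
noncomputable def density (D : ℂ → ℂ) (x : ℝ) : ℝ := √(max (-(D ((|x| : ℝ) : ℂ)).re) 0) / Real.pi

namespace HasQuadraticEquation

variable {μ : Measure ℝ} {A D : ℂ → ℂ}

/-- For any complex w one has (Im w)² = (|w²| - Re w²)/2. With w = G - A this determines |Im w| in
the limit from D, and the sign comes from Im G ≤ 0 together with Im A → 0. -/
theorem tendsto_im_stieltjes [IsFiniteMeasure μ] (h : HasQuadraticEquation μ A D) {x : ℝ}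
    (hx : 0 < x) :
    Tendsto (fun ε : ℝ => (stieltjes μ (x + ε * Complex.I)).im) (𝓝[>] 0)
      (𝓝 (-√(max (-(D x).re) 0))) := by
  have hx' := ofReal_mem_rightHalfPlane hx
  have hA := ((Complex.continuous_im.tendsto _).comp
    ((continuousAt_of_rightHalfPlane h.differentiableOn_A hx').tendsto.comp (tendsto_add_mul_I x)))
  rw [h.im_A x hx] at hA
  have hD := (continuousAt_of_rightHalfPlane h.differentiableOn_D hx').tendsto.comp
    (tendsto_add_mul_I x)
  have hlim : Tendsto (fun ε : ℝ => √((‖D (x + ε * Complex.I)‖ - (D (x + ε * Complex.I)).re) / 2))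
      (𝓝[>] 0) (𝓝 √(max (-(D x).re) 0)) := by
    have h1 : (‖D x‖ - (D x).re) / 2 = max (-(D x).re) 0 := by
      have h2 : ‖D x‖ = |(D x).re| := by
        rw [← Complex.abs_re_eq_norm.2 (h.im_D x hx)]
      rw [h2]
      rcases le_total 0 (D x).re with h3 | h3
      · rw [abs_of_nonneg h3, max_eq_right (by linarith)]
        ring
      · rw [abs_of_nonpos h3, max_eq_left (by linarith)]
        ring
    rw [← h1]
    exact ((hD.norm.sub ((Complex.continuous_re.tendsto _).comp hD)).div_const 2).sqrt
  set v : ℝ → ℝ := fun ε => (stieltjes μ (x + ε * Complex.I) - A (x + ε * Complex.I)).im with hv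
  have habs : Tendsto (fun ε => |v ε|) (𝓝[>] 0) (𝓝 √(max (-(D x).re) 0)) := by
    refine hlim.congr' ?_
    filter_upwards [self_mem_nhdsWithin] with ε hε
    have hzi : ((x : ℂ) + ε * Complex.I).im ≠ 0 := by simpa using ne_of_gt hε
    rw [← h.eq _ (add_mul_I_mem_rightHalfPlane hx ε) hzi, ← Real.sqrt_sq_eq_abs, norm_pow,
      ← Complex.normSq_eq_norm_sq, Complex.normSq_apply, sq (_ - _), Complex.mul_re, hv]
    congr 1
    ring
  -- Since Im G ≤ 0, a positive value of v is at most |Im A|, so the positive part of v disappears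
  -- in the limit.
  have hsum : Tendsto (fun ε => v ε + |v ε|) (𝓝[>] 0) (𝓝 0) := by
    have hA2 := hA.abs.const_mul 2
    rw [abs_zero, mul_zero] at hA2
    refine squeeze_zero' (Eventually.of_forall fun ε => by linarith [neg_abs_le (v ε)]) ?_ hA2
    filter_upwards [self_mem_nhdsWithin] with ε hε
    have h1 := im_stieltjes_nonpos μ x hε
    have h2 : v ε = (stieltjes μ (x + ε * Complex.I)).im - (A (x + ε * Complex.I)).im := by
      simp only [hv, Complex.sub_im]
    have h3 := neg_abs_le (A (x + ε * Complex.I)).im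
    simp only [Function.comp_apply]
    rcases le_total 0 (v ε) with h4 | h4
    · rw [abs_of_nonneg h4]
      linarith
    · rw [abs_of_nonpos h4]
      linarith [abs_nonneg (A (x + ε * Complex.I)).im]
  have := (hsum.sub habs).add hA
  rw [zero_sub, add_zero] at this
  refine this.congr fun ε => ?_
  simp only [hv, Complex.sub_im, Function.comp_apply]
  ring

/-- The quadratic equation bounds G up to the axis by the sizes of A and D on a compact subset of
the half-plane. This is the dominating constant for the inversion. -/
theorem exists_bound [IsFiniteMeasure μ] (h : HasQuadraticEquation μ A D) {c : ℝ} (hc : 0 < c)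
    (d : ℝ) : ∃ C, ∀ x ∈ Icc c d, ∀ ε ∈ Ioc (0 : ℝ) 1,
      ‖stieltjes μ (x + ε * Complex.I)‖ ≤ C := by
  have hK : IsCompact ((fun p : ℝ × ℝ => (p.1 : ℂ) + p.2 * Complex.I) '' (Icc c d ×ˢ Icc 0 1)) :=
    (isCompact_Icc.prod isCompact_Icc).image (by fun_prop)
  have hsub : (fun p : ℝ × ℝ => (p.1 : ℂ) + p.2 * Complex.I) '' (Icc c d ×ˢ Icc 0 1) ⊆
      rightHalfPlane := by
    rintro _ ⟨p, hp, rfl⟩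
    exact add_mul_I_mem_rightHalfPlane (hc.trans_le hp.1.1) _
  obtain ⟨C₁, h1⟩ := hK.exists_bound_of_continuousOn (h.differentiableOn_A.continuousOn.mono hsub)
  obtain ⟨C₂, h2⟩ := hK.exists_bound_of_continuousOn (h.differentiableOn_D.continuousOn.mono hsub)
  refine ⟨C₁ + √C₂, fun x hx ε hε => ?_⟩
  have hmem : (x : ℂ) + ε * Complex.I ∈
      (fun p : ℝ × ℝ => (p.1 : ℂ) + p.2 * Complex.I) '' (Icc c d ×ˢ Icc 0 1) :=
    ⟨(x, ε), ⟨hx, hε.1.le, hε.2⟩, rfl⟩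
  have hzi : ((x : ℂ) + ε * Complex.I).im ≠ 0 := by simpa using ne_of_gt hε.1
  have h3 := h2 _ hmem
  rw [← h.eq _ (hsub hmem) hzi, norm_pow] at h3
  have h4 := Real.le_sqrt_of_sq_le h3
  have h5 := norm_le_norm_add_norm_sub' (stieltjes μ (x + ε * Complex.I)) (A (x + ε * Complex.I))
  linarith [h1 _ hmem]

theorem integral_poisson (μ : Measure ℝ) [IsFiniteMeasure μ] {c d : ℝ} (hcd : c ≤ d) {ε : ℝ}
    (hε : 0 < ε) : ∫ x in c..d, (stieltjes μ (x + ε * Complex.I)).im =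
      -∫ y, (Real.arctan ((d - y) / ε) - Real.arctan ((c - y) / ε)) ∂μ := by
  simp_rw [im_stieltjes μ _ hε]
  rw [intervalIntegral.integral_neg, intervalIntegral.integral_of_le hcd, integral_integral_swap]
  · congr 1
    refine integral_congr_ae (ae_of_all _ fun y => ?_)
    dsimp only
    rw [← intervalIntegral.integral_of_le hcd]
    have hcont : Continuous fun x : ℝ => ε / ((x - y) ^ 2 + ε ^ 2) :=
      Continuous.div (by fun_prop) (by fun_prop) fun x => by positivity
    refine intervalIntegral.integral_eq_sub_of_hasDerivAt
      (f := fun x => Real.arctan ((x - y) / ε)) (fun x _ => ?_) (hcont.intervalIntegrable _ _)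
    have h1 : HasDerivAt (fun x : ℝ => (x - y) / ε) (1 / ε) x :=
      ((hasDerivAt_id x).sub_const y).div_const ε
    refine h1.arctan.congr_deriv ?_
    field_simp
    ring
  · refine Integrable.of_bound (Measurable.aestronglyMeasurable (by unfold Function.uncurry; fun_prop)) ε⁻¹
      (ae_of_all _ fun p => ?_)
    simp only [Function.uncurry]
    rw [Real.norm_of_nonneg (by positivity), div_le_iff₀ (by positivity)]
    field_simp
    nlinarith [sq_nonneg (p.1 - p.2)]

theorem tendsto_arctan_div {t : ℝ} :
    (0 < t → Tendsto (fun ε : ℝ => Real.arctan (t / ε)) (𝓝[>] 0) (𝓝 (Real.pi / 2))) ∧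
    (t < 0 → Tendsto (fun ε : ℝ => Real.arctan (t / ε)) (𝓝[>] 0) (𝓝 (-(Real.pi / 2)))) := by
  have hpos : ∀ t : ℝ, 0 < t →
      Tendsto (fun ε : ℝ => Real.arctan (t / ε)) (𝓝[>] 0) (𝓝 (Real.pi / 2)) := by
    intro t ht
    have h1 : Tendsto (fun ε : ℝ => t / ε) (𝓝[>] 0) atTop := by
      simpa only [div_eq_mul_inv] using tendsto_inv_nhdsGT_zero.const_mul_atTop ht
    exact (Real.tendsto_arctan_atTop.mono_right nhdsWithin_le_nhds).comp h1
  refine ⟨hpos t, fun ht => ?_⟩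
  have := (hpos (-t) (by linarith)).neg
  refine this.congr fun ε => ?_
  rw [neg_div, Real.arctan_neg, neg_neg]

/-- Stieltjes inversion: the integral of -Im G over [c, d] is a smoothed indicator integrated
against μ, and both sides are evaluated as ε → 0. The endpoints do not matter because μ has no
atoms. -/
theorem measureReal_Ioo [IsFiniteMeasure μ] [NullSingletonClass μ]
    (h : HasQuadraticEquation μ A D) {c d : ℝ} (hc : 0 < c) (hcd : c ≤ d) :
    μ.real (Ioo c d) = ∫ x in c..d, density D x := by
  have lim1 : Tendsto (fun ε : ℝ => ∫ x in c..d, (stieltjes μ (x + ε * Complex.I)).im) (𝓝[>] 0)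
      (𝓝 (∫ x in c..d, -√(max (-(D x).re) 0))) := by
    obtain ⟨C, hC⟩ := h.exists_bound hc d
    refine intervalIntegral.tendsto_integral_filter_of_dominated_convergence (fun _ => C) ?_ ?_
      (by simp) ?_
    · refine Eventually.of_forall fun ε => Measurable.aestronglyMeasurable ?_
      have : StronglyMeasurable fun p : ℝ × ℝ => 1 / ((p.1 : ℂ) + ε * Complex.I - p.2) :=
        Measurable.stronglyMeasurable (by fun_prop)
      exact Complex.measurable_im.comp this.integral_prod_right.measurable
    · filter_upwards [Ioc_mem_nhdsGT one_pos] with ε hε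
      refine ae_of_all _ fun x hx => ?_
      rw [uIoc_of_le hcd] at hx
      exact (Complex.abs_im_le_norm _).trans (hC x ⟨hx.1.le, hx.2⟩ ε hε)
    · refine ae_of_all _ fun x hx => ?_
      rw [uIoc_of_le hcd] at hx
      exact h.tendsto_im_stieltjes (hc.trans hx.1)
  have lim2 : Tendsto (fun ε : ℝ => -∫ y, (Real.arctan ((d - y) / ε) - Real.arctan ((c - y) / ε)) ∂μ)
      (𝓝[>] 0) (𝓝 (-∫ y, (Ioo c d).indicator (fun _ => Real.pi) y ∂μ)) := by
    refine Tendsto.neg (tendsto_integral_filter_of_dominated_convergence (fun _ => Real.pi) ?_ ?_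
      (integrable_const _) ?_)
    · exact Eventually.of_forall fun ε => Measurable.aestronglyMeasurable (by fun_prop)
    · refine Eventually.of_forall fun ε => ae_of_all _ fun y => ?_
      have h1 := Real.arctan_lt_pi_div_two ((d - y) / ε)
      have h2 := Real.neg_pi_div_two_lt_arctan ((d - y) / ε)
      have h3 := Real.arctan_lt_pi_div_two ((c - y) / ε)
      have h4 := Real.neg_pi_div_two_lt_arctan ((c - y) / ε)
      rw [Real.norm_eq_abs, abs_le]
      constructor <;> linarith
    · filter_upwards [ae_ne_of_noAtoms μ c, ae_ne_of_noAtoms μ d] with y hyc hyd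
      rcases lt_or_gt_of_ne hyc with h1 | h1
      · rw [indicator_of_notMem fun hy => h1.not_gt hy.1]
        have := ((tendsto_arctan_div (t := d - y)).1 (by linarith)).sub
          ((tendsto_arctan_div (t := c - y)).1 (by linarith))
        rwa [sub_self] at this
      · rcases lt_or_gt_of_ne hyd with h2 | h2
        · rw [indicator_of_mem (show y ∈ Ioo c d from ⟨h1, h2⟩)]
          have := ((tendsto_arctan_div (t := d - y)).1 (by linarith)).sub
            ((tendsto_arctan_div (t := c - y)).2 (by linarith))
          rwa [show Real.pi / 2 - -(Real.pi / 2) = Real.pi by ring] at this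
        · rw [indicator_of_notMem fun hy => h2.not_gt hy.2]
          have := ((tendsto_arctan_div (t := d - y)).2 (by linarith)).sub
            ((tendsto_arctan_div (t := c - y)).2 (by linarith))
          rwa [sub_self] at this
  have heq := tendsto_nhds_unique_of_eventuallyEq lim1 lim2
    (by filter_upwards [self_mem_nhdsWithin] with ε hε using integral_poisson μ hcd hε)
  rw [integral_indicator_const _ measurableSet_Ioo, intervalIntegral.integral_neg, neg_inj,
    smul_eq_mul] at heq
  have h2 : ∫ x in c..d, density D x = (∫ x in c..d, √(max (-(D x).re) 0)) / Real.pi := by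
    rw [← intervalIntegral.integral_div]
    refine intervalIntegral.integral_congr fun x hx => ?_
    rw [uIcc_of_le hcd] at hx
    simp only [density, abs_of_pos (hc.trans_le hx.1)]
  rw [h2, heq, mul_div_cancel_right₀ _ Real.pi_ne_zero]

end HasQuadraticEquation
end ExternalSource


namespace ExternalSource

open Filter Topology

/-! ### The density -/

theorem continuousOn_comp_ofReal {D : ℂ → ℂ} (hD : DifferentiableOn ℂ D rightHalfPlane) :
    ContinuousOn (fun x : ℝ => D x) (Ioi 0) :=
  hD.continuousOn.comp Complex.continuous_ofReal.continuousOn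
    fun _ hx => ofReal_mem_rightHalfPlane hx

theorem density_nonneg (D : ℂ → ℂ) (x : ℝ) : 0 ≤ density D x := by
  unfold density
  positivity

theorem density_neg (D : ℂ → ℂ) (x : ℝ) : density D (-x) = density D x := by
  rw [density, density, abs_neg]

theorem continuousOn_density {D : ℂ → ℂ} (hD : DifferentiableOn ℂ D rightHalfPlane) :
    ContinuousOn (density D) {0}ᶜ := by
  have h1 : ContinuousOn (fun x : ℝ => D ((|x| : ℝ) : ℂ)) {0}ᶜ :=
    (continuousOn_comp_ofReal hD).comp continuous_abs.continuousOn fun x hx => abs_pos.2 hx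
  have h2 : ContinuousOn (fun x : ℝ => max (-(D ((|x| : ℝ) : ℂ)).re) 0) {0}ᶜ :=
    (Complex.continuous_re.comp_continuousOn h1).neg.sup continuousOn_const
  exact (Real.continuous_sqrt.comp_continuousOn h2).div_const _

theorem measurable_density {D : ℂ → ℂ} (hD : DifferentiableOn ℂ D rightHalfPlane) :
    Measurable (density D) :=
  measurable_of_continuousOn_compl_singleton 0 (continuousOn_density hD)

namespace HasQuadraticEquation

variable {μ : Measure ℝ} {A D : ℂ → ℂ}

theorem measure_Ioc [IsFiniteMeasure μ] [NullSingletonClass μ]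
    (h : HasQuadraticEquation μ A D) {c d : ℝ} (hc : 0 < c) :
    μ (Ioc c d) = volume.withDensity (fun x => ENNReal.ofReal (density D x)) (Ioc c d) := by
  rcases lt_or_ge d c with hcd | hcd
  · simp [Ioc_eq_empty_of_le hcd.le]
  have hint : IntegrableOn (density D) (Ioc c d) := by
    refine (ContinuousOn.integrableOn_Icc ?_).mono_set Ioc_subset_Icc_self
    exact (continuousOn_density h.differentiableOn_D).mono fun x hx => (hc.trans_le hx.1).ne'
  rw [withDensity_apply _ measurableSet_Ioc, ← ofReal_integral_eq_lintegral_ofReal hint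
    (ae_of_all _ (density_nonneg D)), ← intervalIntegral.integral_of_le hcd,
    ← h.measureReal_Ioo hc hcd, ofReal_measureReal, measure_congr Ioo_ae_eq_Ioc]

/-- The inversion works only at positive distance from the origin, so the positive axis is exhausted
by the rays beyond 1/(n + 1). Symmetry gives the negative axis, and the origin is null for both
measures. -/
theorem eq_withDensity [IsFiniteMeasure μ] [NullSingletonClass μ]
    (h : HasQuadraticEquation μ A D) (hs : μ.map (fun x => -x) = μ) :
    μ = volume.withDensity (fun x => ENNReal.ofReal (density D x)) := by
  set ν : Measure ℝ := volume.withDensity (fun x => ENNReal.ofReal (density D x)) with hν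
  have hU : Ioi (0 : ℝ) = ⋃ n : ℕ, Ioi (1 / ((n : ℝ) + 1)) := by
    ext x
    simp only [mem_Ioi, mem_iUnion]
    exact ⟨exists_nat_one_div_lt, fun ⟨n, hn⟩ => lt_trans (by positivity) hn⟩
  have hpos : μ.restrict (Ioi 0) = ν.restrict (Ioi 0) := by
    rw [hU, Measure.restrict_iUnion_congr]
    refine fun n => Measure.ext_of_Ioc _ _ fun a b _ => ?_
    rw [Measure.restrict_apply measurableSet_Ioc, Measure.restrict_apply measurableSet_Ioc,
      Ioc_inter_Ioi]
    exact h.measure_Ioc (lt_max_of_lt_right (by positivity))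
  have hposS : ∀ S, MeasurableSet S → μ (S ∩ Ioi 0) = ν (S ∩ Ioi 0) := fun S hS => by
    rw [← Measure.restrict_apply hS, ← Measure.restrict_apply hS, hpos]
  have hνs : ν.map (fun x => -x) = ν := by
    ext S hS
    rw [Measure.map_apply measurable_neg hS, hν, withDensity_apply _ hS,
      withDensity_apply _ (measurable_neg hS)]
    have := (Measure.measurePreserving_neg (volume : Measure ℝ)).setLIntegral_comp_preimage hS
      (measurable_density h.differentiableOn_D).ennreal_ofReal
    simpa only [density_neg] using this
  have hneg : ∀ ρ : Measure ℝ, ρ.map (fun x => -x) = ρ → ∀ S, MeasurableSet S →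
      ρ (S ∩ Iio 0) = ρ ((fun x => -x) ⁻¹' S ∩ Ioi 0) := fun ρ hρ S hS => by
    conv_lhs => rw [← hρ]
    rw [Measure.map_apply measurable_neg (hS.inter measurableSet_Iio)]
    congr 1
    ext x
    simp
  have hz : ∀ ρ : Measure ℝ, ρ {0} = 0 → ∀ S, MeasurableSet S →
      ρ S = ρ (S ∩ Ioi 0) + ρ (S ∩ Iio 0) := fun ρ hρ S hS => by
    rw [← measure_union (disjoint_left.2 fun x h1 h2 => lt_asymm (mem_Ioi.1 h1.2) (mem_Iio.1 h2.2))
      (hS.inter measurableSet_Iio), ← inter_union_distrib_left]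
    refine (measure_inter_conull ?_).symm
    refine measure_mono_null (fun x hx => ?_) hρ
    simp only [mem_compl_iff, mem_union, mem_Ioi, mem_Iio, not_or, not_lt] at hx
    exact le_antisymm (by grind) (by grind)
  ext S hS
  rw [hz μ (measure_singleton 0) S hS,
    hz ν (withDensity_absolutelyContinuous _ _ (measure_singleton 0)) S hS, hposS S hS,
    hneg μ hs S hS, hneg ν hνs S hS, hposS _ (measurable_neg hS)]

/-! ### Double zeros of the discriminant -/

theorem hasDerivAt_ofReal {A : ℂ → ℂ} (hA : DifferentiableOn ℂ A rightHalfPlane) {x : ℝ}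
    (hx : 0 < x) : HasDerivAt A (deriv A x) x :=
  (hA.differentiableAt (isOpen_rightHalfPlane.mem_nhds (ofReal_mem_rightHalfPlane hx))).hasDerivAt

theorem tendsto_slope_mul_I {A : ℂ → ℂ} {A' : ℂ} {x : ℝ} (hA : HasDerivAt A A' x) :
    Tendsto (fun ε : ℝ => (A (x + ε * Complex.I) - A x) / (ε * Complex.I)) (𝓝[>] 0) (𝓝 A') := by
  have h1 := hasDerivAt_iff_tendsto_slope.1 hA
  have h2 : Tendsto (fun ε : ℝ => (x : ℂ) + ε * Complex.I) (𝓝[>] 0) (𝓝[≠] x) := by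
    refine tendsto_nhdsWithin_iff.2 ⟨tendsto_add_mul_I x, ?_⟩
    filter_upwards [self_mem_nhdsWithin] with ε hε
    simpa using ne_of_gt hε
  refine (h1.comp h2).congr fun ε => ?_
  rw [Function.comp_apply, slope_def_field, add_sub_cancel_left]

/-- After division by ε the hypothesis bounds the integrals of 1/((x - y)² + ε²), and Fatou's lemma
passes to ε = 0. -/
theorem integrable_one_div_sq [IsFiniteMeasure μ] [NullSingletonClass μ] {x C : ℝ}
    (hC : ∀ᶠ ε : ℝ in 𝓝[>] 0, ∫ y, ε / ((x - y) ^ 2 + ε ^ 2) ∂μ ≤ C * ε) :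
    Integrable (fun y => (1 / (x - y)) ^ 2) μ := by
  have hu : Tendsto (fun n : ℕ => 1 / ((n : ℝ) + 1)) atTop (𝓝[>] 0) :=
    tendsto_nhdsWithin_iff.2 ⟨tendsto_one_div_add_atTop_nhds_zero_nat,
      Eventually.of_forall fun n => by simp only [mem_Ioi]; positivity⟩
  refine integrable_of_tendsto
    (G := fun n y => 1 / ((x - y) ^ 2 + (1 / ((n : ℝ) + 1)) ^ 2)) ?_
    (fun n => Measurable.aestronglyMeasurable (by fun_prop)) ?_
  · filter_upwards [ae_ne_of_noAtoms μ x] with y hy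
    have h1 : (x - y) ^ 2 + (0 : ℝ) ^ 2 ≠ 0 := by
      have : x - y ≠ 0 := sub_ne_zero.2 (Ne.symm hy)
      positivity
    have h2 : ContinuousAt (fun ε : ℝ => 1 / ((x - y) ^ 2 + ε ^ 2)) 0 :=
      ContinuousAt.div (by fun_prop) (by fun_prop) h1
    have h3 := h2.tendsto.comp (hu.mono_right nhdsWithin_le_nhds)
    simpa [Function.comp_def] using h3
  · refine ne_top_of_le_ne_top (b := ENNReal.ofReal C) ENNReal.ofReal_ne_top ?_
    refine liminf_le_of_frequently_le' (Eventually.frequently ?_)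
    filter_upwards [hu.eventually hC] with n hn
    have hε : 0 < 1 / ((n : ℝ) + 1) := by positivity
    set ε := 1 / ((n : ℝ) + 1) with hεdef
    have hnn : ∀ y : ℝ, 0 ≤ 1 / ((x - y) ^ 2 + ε ^ 2) := fun y => by positivity
    have hint : Integrable (fun y => 1 / ((x - y) ^ 2 + ε ^ 2)) μ := by
      refine Integrable.of_bound (Measurable.aestronglyMeasurable (by fun_prop)) (1 / ε ^ 2)
        (ae_of_all _ fun y => ?_)
      rw [Real.norm_of_nonneg (hnn y)]
      exact one_div_le_one_div_of_le (by positivity) (by nlinarith [sq_nonneg (x - y)])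
    simp only [Real.enorm_of_nonneg (hnn _)]
    rw [← ofReal_integral_eq_lintegral_ofReal hint (ae_of_all _ hnn)]
    refine ENNReal.ofReal_le_ofReal ?_
    have h1 : ∫ y, ε / ((x - y) ^ 2 + ε ^ 2) ∂μ = ε * ∫ y, 1 / ((x - y) ^ 2 + ε ^ 2) ∂μ := by
      rw [← integral_const_mul]
      simp only [mul_one_div]
    rw [h1, mul_comm C] at hn
    exact le_of_mul_le_mul_left hn hε

/-- The Stieltjes transform has a vertical derivative at the boundary point x, obtained under the
integral sign. The difference quotient is dominated by (x - y)⁻², because moving off the axis only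
increases the distance to y. -/
theorem tendsto_stieltjes_slope [IsFiniteMeasure μ] [NullSingletonClass μ] {x : ℝ}
    (hint : Integrable (fun y => (1 / (x - y)) ^ 2) μ)
    (hint1 : Integrable (fun y => 1 / (x - y)) μ) :
    Tendsto (fun ε : ℝ => (stieltjes μ (x + ε * Complex.I) - ((∫ y, 1 / (x - y) ∂μ : ℝ) : ℂ)) /
      (ε * Complex.I)) (𝓝[>] 0) (𝓝 (-((∫ y, (1 / (x - y)) ^ 2 ∂μ : ℝ) : ℂ))) := by
  have hlim : Tendsto (fun ε : ℝ => ∫ y : ℝ, -(1 / ((x : ℂ) + ε * Complex.I - y) * (1 / (x - y))) ∂μ)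
      (𝓝[>] 0) (𝓝 (∫ y, -(((1 / (x - y)) ^ 2 : ℝ) : ℂ) ∂μ)) := by
    refine tendsto_integral_filter_of_dominated_convergence (fun y => (1 / (x - y)) ^ 2) ?_ ?_
      hint ?_
    · exact Eventually.of_forall fun ε => Measurable.aestronglyMeasurable (by fun_prop)
    · refine Eventually.of_forall fun ε => ?_
      filter_upwards [ae_ne_of_noAtoms μ x] with y hy
      have hy' : 0 < |x - y| := abs_pos.2 (sub_ne_zero.2 (Ne.symm hy))
      have h1 : |x - y| ≤ ‖(x : ℂ) + ε * Complex.I - y‖ := by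
        simpa using Complex.abs_re_le_norm ((x : ℂ) + ε * Complex.I - y)
      have h2 : ‖(x : ℂ) - y‖ = |x - y| := by
        rw [← Complex.ofReal_sub, Complex.norm_real, Real.norm_eq_abs]
      rw [norm_neg, norm_mul, norm_div, norm_div, norm_one, h2, ← sq_abs, abs_div, abs_one, sq]
      gcongr
    · filter_upwards [ae_ne_of_noAtoms μ x] with y hy
      have h0 : (x : ℂ) - y ≠ 0 := by
        rw [← Complex.ofReal_sub]
        exact Complex.ofReal_ne_zero.2 (sub_ne_zero.2 (Ne.symm hy))
      have h1 := ((((tendsto_add_mul_I x).sub_const (y : ℂ)).inv₀ h0).mul_const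
        (1 / ((x : ℂ) - y))).neg
      convert h1 using 2
      · rw [one_div]
      · push_cast
        ring
  rw [integral_neg, integral_complex_ofReal] at hlim
  refine hlim.congr' ?_
  filter_upwards [self_mem_nhdsWithin] with ε hε
  have hε' : (ε : ℂ) * Complex.I ≠ 0 := by simpa using ne_of_gt hε
  have hzi : ((x : ℂ) + ε * Complex.I).im ≠ 0 := by simpa using ne_of_gt hε
  have hsub : ∫ y : ℝ, (1 / ((x : ℂ) + ε * Complex.I - y) - ((1 / (x - y) : ℝ) : ℂ)) ∂μ =
      ∫ y : ℝ, 1 / ((x : ℂ) + ε * Complex.I - y) ∂μ - ∫ y : ℝ, ((1 / (x - y) : ℝ) : ℂ) ∂μ :=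
    integral_sub (integrable_one_div_sub hzi) hint1.ofReal
  rw [stieltjes, ← integral_complex_ofReal]
  refine Eq.trans ?_ (congrArg (· / ((ε : ℂ) * Complex.I)) hsub)
  rw [← integral_div]
  refine integral_congr_ae ?_
  filter_upwards [ae_ne_of_noAtoms μ x] with y hy
  have h0 : (x : ℂ) - y ≠ 0 := by
    rw [← Complex.ofReal_sub]
    exact Complex.ofReal_ne_zero.2 (sub_ne_zero.2 (Ne.symm hy))
  have h1 : (x : ℂ) + ε * Complex.I - y ≠ 0 := fun hc => by
    have := congrArg Complex.im hc
    simp at this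
    exact ne_of_gt hε this
  push_cast
  rw [div_sub_div _ _ h1 h0, div_div, eq_div_iff (mul_ne_zero (mul_ne_zero h1 h0) hε')]
  field_simp
  ring

/-- By symmetry the second moment dominates the transform. -/
theorem integral_sq_add_pos [IsProbabilityMeasure μ] [NullSingletonClass μ]
    (hs : μ.map (fun x => -x) = μ) {x : ℝ} (hx : 0 < x)
    (hint : Integrable (fun y => (1 / (x - y)) ^ 2) μ)
    (hint1 : Integrable (fun y => 1 / (x - y)) μ) :
    0 < ∫ y, (1 / (x - y)) ^ 2 ∂μ + (∫ y, 1 / (x - y) ∂μ) / x := by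
  have hn := integrable_comp_neg_of_map_neg hs hint
  have hn1 := integrable_comp_neg_of_map_neg hs hint1
  have e := integral_comp_neg_of_map_neg hs fun y => (1 / (x - y)) ^ 2
  have e1 := integral_comp_neg_of_map_neg hs fun y => 1 / (x - y)
  -- With p = 1/(x - y) and q = 1/(x + y) one has p + q = 2x pq, so p² + q² + (p + q)/x is the
  -- perfect square (p + q)², which does not vanish.
  have hae : ∀ᵐ y ∂μ, ((1 / (x - y)) ^ 2 + (1 / (x - -y)) ^ 2) +
      (1 / (x - y) + 1 / (x - -y)) / x = (1 / (x - y) + 1 / (x - -y)) ^ 2 ∧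
      1 / (x - y) + 1 / (x - -y) ≠ 0 := by
    filter_upwards [ae_ne_of_noAtoms μ x, ae_ne_of_noAtoms μ (-x)] with y h1 h2
    have h3 : x - y ≠ 0 := sub_ne_zero.2 (Ne.symm h1)
    have h4 : x - -y ≠ 0 := fun h => h2 (by linarith)
    have h5 : (1 / (x - y) + 1 / (x - -y)) = 2 * x * ((1 / (x - y)) * (1 / (x - -y))) := by
      field_simp
      ring
    refine ⟨?_, ?_⟩
    · conv_lhs => rw [h5]
      field_simp
      ring
    · rw [h5]
      positivity
  have hI : Integrable (fun y => (1 / (x - y) + 1 / (x - -y)) ^ 2) μ :=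
    ((hint.add hn).add ((hint1.add hn1).div_const x)).congr
      (hae.mono fun y hy => hy.1)
  have hpos : 0 < ∫ y, (1 / (x - y) + 1 / (x - -y)) ^ 2 ∂μ := by
    rw [integral_pos_iff_support_of_nonneg (fun y => sq_nonneg _) hI]
    have : μ (Function.support fun y => (1 / (x - y) + 1 / (x - -y)) ^ 2) = 1 := by
      rw [prob_compl_eq_zero_iff₀ ?_ |>.1]
      · exact (hae.mono fun y hy => pow_ne_zero 2 hy.2)
      · exact (measurableSet_support (by fun_prop)).nullMeasurableSet
    rw [this]
    exact one_pos
  have : ∫ y, (1 / (x - y) + 1 / (x - -y)) ^ 2 ∂μ =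
      2 * (∫ y, (1 / (x - y)) ^ 2 ∂μ + (∫ y, 1 / (x - y) ∂μ) / x) := by
    have i1 := integral_add (hint.add hn) ((hint1.add hn1).div_const x)
    have i2 := integral_add hint hn
    have i3 := integral_add hint1 hn1
    simp only [Pi.add_apply] at i1 i2 i3
    rw [← integral_congr_ae (hae.mono fun y hy => hy.1), i1, i2, integral_div, i3, e, e1]
    ring
  linarith

/-- At a double zero of the discriminant on the positive axis the discriminant is positive
nearby. -/
theorem eventually_pos_of_double_zero [IsProbabilityMeasure μ] [NullSingletonClass μ]
    (h : HasQuadraticEquation μ A D) (hs : μ.map (fun x => -x) = μ)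
    (hmono : MonotoneOn (fun x : ℝ => (A x).re / x) (Ioi 0)) {x : ℝ} (hx : 0 < x)
    (hD0 : D x = 0) (hD1 : deriv D x = 0) : ∀ᶠ y : ℝ in 𝓝[≠] x, 0 < (D y).re := by
  have hxm := isOpen_rightHalfPlane.mem_nhds (ofReal_mem_rightHalfPlane hx)
  set E : ℂ → ℂ := dslope (dslope D x) x with hE
  have hEd : DifferentiableOn ℂ E rightHalfPlane :=
    (Complex.differentiableOn_dslope hxm).2
      ((Complex.differentiableOn_dslope hxm).2 h.differentiableOn_D)
  have hDE : ∀ z, D z = (z - x) ^ 2 * E z := by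
    intro z
    have h1 := sub_smul_dslope D x z
    have h2 := sub_smul_dslope (dslope D x) x z
    rw [dslope_same, hD1, sub_zero, smul_eq_mul] at h2
    rw [hD0, sub_zero, ← h2, smul_eq_mul] at h1
    rw [← h1, hE]
    ring
  have hEc := continuousAt_of_rightHalfPlane hEd (ofReal_mem_rightHalfPlane hx)
  have hElim := hEc.tendsto.comp (tendsto_add_mul_I x)
  have hAd := hasDerivAt_ofReal h.differentiableOn_A hx
  have hAs := tendsto_slope_mul_I hAd
  have hAxre : (((A x).re : ℝ) : ℂ) = A x :=
    Complex.ext (by simp) (by simpa using (h.im_A x hx).symm)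
  set w : ℝ → ℂ := fun ε => stieltjes μ (x + ε * Complex.I) - A (x + ε * Complex.I) with hw
  have hwsq : ∀ ε : ℝ, 0 < ε → w ε ^ 2 = (ε * Complex.I) ^ 2 * E (x + ε * Complex.I) := by
    intro ε hε
    rw [hw, h.eq _ (add_mul_I_mem_rightHalfPlane hx ε) (by simpa using hε.ne'), hDE,
      add_sub_cancel_left]
  -- The double zero gives G - A = O(ε) along the vertical line. As Im A is O(ε) too, the Poisson
  -- integral is O(ε) and the second moment is finite.
  obtain ⟨C₁, hC₁⟩ : ∃ C, ∀ᶠ ε : ℝ in 𝓝[>] 0, ‖w ε‖ ≤ C * ε := by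
    refine ⟨√(‖E x‖ + 1), ?_⟩
    filter_upwards [self_mem_nhdsWithin, hElim.norm.eventually_lt_const (lt_add_one ‖E x‖)]
      with ε hε hε1
    have h1 : ‖w ε‖ ^ 2 ≤ (‖E x‖ + 1) * ε ^ 2 := by
      rw [← norm_pow, hwsq ε hε, norm_mul, norm_pow, norm_mul, Complex.norm_I, mul_one,
        Complex.norm_real, Real.norm_eq_abs, sq_abs, mul_comm]
      exact mul_le_mul_of_nonneg_right hε1.le (sq_nonneg ε)
    refine (Real.le_sqrt_of_sq_le h1).trans_eq ?_
    rw [Real.sqrt_mul (by positivity), Real.sqrt_sq (le_of_lt hε)]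
  obtain ⟨C₂, hC₂⟩ : ∃ C, ∀ᶠ ε : ℝ in 𝓝[>] 0, |(A (x + ε * Complex.I)).im| ≤ C * ε := by
    refine ⟨‖deriv A x‖ + 1, ?_⟩
    filter_upwards [self_mem_nhdsWithin, hAs.norm.eventually_lt_const (lt_add_one _)]
      with ε hε hε1
    have h1 : (A (x + ε * Complex.I)).im = (A (x + ε * Complex.I) - A x).im := by
      rw [Complex.sub_im, h.im_A x hx, sub_zero]
    rw [h1]
    refine (Complex.abs_im_le_norm _).trans ?_
    rw [norm_div, norm_mul, Complex.norm_I, mul_one, Complex.norm_real, Real.norm_eq_abs,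
      abs_of_pos hε, div_lt_iff₀ hε] at hε1
    exact hε1.le
  have hint : Integrable (fun y => (1 / (x - y)) ^ 2) μ := by
    refine integrable_one_div_sq (C := C₁ + C₂) ?_
    filter_upwards [self_mem_nhdsWithin, hC₁, hC₂] with ε hε h1 h2
    have h3 := im_stieltjes μ x hε
    have h4 : (stieltjes μ (x + ε * Complex.I)).im = (w ε).im + (A (x + ε * Complex.I)).im := by
      simp only [hw, Complex.sub_im]
      ring
    have h5 := (Complex.abs_im_le_norm (w ε)).trans h1
    linarith [neg_abs_le (w ε).im, neg_abs_le (A (x + ε * Complex.I)).im]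
  have hint1 : Integrable (fun y => 1 / (x - y)) μ := by
    refine Integrable.mono' ((integrable_const 1).add hint)
      (Measurable.aestronglyMeasurable (by fun_prop)) (ae_of_all _ fun y => ?_)
    rw [Pi.add_apply, Real.norm_eq_abs, ← sq_abs]
    nlinarith [sq_nonneg (|1 / (x - y)| - 1)]
  have hGs := tendsto_stieltjes_slope hint hint1
  set G₀ : ℝ := ∫ y, 1 / (x - y) ∂μ with hG₀
  set S : ℝ := ∫ y, (1 / (x - y)) ^ 2 ∂μ with hS
  have hne : ∀ᶠ ε : ℝ in 𝓝[>] 0, (ε : ℂ) * Complex.I ≠ 0 := by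
    filter_upwards [self_mem_nhdsWithin] with ε hε
    simpa using ne_of_gt hε
  have hε0 : Tendsto (fun ε : ℝ => (ε : ℂ) * Complex.I) (𝓝[>] 0) (𝓝 0) := by
    simpa using (tendsto_add_mul_I 0)
  have hGA : (G₀ : ℂ) = A x := by
    have h1 : Tendsto (fun ε : ℝ => stieltjes μ (x + ε * Complex.I)) (𝓝[>] 0) (𝓝 G₀) := by
      have h2 := (hGs.mul hε0).add_const (G₀ : ℂ)
      rw [mul_zero, zero_add] at h2
      refine h2.congr' ?_
      filter_upwards [hne] with ε hε
      rw [div_mul_cancel₀ _ hε, sub_add_cancel]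
    have h2 : Tendsto w (𝓝[>] 0) (𝓝 0) := by
      have h3 : Tendsto (fun ε : ℝ => C₁ * ε) (𝓝[>] 0) (𝓝 0) := by
        have : Continuous fun ε : ℝ => C₁ * ε := by fun_prop
        simpa using (this.tendsto 0).mono_left nhdsWithin_le_nhds
      exact squeeze_zero_norm' hC₁ h3
    have h3 := (continuousAt_of_rightHalfPlane h.differentiableOn_A
      (ofReal_mem_rightHalfPlane hx)).tendsto.comp (tendsto_add_mul_I x)
    exact sub_eq_zero.1 (tendsto_nhds_unique (h1.sub h3) h2)
  -- E is the limit of ((G - A)/(iε))², and G and A have the vertical slopes -S and A'(x).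
  have hEx : E x = (-(S : ℂ) - deriv A x) ^ 2 := by
    refine tendsto_nhds_unique hElim (((hGs.sub hAs).pow 2).congr' ?_)
    filter_upwards [self_mem_nhdsWithin, hne] with ε hε hεne
    rw [Function.comp_apply, ← sub_div, div_pow, hGA, sub_sub_sub_cancel_right, hwsq ε hε,
      mul_div_cancel_left₀ _ (pow_ne_zero 2 hεne)]
  have hAim : (deriv A x).im = 0 := by
    have h1 := (hasDerivAt_const x (0 : ℝ)).congr_of_eventuallyEq
      (show (fun y : ℝ => (A y).im) =ᶠ[𝓝 x] fun _ => 0 from by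
        filter_upwards [Ioi_mem_nhds hx] with y hy using h.im_A y hy)
    have h2 := (Complex.imCLM.hasFDerivAt.comp_hasDerivAt x hAd.comp_ofReal)
    exact h2.unique h1
  -- This is the sign of the derivative of the monotone function A(x)/x. It is where convexity in x²
  -- enters.
  have hAre : (A x).re / x ≤ (deriv A x).re := by
    have h1 : HasDerivAt (fun y : ℝ => (A y).re / y)
        (((deriv A x).re * x - (A x).re * 1) / x ^ 2) x :=
      hAd.real_of_complex.div (hasDerivAt_id x) hx.ne'
    have h2 : 0 ≤ derivWithin (fun y : ℝ => (A y).re / y) (Ioi 0) x := hmono.derivWithin_nonneg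
    rw [derivWithin_of_isOpen isOpen_Ioi hx, h1.deriv] at h2
    rw [div_le_iff₀ hx]
    have h3 : 0 ≤ ((deriv A x).re * x - (A x).re * 1) / x ^ 2 * x ^ 2 := by positivity
    rw [div_mul_cancel₀ _ (by positivity)] at h3
    linarith
  have hpos : 0 < S + (deriv A x).re := by
    have h1 := integral_sq_add_pos hs hx hint hint1
    have h2 : G₀ = (A x).re := by rw [← hGA, Complex.ofReal_re]
    rw [← hG₀, ← hS, h2] at h1
    linarith
  have hExre : 0 < (E x).re := by
    have h1 : -(S : ℂ) - deriv A x = ((-(S + (deriv A x).re) : ℝ) : ℂ) :=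
      Complex.ext (by simp; ring) (by simp [hAim])
    rw [hEx, h1, ← Complex.ofReal_pow, Complex.ofReal_re, neg_sq]
    exact pow_pos hpos 2
  have hev : ∀ᶠ y : ℝ in 𝓝 x, 0 < (E y).re := by
    have h1 : ContinuousAt (fun y : ℝ => (E y).re) x :=
      Complex.continuous_re.continuousAt.comp
        (ContinuousAt.comp (f := fun y : ℝ => (y : ℂ)) hEc Complex.continuous_ofReal.continuousAt)
    exact h1.eventually_const_lt hExre
  filter_upwards [hev.filter_mono nhdsWithin_le_nhds, self_mem_nhdsWithin] with y hy hyx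
  rw [hDE, ← Complex.ofReal_sub, ← Complex.ofReal_pow, Complex.re_ofReal_mul]
  have : y - x ≠ 0 := sub_ne_zero.2 hyx
  positivity

end HasQuadraticEquation
end ExternalSource


namespace ExternalSource

open Filter Topology

/-! ### The sign of the discriminant and the square root behavior of the density -/

namespace HasQuadraticEquation

variable {μ : Measure ℝ} {A D : ℂ → ℂ}

theorem continuousAt_re (h : HasQuadraticEquation μ A D) {x : ℝ} (hx : 0 < x) :
    ContinuousAt (fun y : ℝ => (D y).re) x :=
  Complex.continuous_re.continuousAt.comp
    ((continuousOn_comp_ofReal h.differentiableOn_D).continuousAt (Ioi_mem_nhds hx))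

theorem im_deriv (h : HasQuadraticEquation μ A D) {x : ℝ} (hx : 0 < x) : (deriv D x).im = 0 := by
  have h1 := (hasDerivAt_const x (0 : ℝ)).congr_of_eventuallyEq
    (show (fun y : ℝ => (D y).im) =ᶠ[𝓝 x] fun _ => 0 from by
      filter_upwards [Ioi_mem_nhds hx] with y hy using h.im_D y hy)
  exact (Complex.imCLM.hasFDerivAt.comp_hasDerivAt x
    (hasDerivAt_ofReal h.differentiableOn_D hx).comp_ofReal).unique h1

variable [IsProbabilityMeasure μ] [NullSingletonClass μ]

theorem measure_eq_zero_iff (h : HasQuadraticEquation μ A D) (hs : μ.map (fun x => -x) = μ)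
    (U : Set ℝ) : μ U = 0 ↔ volume ({x | density D x ≠ 0} ∩ U) = 0 := by
  conv_lhs => rw [h.eq_withDensity hs]
  rw [withDensity_apply_eq_zero (measurable_density h.differentiableOn_D).ennreal_ofReal]
  have : ∀ x, ENNReal.ofReal (density D x) ≠ 0 ↔ density D x ≠ 0 := fun x => by
    rw [Ne, ENNReal.ofReal_eq_zero, not_le]
    exact ⟨ne_of_gt, fun hx => lt_of_le_of_ne (density_nonneg D x) (Ne.symm hx)⟩
  simp only [this]

theorem density_ne_zero_iff {x : ℝ} (hx : 0 < x) : density D x ≠ 0 ↔ (D x).re < 0 := by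
  rw [density, abs_of_pos hx, div_ne_zero_iff, Real.sqrt_ne_zero (le_max_right _ _)]
  simp [Real.pi_ne_zero]

theorem re_nonneg_of_notMem_support (h : HasQuadraticEquation μ A D)
    (hs : μ.map (fun x => -x) = μ) {x : ℝ} (hx : 0 < x) (hxs : x ∉ μ.support) :
    0 ≤ (D x).re := by
  by_contra! hneg
  obtain ⟨U, hU, hμ⟩ := Measure.notMem_support_iff_exists.1 hxs
  obtain ⟨W, hWU, hWo, hxW⟩ := mem_nhds_iff.1 (inter_mem hU (inter_mem (Ioi_mem_nhds hx)
    ((h.continuousAt_re hx).eventually_lt_const hneg)))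
  have h1 := (h.measure_eq_zero_iff hs W).1 (measure_mono_null (fun y hy => (hWU hy).1) hμ)
  have h2 : W ⊆ {x | density D x ≠ 0} := fun y hy =>
    (density_ne_zero_iff (hWU hy).2.1).2 (hWU hy).2.2
  rw [inter_eq_right.2 h2] at h1
  exact (hWo.measure_pos volume ⟨x, hxW⟩).ne' h1

/-- Otherwise the density would vanish on a punctured neighborhood, and that neighborhood would be
null. -/
theorem not_eventually_re_nonneg (h : HasQuadraticEquation μ A D)
    (hs : μ.map (fun x => -x) = μ) {x : ℝ} (hx : 0 < x) (hxs : x ∈ μ.support) :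
    ¬ ∀ᶠ y : ℝ in 𝓝[≠] x, 0 ≤ (D y).re := by
  intro hev
  have hU := inter_mem (Ioi_mem_nhds hx) (eventually_nhdsWithin_iff.1 hev)
  refine ((Measure.mem_support_iff_forall x).1 hxs _ hU).ne' ((h.measure_eq_zero_iff hs _).2 ?_)
  refine measure_mono_null (fun y hy => ?_) (measure_singleton x)
  by_contra hyx
  exact ((density_ne_zero_iff hy.2.1).1 hy.1).not_ge (hy.2.2 hyx)

theorem re_nonpos_of_mem_support (h : HasQuadraticEquation μ A D)
    (hs : μ.map (fun x => -x) = μ) {x : ℝ} (hx : 0 < x) (hxs : x ∈ μ.support) :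
    (D x).re ≤ 0 := by
  by_contra! hpos
  exact h.not_eventually_re_nonneg hs hx hxs
    (((h.continuousAt_re hx).eventually_const_lt hpos).filter_mono nhdsWithin_le_nhds
      |>.mono fun _ => le_of_lt)

/-- A double zero would make D positive on a punctured neighborhood, which the support excludes. -/
theorem deriv_ne_zero (h : HasQuadraticEquation μ A D) (hs : μ.map (fun x => -x) = μ)
    (hmono : MonotoneOn (fun x : ℝ => (A x).re / x) (Ioi 0)) {x : ℝ} (hx : 0 < x)
    (hxs : x ∈ μ.support) (hD0 : D x = 0) : (deriv D x).re ≠ 0 := fun hre =>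
  h.not_eventually_re_nonneg hs hx hxs
    ((h.eventually_pos_of_double_zero hs hmono hx hD0 (Complex.ext hre (h.im_deriv hx))).mono
      fun _ => le_of_lt)

/-- D ≤ 0 around an interior point, so a zero there would be a local maximum, hence a double zero.
-/
theorem re_neg_of_mem_interior (h : HasQuadraticEquation μ A D) (hs : μ.map (fun x => -x) = μ)
    (hmono : MonotoneOn (fun x : ℝ => (A x).re / x) (Ioi 0)) {x : ℝ} (hx : 0 < x)
    (hxs : μ.support ∈ 𝓝 x) : (D x).re < 0 := by
  refine lt_of_le_of_ne (h.re_nonpos_of_mem_support hs hx (mem_of_mem_nhds hxs)) fun h0 => ?_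
  refine h.deriv_ne_zero hs hmono hx (mem_of_mem_nhds hxs) (Complex.ext h0 (h.im_D x hx)) ?_
  refine IsLocalMax.hasDerivAt_eq_zero ?_
    (hasDerivAt_ofReal h.differentiableOn_D hx).real_of_complex
  filter_upwards [hxs, Ioi_mem_nhds hx] with y hy hy0
  rw [h0]
  exact h.re_nonpos_of_mem_support hs hy0 hy

/-- D ≤ 0 on the support and D ≥ 0 off it, so continuity forces a zero at a positive boundary point.
-/
theorem eq_zero_of_frequently (h : HasQuadraticEquation μ A D) (hs : μ.map (fun x => -x) = μ)
    {x : ℝ} (hx : 0 < x) (hxs : x ∈ μ.support) (hfr : ∃ᶠ y in 𝓝 x, y ∉ μ.support) : D x = 0 := by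
  refine Complex.ext (le_antisymm (h.re_nonpos_of_mem_support hs hx hxs) ?_) (h.im_D x hx)
  by_contra! hneg
  refine hfr ?_
  filter_upwards [(h.continuousAt_re hx).eventually_lt_const hneg, Ioi_mem_nhds hx] with y hy hy0
  exact fun hyn => (h.re_nonneg_of_notMem_support hs hy0 hyn).not_gt hy

theorem deriv_eq_of_eq_sub_mul {F : ℂ → ℂ} {x : ℂ} (hF : ContinuousAt F x)
    (he : ∀ z, D z = (z - x) * F z) : deriv D x = F x := by
  refine HasDerivAt.deriv (hasDerivAt_iff_tendsto_slope.2 ?_)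
  refine (hF.tendsto.mono_left nhdsWithin_le_nhds).congr' ?_
  filter_upwards [self_mem_nhdsWithin] with z hz
  rw [slope_def_field, he, he, sub_self, zero_mul, sub_zero,
    mul_div_cancel_left₀ _ (sub_ne_zero.2 hz)]

theorem analyticOnNhd_re {F : ℂ → ℂ} (hF : DifferentiableOn ℂ F rightHalfPlane) :
    AnalyticOnNhd ℝ (fun x : ℝ => (F x).re) (Ioi 0) := fun _ hx =>
  (hF.analyticAt (isOpen_rightHalfPlane.mem_nhds (ofReal_mem_rightHalfPlane hx))).re_ofReal

/-- Dividing out the zero at β leaves a factor that is positive inside by the sign of D and nonzero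
at β because the zero is simple. The division by β + x turns β - x into β² - x², which suits the
reflection. -/
theorem exists_factor_one (h : HasQuadraticEquation μ A D) (hs : μ.map (fun x => -x) = μ)
    (hmono : MonotoneOn (fun x : ℝ => (A x).re / x) (Ioi 0)) {β : ℝ} (hβ : 0 < β)
    (hsupp : ∀ x, x ∈ μ.support ↔ 0 ≤ |x| ∧ |x| ≤ β) :
    ∃ k : ℝ → ℝ, AnalyticOnNhd ℝ k (Ioi 0) ∧
      (∀ x : ℝ, 0 < x → -(D x).re = (β ^ 2 - x ^ 2) * k x) ∧ ∀ x, 0 < x → x ∈ μ.support → 0 < k x := by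
  have hβs : β ∈ μ.support := (hsupp β).2 ⟨abs_nonneg _, (abs_of_pos hβ).le⟩
  have hD0 : D β = 0 := by
    refine h.eq_zero_of_frequently hs hβ hβs ?_
    have : ∀ᶠ y in 𝓝[>] β, y ∉ μ.support := eventually_nhdsWithin_of_forall fun y hy hc =>
      ((le_abs_self y).trans ((hsupp y).1 hc).2).not_gt hy
    exact this.frequently.filter_mono nhdsWithin_le_nhds
  have hβm := isOpen_rightHalfPlane.mem_nhds (ofReal_mem_rightHalfPlane hβ)
  set E : ℂ → ℂ := dslope D β with hE
  have hEd : DifferentiableOn ℂ E rightHalfPlane :=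
    (Complex.differentiableOn_dslope hβm).2 h.differentiableOn_D
  have hDE : ∀ z, D z = (z - β) * E z := fun z => by
    rw [← smul_eq_mul, hE, sub_smul_dslope, hD0, sub_zero]
  have hre : ∀ x : ℝ, (D x).re = (x - β) * (E x).re := fun x => by
    rw [hDE, ← Complex.ofReal_sub, Complex.re_ofReal_mul]
  have hEβ : (E β).re ≠ 0 := by
    have := h.deriv_ne_zero hs hmono hβ hβs hD0
    rwa [deriv_eq_of_eq_sub_mul (continuousAt_of_rightHalfPlane hEd
      (ofReal_mem_rightHalfPlane hβ)) hDE] at this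
  have hEpos : ∀ x : ℝ, 0 < x → x < β → 0 < (E x).re := by
    intro x hx hxβ
    have h1 := h.re_neg_of_mem_interior hs hmono hx (by
      filter_upwards [Ioo_mem_nhds hx hxβ] with y hy
      exact (hsupp y).2 ⟨abs_nonneg _, by rw [abs_of_pos hy.1]; exact hy.2.le⟩)
    rw [hre] at h1
    nlinarith
  refine ⟨fun x => (E x).re / (β + x), ?_, fun x hx => ?_, fun x hx hxs => ?_⟩
  · exact (analyticOnNhd_re hEd).div (analyticOnNhd_const.add analyticOnNhd_id)
      fun x hx => (add_pos hβ hx).ne'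
  · have : β + x ≠ 0 := by positivity
    rw [hre]
    field_simp
    ring
  · refine div_pos ?_ (by positivity)
    have hxβ := ((hsupp x).1 hxs).2
    rw [abs_of_pos hx] at hxβ
    rcases hxβ.lt_or_eq with h1 | rfl
    · exact hEpos x hx h1
    -- At the endpoint the factor is nonnegative as a limit from inside and nonzero by simplicity.
    · refine lt_of_le_of_ne ?_ hEβ.symm
      have h2 := ((analyticOnNhd_re hEd) x hx).continuousAt
      refine ge_of_tendsto (h2.tendsto.mono_left (nhdsWithin_le_nhds (s := Iio x))) ?_
      filter_upwards [self_mem_nhdsWithin, nhdsWithin_le_nhds (Ioi_mem_nhds hx)] with y hy hy0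
      exact (hEpos y hy0 hy).le

theorem exists_factor_two (h : HasQuadraticEquation μ A D) (hs : μ.map (fun x => -x) = μ)
    (hmono : MonotoneOn (fun x : ℝ => (A x).re / x) (Ioi 0)) {α β : ℝ} (hα : 0 < α) (hαβ : α < β)
    (hsupp : ∀ x, x ∈ μ.support ↔ α ≤ |x| ∧ |x| ≤ β) :
    ∃ k : ℝ → ℝ, AnalyticOnNhd ℝ k (Ioi 0) ∧
      (∀ x : ℝ, 0 < x → -(D x).re = (β ^ 2 - x ^ 2) * (x ^ 2 - α ^ 2) * k x) ∧
      ∀ x, 0 < x → x ∈ μ.support → 0 < k x := by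
  have hβ : 0 < β := hα.trans hαβ
  have hβs : β ∈ μ.support := (hsupp β).2 (by simp [abs_of_pos hβ, hαβ.le])
  have hαs : α ∈ μ.support := (hsupp α).2 (by simp [abs_of_pos hα, hαβ.le])
  have hDβ : D β = 0 := by
    refine h.eq_zero_of_frequently hs hβ hβs ?_
    have : ∀ᶠ y in 𝓝[>] β, y ∉ μ.support := eventually_nhdsWithin_of_forall fun y hy hc =>
      ((le_abs_self y).trans ((hsupp y).1 hc).2).not_gt hy
    exact this.frequently.filter_mono nhdsWithin_le_nhds
  have hDα : D α = 0 := by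
    refine h.eq_zero_of_frequently hs hα hαs ?_
    have : ∀ᶠ y in 𝓝[<] α, y ∉ μ.support := by
      filter_upwards [self_mem_nhdsWithin, nhdsWithin_le_nhds (Ioi_mem_nhds hα)] with y hy hy0 hc
      have := ((hsupp y).1 hc).1
      rw [abs_of_pos hy0] at this
      exact this.not_gt hy
    exact this.frequently.filter_mono nhdsWithin_le_nhds
  have hβm := isOpen_rightHalfPlane.mem_nhds (ofReal_mem_rightHalfPlane hβ)
  have hαm := isOpen_rightHalfPlane.mem_nhds (ofReal_mem_rightHalfPlane hα)
  set E : ℂ → ℂ := dslope (dslope D β) α with hE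
  have hEd : DifferentiableOn ℂ E rightHalfPlane :=
    (Complex.differentiableOn_dslope hαm).2
      ((Complex.differentiableOn_dslope hβm).2 h.differentiableOn_D)
  have hDE : ∀ z, D z = (z - β) * ((z - α) * E z) := fun z => by
    have h1 : dslope D β α = 0 := by
      rw [dslope_of_ne _ (by exact_mod_cast hαβ.ne), slope_def_field, hDα, hDβ, sub_self, zero_div]
    rw [← smul_eq_mul (z - (α : ℂ)), hE, sub_smul_dslope, h1, sub_zero, ← smul_eq_mul,
      sub_smul_dslope, hDβ, sub_zero]
  have hre : ∀ x : ℝ, (D x).re = (x - β) * ((x - α) * (E x).re) := fun x => by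
    rw [hDE, ← Complex.ofReal_sub, Complex.re_ofReal_mul, ← Complex.ofReal_sub,
      Complex.re_ofReal_mul]
  have hcont : ∀ (c x : ℝ), 0 < x → ContinuousAt (fun z => (z - (c : ℂ)) * E z) x :=
    fun c x hx => ContinuousAt.mul (by fun_prop) (continuousAt_of_rightHalfPlane hEd
      (ofReal_mem_rightHalfPlane hx))
  have hEβ : (E β).re ≠ 0 := by
    have := h.deriv_ne_zero hs hmono hβ hβs hDβ
    rw [deriv_eq_of_eq_sub_mul (hcont α β hβ) hDE, ← Complex.ofReal_sub,
      Complex.re_ofReal_mul] at this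
    exact right_ne_zero_of_mul this
  have hEα : (E α).re ≠ 0 := by
    have := h.deriv_ne_zero hs hmono hα hαs hDα
    rw [deriv_eq_of_eq_sub_mul (hcont β α hα) fun z => (hDE z).trans (mul_left_comm _ _ _),
      ← Complex.ofReal_sub, Complex.re_ofReal_mul] at this
    exact right_ne_zero_of_mul this
  have hEpos : ∀ x : ℝ, α < x → x < β → 0 < (E x).re := by
    intro x hαx hxβ
    have h1 := h.re_neg_of_mem_interior hs hmono (hα.trans hαx) (by
      filter_upwards [Ioo_mem_nhds hαx hxβ] with y hy
      refine (hsupp y).2 ?_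
      rw [abs_of_pos (hα.trans hy.1)]
      exact ⟨hy.1.le, hy.2.le⟩)
    rw [hre] at h1
    have h2 : 0 < (x - α) * (E x).re := by nlinarith
    exact pos_of_mul_pos_right h2 (by linarith)
  refine ⟨fun x => (E x).re / ((β + x) * (x + α)), ?_, fun x hx => ?_, fun x hx hxs => ?_⟩
  · refine (analyticOnNhd_re hEd).div ((analyticOnNhd_const.add analyticOnNhd_id).mul
      (analyticOnNhd_id.add analyticOnNhd_const)) fun x hx => ?_
    exact (mul_pos (add_pos hβ hx) (add_pos hx hα)).ne'
  · have h1 : β + x ≠ 0 := by positivity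
    have h2 : x + α ≠ 0 := by positivity
    rw [hre]
    field_simp
    ring
  · refine div_pos ?_ (by positivity)
    obtain ⟨hαx, hxβ⟩ := (hsupp x).1 hxs
    rw [abs_of_pos hx] at hxβ hαx
    have h2 := ((analyticOnNhd_re hEd) x hx).continuousAt
    rcases hαx.lt_or_eq with h3 | rfl
    · rcases hxβ.lt_or_eq with h1 | rfl
      · exact hEpos x h3 h1
      · refine lt_of_le_of_ne ?_ hEβ.symm
        refine ge_of_tendsto (h2.tendsto.mono_left (nhdsWithin_le_nhds (s := Iio x))) ?_
        filter_upwards [self_mem_nhdsWithin, nhdsWithin_le_nhds (Ioi_mem_nhds h3)] with y hy hy0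
        exact (hEpos y hy0 hy).le
    · refine lt_of_le_of_ne ?_ hEα.symm
      refine ge_of_tendsto (h2.tendsto.mono_left (nhdsWithin_le_nhds (s := Ioi α))) ?_
      filter_upwards [self_mem_nhdsWithin, nhdsWithin_le_nhds (Iio_mem_nhds hαβ)] with y hy hy0
      exact (hEpos y hy hy0).le

/-- Away from the origin |y| is locally ±y, and the square root of a positive analytic function is
the exponential of half its logarithm. -/
theorem analyticAt_sqrt_comp_abs {k : ℝ → ℝ} (hk : AnalyticOnNhd ℝ k (Ioi 0)) {x : ℝ}
    (hx : x ≠ 0) (hpos : 0 < k |x|) : AnalyticAt ℝ (fun y => √(k |y|)) x := by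
  have habs : AnalyticAt ℝ (fun y : ℝ => |y|) x := by
    rcases lt_or_gt_of_ne hx with h1 | h1
    · refine analyticAt_id.neg.congr ?_
      filter_upwards [Iio_mem_nhds h1] with y hy
      simp [abs_of_neg (mem_Iio.1 hy)]
    · refine analyticAt_id.congr ?_
      filter_upwards [Ioi_mem_nhds h1] with y hy
      simp [abs_of_pos (mem_Ioi.1 hy)]
  have hkx : AnalyticAt ℝ (fun y => k |y|) x :=
    AnalyticAt.comp (g := k) (hk _ (abs_pos.2 hx)) habs
  have hlog : AnalyticAt ℝ (fun y => Real.exp (Real.log (k |y|) / 2)) x :=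
    ((hkx.log hpos).div_const).rexp
  refine hlog.congr ?_
  filter_upwards [hkx.continuousAt.eventually_const_lt hpos] with y hy
  rw [Real.exp_half, Real.exp_log hy]

theorem hasSqrtDensity_of_factor (h : HasQuadraticEquation μ A D)
    (hs : μ.map (fun x => -x) = μ) {k : ℝ → ℝ} (hk : AnalyticOnNhd ℝ k (Ioi 0))
    (hpos : ∀ x, 0 < x → x ∈ μ.support → 0 < k x) {N : ℕ} {a b : Fin N → ℝ}
    (hab : ∀ j, a j < b j) (hord : ∀ i j, i < j → b i < a j)
    (hsupp : μ.support = ⋃ j, Icc (a j) (b j))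
    (hfac : ∀ x ∈ μ.support, x ≠ 0 →
      -(D ((|x| : ℝ) : ℂ)).re = |∏ j, (b j - x) * (x - a j)| * k |x|) :
    HasSqrtDensity μ N a b (fun x => √(k |x|) / Real.pi) ∧
      ∀ x ∈ μ.support, x ≠ 0 → 0 < √(k |x|) / Real.pi := by
  have hpos' : ∀ x ∈ μ.support, x ≠ 0 → 0 < k |x| := fun x hx hx0 =>
    hpos _ (abs_pos.2 hx0) ((abs_mem_support_iff hs).2 hx)
  refine ⟨⟨hab, hord, hsupp, fun x _ => by positivity, fun x hx => ?_, ?_⟩, fun x hx hx0 => ?_⟩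
  · exact (analyticAt_sqrt_comp_abs hk hx.2 (hpos' x hx.1 hx.2)).div_const
  · have hmeas : MeasurableSet μ.support := Measure.isClosed_support.measurableSet
    have h1 : μ = μ.restrict μ.support :=
      (Measure.restrict_eq_self_of_ae_mem
        (mem_ae_iff.2 Measure.measure_compl_support)).symm
    have h2 : μ.restrict μ.support = (volume.restrict μ.support).withDensity
        (fun x => ENNReal.ofReal (density D x)) := by
      rw [← restrict_withDensity hmeas, ← h.eq_withDensity hs]
    refine h1.trans (h2.trans (withDensity_congr_ae ?_))
    filter_upwards [ae_restrict_mem hmeas, ae_ne_of_noAtoms (volume.restrict μ.support) 0]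
      with x hx hx0
    congr 1
    rw [density, hfac x hx hx0,
      max_eq_left (mul_nonneg (abs_nonneg _) (hpos' x hx hx0).le), Real.sqrt_mul (abs_nonneg _)]
    ring
  · have := hpos' x hx hx0
    positivity

theorem exists_hasSqrtDensity (h : HasQuadraticEquation μ A D) (hs : μ.map (fun x => -x) = μ)
    (hmono : MonotoneOn (fun x : ℝ => (A x).re / x) (Ioi 0)) {α β : ℝ} (hα : 0 ≤ α) (hαβ : α < β)
    (hsupp : ∀ x, x ∈ μ.support ↔ α ≤ |x| ∧ |x| ≤ β) :
    ∃ (N : ℕ) (a b : Fin N → ℝ) (f : ℝ → ℝ), HasSqrtDensity μ N a b f ∧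
      (0 ∈ μ.support → N = 1) ∧ (0 ∉ μ.support → N = 2) ∧ ∀ x ∈ μ.support, x ≠ 0 → 0 < f x := by
  have hβ : 0 < β := hα.trans_lt hαβ
  rcases hα.eq_or_lt with rfl | hα0
  · have h0 : (0 : ℝ) ∈ μ.support := (hsupp 0).2 (by simpa using hβ.le)
    obtain ⟨k, hk, hfac, hpos⟩ := h.exists_factor_one hs hmono hβ hsupp
    have := h.hasSqrtDensity_of_factor hs hk hpos (N := 1) (a := fun _ => -β) (b := fun _ => β)
      (fun _ => by linarith) (fun i j hij => absurd hij (by simp [Subsingleton.elim i j])) (by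
        ext x
        simp [hsupp, abs_le]) (fun x hx hx0 => by
        have hxβ := abs_le.1 ((hsupp x).1 hx).2
        rw [hfac _ (abs_pos.2 hx0), Fin.prod_univ_one, sq_abs,
          abs_of_nonneg (show 0 ≤ (β - x) * (x - -β) by nlinarith)]
        ring)
    exact ⟨1, _, _, _, this.1, fun _ => rfl, fun hc => absurd h0 hc, this.2⟩
  · have h0 : (0 : ℝ) ∉ μ.support := fun hc => by
      have := ((hsupp 0).1 hc).1
      rw [abs_zero] at this
      linarith
    obtain ⟨k, hk, hfac, hpos⟩ := h.exists_factor_two hs hmono hα0 hαβ hsupp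
    have := h.hasSqrtDensity_of_factor hs hk hpos (N := 2) (a := ![-β, α]) (b := ![-α, β])
      (fun j => by fin_cases j <;> simp [hαβ])
      (fun i j hij => by fin_cases i <;> fin_cases j <;> simp_all) (by
        ext x
        simp only [hsupp, mem_iUnion, Fin.exists_fin_two, mem_Icc, Matrix.cons_val_zero,
          Matrix.cons_val_one]
        grind) (fun x hx hx0 => by
        obtain ⟨h1, h2⟩ := (hsupp x).1 hx
        have h3 : 0 ≤ β ^ 2 - x ^ 2 := by
          rw [← sq_abs x]
          nlinarith [abs_nonneg x]
        have h4 : 0 ≤ x ^ 2 - α ^ 2 := by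
          rw [← sq_abs x]
          nlinarith [abs_nonneg x]
        -- For two intervals the product is negative inside the support, one factor being positive
        -- and the other negative; the absolute value in the density absorbs this sign.
        have h5 : ∏ j, (![-α, β] j - x) * (x - ![-β, α] j) =
            -((β ^ 2 - x ^ 2) * (x ^ 2 - α ^ 2)) := by
          rw [Fin.prod_univ_two]
          simp only [Matrix.cons_val_zero, Matrix.cons_val_one]
          ring
        rw [hfac _ (abs_pos.2 hx0), h5, abs_neg, abs_of_nonneg (mul_nonneg h3 h4), sq_abs])
    exact ⟨2, _, _, _, this.1, fun hc => absurd hc h0, fun _ => rfl, this.2⟩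

end HasQuadraticEquation
end ExternalSource


namespace ExternalSource

open Filter Topology

/-! ### Reduction of the vector equilibrium problem to a scalar one -/

theorem measurable_mul_I : Measurable fun y : ℝ => (y : ℂ) * Complex.I := by fun_prop

section Constraint

variable {a : ℝ} {μ₂ : Measure ℂ}

theorem ae_eq_im_mul_I (h : μ₂ ≤ sigma a) : ∀ᵐ z ∂μ₂, (z.im : ℂ) * Complex.I = z := by
  have h1 : ∀ᵐ z ∂sigma a, (z.im : ℂ) * Complex.I = z := by
    refine Measure.ae_smul_measure ?_ _
    rw [ae_map_iff measurable_mul_I.aemeasurable (measurableSet_eq_fun (by fun_prop) (by fun_prop))]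
    exact ae_of_all _ fun y => by simp
  exact h1.filter_mono (ae_mono h)

theorem map_im_le (h : μ₂ ≤ sigma a) :
    μ₂.map Complex.im ≤ ENNReal.ofReal (a / Real.pi) • volume := by
  refine (Measure.map_mono h Complex.measurable_im).trans_eq ?_
  rw [sigma, Measure.map_smul, Measure.map_map Complex.measurable_im measurable_mul_I]
  have : Complex.im ∘ (fun y : ℝ => (y : ℂ) * Complex.I) = id := by
    ext y
    simp
  rw [this, Measure.map_id]

theorem map_im_map_mul_I (h : μ₂ ≤ sigma a) :
    (μ₂.map Complex.im).map (fun y : ℝ => (y : ℂ) * Complex.I) = μ₂ := by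
  rw [Measure.map_map measurable_mul_I Complex.measurable_im]
  exact (Measure.map_congr (ae_eq_im_mul_I h)).trans Measure.map_id

theorem isConstrained_map_im [IsFiniteMeasure μ₂] (h : μ₂ ≤ sigma a) (hf : FiniteLogEnergy μ₂) :
    IsConstrained a (μ₂.map Complex.im) where
  isFinite := inferInstance
  le := map_im_le h
  integrable_log := by
    have h1 : Integrable (fun p : ℂ × ℂ => Real.log ‖p.1 - p.2‖) (μ₂.prod μ₂) := by
      refine hf.2.neg.congr (ae_of_all _ fun p => ?_)
      simp
    rw [integrable_map_measure continuous_log_one_add_abs.aestronglyMeasurable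
      Complex.measurable_im.aemeasurable]
    refine (integrable_log_one_add_norm h1).congr ?_
    filter_upwards [ae_eq_im_mul_I h] with z hz
    rw [Function.comp_apply]
    conv_lhs => rw [← hz]
    simp

theorem log_one_div_norm_sub_mul_I (x y : ℝ) :
    Real.log (1 / ‖(x : ℂ) - y * Complex.I‖) = -(1 / 2 * Real.log (x ^ 2 + y ^ 2)) := by
  rw [one_div, Real.log_inv, Complex.norm_def, Real.log_sqrt (Complex.normSq_nonneg _),
    Complex.normSq_apply]
  simp
  ring_nf

theorem logPotential_eq_neg_imLog (h : μ₂ ≤ sigma a) (x : ℝ) :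
    logPotential μ₂ x = -imLog (μ₂.map Complex.im) (x ^ 2) := by
  rw [logPotential]
  conv_lhs => rw [← map_im_map_mul_I h]
  rw [integral_map measurable_mul_I.aemeasurable (Measurable.aestronglyMeasurable (by fun_prop)),
    imLog, ← integral_neg]
  simp only [log_one_div_norm_sub_mul_I]

end Constraint

section RealAxis

variable {ν : Measure ℝ}

theorem log_one_div_norm_sub (x y : ℝ) :
    Real.log (1 / ‖(x : ℂ) - y‖) = -Real.log (x - y) := by
  rw [one_div, Real.log_inv, ← Complex.ofReal_sub, Complex.norm_real, Real.norm_eq_abs,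
    Real.log_abs]

theorem logPotential_onRealAxis (ν : Measure ℝ) (x : ℝ) :
    logPotential (onRealAxis ν) x = pot ν x := by
  rw [logPotential, onRealAxis, integral_map (by fun_prop)
    (Measurable.aestronglyMeasurable (by fun_prop)), pot, ← integral_neg]
  simp only [log_one_div_norm_sub]

theorem onRealAxis_prod [SFinite ν] :
    (onRealAxis ν).prod (onRealAxis ν) =
      (ν.prod ν).map (Prod.map (fun x : ℝ => (x : ℂ)) fun x : ℝ => (x : ℂ)) :=
  Measure.map_prod_map _ _ (by fun_prop) (by fun_prop)

theorem measurable_log_one_div :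
    Measurable fun p : ℂ × ℂ => Real.log (1 / ‖p.1 - p.2‖) := by fun_prop

theorem mutualEnergy_onRealAxis [SFinite ν] :
    mutualEnergy (onRealAxis ν) (onRealAxis ν) = -∫ p, Real.log (p.1 - p.2) ∂(ν.prod ν) := by
  rw [mutualEnergy, onRealAxis_prod, integral_map (Measurable.aemeasurable (by fun_prop))
    measurable_log_one_div.aestronglyMeasurable, ← integral_neg]
  simp only [Prod.map_fst, Prod.map_snd, log_one_div_norm_sub]

/-- An atom at x charges the diagonal through {x} × {x}, and conversely Fubini makes the diagonal
null when there are no atoms. -/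
theorem finiteLogEnergy_onRealAxis_iff [SFinite ν] :
    FiniteLogEnergy (onRealAxis ν) ↔
      NullSingletonClass ν ∧ Integrable (fun p : ℝ × ℝ => Real.log (p.1 - p.2)) (ν.prod ν) := by
  have hm : Measurable (Prod.map (fun x : ℝ => (x : ℂ)) fun x : ℝ => (x : ℂ)) := by fun_prop
  have h1 : Integrable (fun p : ℂ × ℂ => Real.log (1 / ‖p.1 - p.2‖))
      ((onRealAxis ν).prod (onRealAxis ν)) ↔
      Integrable (fun p : ℝ × ℝ => Real.log (p.1 - p.2)) (ν.prod ν) := by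
    rw [onRealAxis_prod, integrable_map_measure measurable_log_one_div.aestronglyMeasurable
      hm.aemeasurable]
    simp only [Function.comp_def, Prod.map_fst, Prod.map_snd, log_one_div_norm_sub]
    exact integrable_neg_iff
  have h2 : ((onRealAxis ν).prod (onRealAxis ν)) {p : ℂ × ℂ | p.1 = p.2} = 0 ↔
      NullSingletonClass ν := by
    rw [onRealAxis_prod, Measure.map_apply hm (measurableSet_eq_fun measurable_fst measurable_snd)]
    have he : Prod.map (fun x : ℝ => (x : ℂ)) (fun x : ℝ => (x : ℂ)) ⁻¹' {p : ℂ × ℂ | p.1 = p.2} =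
        {p : ℝ × ℝ | p.1 = p.2} := by
      ext p
      simp
    rw [he]
    refine ⟨fun h => ⟨fun x => ?_⟩, fun h => ?_⟩
    · have h3 : (ν.prod ν) ({x} ×ˢ {x}) = 0 :=
        measure_mono_null (by rintro p ⟨hp1, hp2⟩; exact hp1.trans hp2.symm) h
      rw [Measure.prod_prod] at h3
      exact mul_self_eq_zero.1 h3
    · simpa [ae_iff] using ae_fst_ne_snd ν ν
  rw [FiniteLogEnergy, h1, h2]

end RealAxis

section Mixed

variable {a : ℝ} {ν m : Measure ℝ}

theorem IsConstrained.integrable_half_log_prod [IsFiniteMeasure ν] (h : IsConstrained a m)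
    (hν : Integrable (fun x => Real.log (1 + |x|)) ν) :
    Integrable (fun p : ℝ × ℝ => 1 / 2 * Real.log (p.1 ^ 2 + p.2 ^ 2)) (ν.prod m) := by
  have := h.isFinite
  refine Integrable.mono' (g := fun p : ℝ × ℝ =>
    2 * Real.log (1 + |p.1|) + Real.log (1 + |p.2|) + negLog p.2) ?_
    (Measurable.aestronglyMeasurable (by fun_prop)) ?_
  · exact (((hν.const_mul 2).comp_fst m).add (h.integrable_log.comp_snd ν)).add
      (h.integrable_negLog.comp_snd ν)
  · have h1 : ∀ᵐ p ∂(ν.prod m), p.2 ≠ 0 :=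
      Measure.quasiMeasurePreserving_snd.ae h.ae_ne_zero
    filter_upwards [h1] with p hp
    refine (IsConstrained.abs_half_log_le _ (sq_nonneg p.1) hp).trans ?_
    have h2 : Real.log (1 + p.1 ^ 2) ≤ 2 * Real.log (1 + |p.1|) := by
      rw [show 2 * Real.log (1 + |p.1|) = Real.log ((1 + |p.1|) ^ 2) by rw [Real.log_pow]; norm_num]
      refine Real.log_le_log (by positivity) ?_
      nlinarith [sq_abs p.1, abs_nonneg p.1]
    linarith

theorem IsConstrained.integrable_imLog_sq [IsFiniteMeasure ν] (h : IsConstrained a m)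
    (hν : Integrable (fun x => Real.log (1 + |x|)) ν) :
    Integrable (fun x => imLog m (x ^ 2)) ν := by
  have := h.isFinite
  exact (h.integrable_half_log_prod hν).integral_prod_left

theorem mutualEnergy_onRealAxis_right [IsFiniteMeasure ν] {μ₂ : Measure ℂ} [IsFiniteMeasure μ₂]
    (h : μ₂ ≤ sigma a) (hf : FiniteLogEnergy μ₂)
    (hν : Integrable (fun x => Real.log (1 + |x|)) ν) :
    mutualEnergy (onRealAxis ν) μ₂ = -∫ x, imLog (μ₂.map Complex.im) (x ^ 2) ∂ν := by
  have hc := isConstrained_map_im h hf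
  rw [mutualEnergy]
  conv_lhs => rw [← map_im_map_mul_I h]
  rw [onRealAxis, Measure.map_prod_map _ _ (by fun_prop) measurable_mul_I,
    integral_map (Measurable.aemeasurable (by fun_prop))
      measurable_log_one_div.aestronglyMeasurable]
  simp only [Prod.map_fst, Prod.map_snd, log_one_div_norm_sub_mul_I]
  rw [integral_neg, integral_prod _ (hc.integrable_half_log_prod hν)]
  rfl

theorem integrable_log_one_add_abs_of_log_sub [IsFiniteMeasure ν]
    (h : Integrable (fun p : ℝ × ℝ => Real.log (p.1 - p.2)) (ν.prod ν)) :
    Integrable (fun x => Real.log (1 + |x|)) ν :=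
  integrable_log_one_add_norm (E := ℝ) (h.congr (ae_of_all _ fun p => by simp))

/-- For fixed μ₂ the energy is a constant plus the scalar functional, because the mixed term is
linear in ν and can be absorbed into the field. -/
theorem energy_eq {V : Polynomial ℝ} [IsFiniteMeasure ν] {μ₂ : Measure ℂ} [IsFiniteMeasure μ₂]
    (h : μ₂ ≤ sigma a) (hf : FiniteLogEnergy μ₂)
    (hν : Integrable (fun p : ℝ × ℝ => Real.log (p.1 - p.2)) (ν.prod ν))
    (hV : Integrable (fun x : ℝ => V.eval x - a * |x|) ν) :
    Integrable (extField V a (μ₂.map Complex.im)) ν ∧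
      energy V a ν μ₂ = ((mutualEnergy μ₂ μ₂ + (-∫ p, Real.log (p.1 - p.2) ∂(ν.prod ν) +
        ∫ x, extField V a (μ₂.map Complex.im) x ∂ν) : ℝ) : EReal) := by
  have hl := integrable_log_one_add_abs_of_log_sub hν
  have hi := (isConstrained_map_im h hf).integrable_imLog_sq hl
  refine ⟨hV.add hi, ?_⟩
  have h1 : ∫ x, extField V a (μ₂.map Complex.im) x ∂ν =
      ∫ x, (V.eval x - a * |x|) ∂ν + ∫ x, imLog (μ₂.map Complex.im) (x ^ 2) ∂ν :=
    integral_add hV hi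
  rw [energy, if_pos hV, mutualEnergy_onRealAxis, mutualEnergy_onRealAxis_right h hf hl, h1]
  congr 1
  ring

theorem integrable_of_continuous_restrict_Icc {f : ℝ → ℝ} (hf : Continuous f) :
    Integrable f (volume.restrict (Icc (0 : ℝ) 1)) :=
  hf.continuousOn.integrableOn_Icc

/-- The first component of an equilibrium pair solves the scalar problem in the external field
generated by the second component. -/
theorem IsEquilibriumPair.isLogMinimizer {V : Polynomial ℝ} {μ₁ : Measure ℝ} {μ₂ : Measure ℂ}
    (h : IsEquilibriumPair V a μ₁ μ₂) :
    IsConstrained a (μ₂.map Complex.im) ∧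
      IsLogMinimizer (extField V a (μ₂.map Complex.im)) μ₁ := by
  obtain ⟨hadm, hmin⟩ := h
  have : IsProbabilityMeasure μ₁ := ⟨hadm.mass₁⟩
  have : IsFiniteMeasure μ₂ := ⟨by rw [hadm.mass₂]; simp⟩
  have hc := isConstrained_map_im hadm.constraint hadm.finite₂
  obtain ⟨hna, hlog⟩ := finiteLogEnergy_onRealAxis_iff.1 hadm.finite₁
  -- Otherwise the minimal energy would be ⊤, while the uniform measure on [0, 1] paired with the
  -- same μ₂ has finite energy.
  have hV : Integrable (fun x : ℝ => V.eval x - a * |x|) μ₁ := by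
    by_contra hV
    set ν : Measure ℝ := volume.restrict (Icc 0 1) with hν
    have : IsProbabilityMeasure ν := ⟨by simp [hν]⟩
    have hνl : Integrable (fun p : ℝ × ℝ => Real.log (p.1 - p.2)) (ν.prod ν) :=
      integrable_log_sub_prod_restrict
        (integrable_of_continuous_restrict_Icc continuous_log_one_add_abs) 0 1
    have hνV : Integrable (fun x : ℝ => V.eval x - a * |x|) ν :=
      integrable_of_continuous_restrict_Icc (by fun_prop)
    have h1 := hmin ν μ₂ ⟨measure_univ, hadm.mass₂,
      finiteLogEnergy_onRealAxis_iff.2 ⟨inferInstance, hνl⟩, hadm.finite₂, hadm.constraint⟩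
    rw [(energy_eq hadm.constraint hadm.finite₂ hνl hνV).2, energy, if_neg hV, top_le_iff] at h1
    exact EReal.coe_ne_top _ h1
  obtain ⟨hQ, he⟩ := energy_eq hadm.constraint hadm.finite₂ hlog hV
  refine ⟨hc, inferInstance, hna, hlog, hQ, fun ν hν hνa hνl hνQ => ?_⟩
  have hνV : Integrable (fun x : ℝ => V.eval x - a * |x|) ν := by
    refine (hνQ.sub (hc.integrable_imLog_sq (integrable_log_one_add_abs_of_log_sub hνl))).congr
      (ae_of_all _ fun x => ?_)
    simp [extField]
  have h1 := hmin ν μ₂ ⟨measure_univ, hadm.mass₂,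
    finiteLogEnergy_onRealAxis_iff.2 ⟨hνa, hνl⟩, hadm.finite₂, hadm.constraint⟩
  rw [he, (energy_eq hadm.constraint hadm.finite₂ hνl hνV).2, EReal.coe_le_coe_iff] at h1
  linarith

end Mixed

/-- The quotient Q'(x)/(2x) is the derivative of the field in s, evaluated at s = x². -/
theorem monotoneOn_extFieldC_div {V : Polynomial ℝ} {a : ℝ} {m : Measure ℝ}
    (h : IsConstrained a m) (ha : 0 < a)
    (hconv : ConvexOn ℝ (Ioi (0 : ℝ)) (fun x : ℝ => V.eval √x)) :
    MonotoneOn (fun x : ℝ => (extFieldC V a m x / 2).re / x) (Ioi 0) := by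
  refine MonotoneOn.congr (f₁ := fun x => extFieldDeriv V a m √(x ^ 2) / (2 * √(x ^ 2)))
    (fun x hx y hy hxy => (h.strictMonoOn_extFieldDeriv ha hconv).monotoneOn
      (mem_Ioi.2 (pow_pos (mem_Ioi.1 hx) 2)) (mem_Ioi.2 (pow_pos (mem_Ioi.1 hy) 2)) (pow_le_pow_left₀ (le_of_lt hx) hxy 2)) fun x hx => ?_
  have h1 : extFieldC V a m x / 2 = ((extFieldDeriv V a m x / 2 : ℝ) : ℂ) := by
    rw [extFieldC_ofReal V a m hx]
    push_cast
    rfl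
  dsimp only
  rw [Real.sqrt_sq (le_of_lt hx), h1, Complex.ofReal_re, div_div]

end ExternalSource


namespace ExternalSource

/-! ### Support, density and variational conditions for an equilibrium pair -/

theorem IsEquilibriumPair.exists_hasSqrtDensity {V : Polynomial ℝ} {a : ℝ} {μ₁ : Measure ℝ} {μ₂ : Measure ℂ}
    (hVeven : ∀ x : ℝ, V.eval (-x) = V.eval x)
    (hVdeg : 0 < V.natDegree)
    (hVlead : 0 < V.leadingCoeff)
    (ha : 0 < a)
    (hμ : IsEquilibriumPair V a μ₁ μ₂)
    (hconv : ConvexOn ℝ (Ioi (0 : ℝ)) (fun x : ℝ => V.eval √x)) :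
    ∃ (N : ℕ) (α β : Fin N → ℝ) (h : ℝ → ℝ) (ℓ : ℝ),
      HasSqrtDensity μ₁ N α β h ∧
      (0 ∈ μ₁.support → N = 1) ∧
      (0 ∉ μ₁.support → N = 2) ∧
      VariationalConditions V a μ₁ μ₂ ℓ ∧
      singularPoints V a μ₁ μ₂ h ℓ ⊆ {0} := by
  obtain ⟨hm, h⟩ := hμ.isLogMinimizer
  have := h.isProb
  have := h.noAtoms
  set m := μ₂.map Complex.im with hmdef
  have hQ := hm.continuous_extField V
  have hK := h.isCompact_support hQ (IsConstrained.tendsto_extField hVeven hVdeg hVlead)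
  have hs := h.map_neg_eq hQ hK (IsConstrained.extField_neg hVeven)
  have hQconv := hm.strictConvexOn_extField ha hconv
  obtain ⟨α, β, hα, hαβ, hsupp⟩ := h.exists_support_eq hQ hK hs hQconv
  obtain ⟨D, hD⟩ := hasQuadraticEquation hm h hK hs hVeven
  obtain ⟨N, b, c, f, hf, hN1, hN2, hpos⟩ :=
    hD.exists_hasSqrtDensity hs (monotoneOn_extFieldC_div hm ha hconv) hα hαβ hsupp
  -- The constant ℓ is subtracted in the variational conditions, so it is minus the Robin constant.
  have hrhs : ∀ x : ℝ, variationalRHS V a μ₂ (-robin (extField V a m) μ₁) x =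
      robin (extField V a m) μ₁ - extField V a m x := fun x => by
    rw [variationalRHS, logPotential_eq_neg_imLog hμ.1.constraint, extField]
    ring
  have hoff : ∀ x ∉ μ₁.support, variationalRHS V a μ₂ (-robin (extField V a m) μ₁) x <
      2 * logPotential (onRealAxis μ₁) x := fun x hx => by
    have := h.robin_lt_of_notMem_support hQ hK hs (IsConstrained.extField_neg hVeven) hQconv hx
    rw [hrhs, logPotential_onRealAxis]
    linarith
  refine ⟨N, b, c, f, -robin (extField V a m) μ₁, hf, hN1, hN2,
    ⟨fun x hx => ?_, fun x hx => (hoff x hx).le⟩, ?_⟩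
  · have := (h.pot_eq_on_support hQ hx).2
    rw [hrhs, logPotential_onRealAxis]
    linarith
  · rintro x (⟨hx, hx0⟩ | ⟨hx, hx0⟩)
    · by_contra hne
      exact hx0 (hpos x hx hne)
    · exact absurd (hoff x hx) hx0

end ExternalSource

theorem mainTheorem5 (V : Polynomial ℝ) (a : ℝ) (μ₁ : Measure ℝ) (μ₂ : Measure ℂ)
    (hVeven : ∀ x : ℝ, V.eval (-x) = V.eval x)
    (hVdeg : 0 < V.natDegree)
    (hVlead : 0 < V.leadingCoeff)
    (ha : 0 < a)
    (hμ : ExternalSource.IsEquilibriumPair V a μ₁ μ₂)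
    (hconv : ConvexOn ℝ (Ioi (0 : ℝ)) (fun x : ℝ => V.eval √x)) :
    ∃ (N : ℕ) (α β : Fin N → ℝ) (h : ℝ → ℝ) (ℓ : ℝ),
      ExternalSource.HasSqrtDensity μ₁ N α β h ∧
      (0 ∈ μ₁.support → N = 1) ∧
      (0 ∉ μ₁.support → N = 2) ∧
      ExternalSource.VariationalConditions V a μ₁ μ₂ ℓ ∧
      ExternalSource.singularPoints V a μ₁ μ₂ h ℓ ⊆ {0} :=
  hμ.exists_hasSqrtDensity hVeven hVdeg hVlead ha hconv
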